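/- **Conventions.** $\mathbb P=\{1,2,\dots\}$, $[m]=\{1,\dots,m\}$, tuples are compared entrywise ($\mathbf x<\mathbf y$ means $\mathbf x\le\mathbf y$, $\mathbf x\ne\mathbf y$), $\delta_t$ is the $t$-th unit vector, $x^{[t]}$ is the $t$-th entry of a tuple $x$, and $\binom{\mathbf x}{\mathbf y}=\prod_i\binom{x_i}{y_i}$ with $\binom{x}{y}=0$ for $y<0$. The colex order on finite sets of equal size is: $A<B$ iff the largest element of the symmetric difference lies in $B$. Fix $n,N\in\mathbb P$ and $\mathbf a=(a_1,\dots,a_n)\in\mathbb P^n$. **Complexes.** A pure color-compressed $\mathbf a$-balanced complex is a pair $(\Delta,\pi)$: $\Delta$ is a pure simplicial complex on a finite non-empty vertex set $V$, of dimension $a_1+\dots+a_n-1$, and $\pi=(V_1,\dots,V_n)$ is an ordered partition of $V$ into non-empty linearly ordered classes with $|F\cap V_i|\le a_i$ for all faces $F$ and all $i$, such that for each face $F$ and each $t\in[n]$ the sets $F'\cap V_t$, over faces $F'$ with $|F'\cap V_t|=|F\cap V_t|$ and $F'\setminus V_t=F\setminus V_t$, form a colex initial segment of $\binom{V_t}{|F\cap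 V_t|}$. Two such pairs are isomorphic if a bijection of the vertex sets maps the $i$-th class onto the $i$-th class for each $i$ and matches the faces. **Shedding tree.** Start with a planted binary tree consisting of a root and one child, the child labeled $(\mathbf a,\Delta,\pi,(|V_1|,\dots,|V_n|))$. For $t=n,n-1,\dots,1$ in turn: as long as some terminal vertex (leaf other than the root) has a label $(\mathbf a',\Delta',\pi',\lambda')$ such that $\Delta'$ is not $t$-factorizable, i.e. not the join of the complex generated by the $a'_t$-subsets of $V'_t$ with some non-empty complex, relabel that vertex by $t$ and give it a left and a right child with labels $(\mathbf a',\Delta'_1,\pi'\cap W_1,\kappa_1)$ and $(\mathbf a'-\delta_t,\Delta'_2,\pi'\cap W_2,\kappa_2)$. Here $\Delta'_1$, $\Delta'_2$ are the deletion and the link in $\Delta'$ of the largest element of $V'_t$, $W_j$ is the vertex set of $\Delta'_j$, and the $i$-th entry of $\kappa_j$ is $|V'_i\cap W_j|$ if $V'_i\cap W_j$ is non-empty and the $i$-th entry of $\lambda'-\delta_t$ otherwise. The final tree does not depend on the choices. The tree *induced by* the shedding tree of $(\Delta,\pi)$ is obtained by keeping only the last entry of the label of each terminal vertex and labeling the root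 by $\mathbf a$. **Labeled trees.** Let $T$ be a planar trivalent planted binary tree with root $r_0$, set $Y$ of trivalent vertices and set $L$ of terminal vertices, and let $\varphi$ label $r_0$ by $\mathbf a$, each $y\in Y$ by an element of $[n]$, and each $u\in L$ by an element of $\mathbb P^n$. Labeled trees are considered up to isomorphism. Every vertex is an ancestor and a descendant of itself. The *left-weight* is $\omega(u)=\varphi(u)$ for $u\in L$ and $\omega(y)=\omega(y_{\rm left})+\delta_{\varphi(y)}$ for $y\in Y$. The map $\nu$ takes the value $\mathbf a$ at the child of $r_0$, and $\nu(y_{\rm left})=\nu(y)$, $\nu(y_{\rm right})=\nu(y)-\delta_{\varphi(y)}$. The pair $(T,\varphi)$ is an *$\mathbf a$-Macaulay tree of $N$* if: (a) $\varphi(y)\ge\varphi(y')$ for $y,y'\in Y$ with $y'$ a descendant of $y$; (b) for $y\in Y$ and $t>\varphi(y)$, $\varphi^{[t]}$ is constant on the terminal descendants of $y$; (c) $\omega(y_{\rm left})\ge\omega(y_{\rm right})$ for $y\in Y$; (d) $\varphi(u)\ge\nu(u)>\mathbf 0$ for $u\in L$; (e) if $y\in Y$, $t=\varphi(y)$ and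 $\nu^{[t]}(y)=1$, then $\omega^{[t]}(x)=\omega^{[t]}(y)-1$ for all descendants $x$ of $y_{\rm right}$; (f) $N=\sum_{u\in L}\binom{\varphi(u)}{\nu(u)}$. For $0\le t\le n$, a vertex $x\in Y\cup L$ is *$t$-leading* if $x\in L$ or $\varphi(x)\le t$, and its parent is $r_0$ or has label $>t$. The tree is *condensed* if there is no $y\in Y$ such that the labeled subtrees of descendants of $y_{\rm left}$ and of $y_{\rm right}$ are isomorphic and $y_{\rm left},y_{\rm right}$ are both $(\varphi(y)-1)$-leading. For $x\in Y\cup L$ and $t\in[n]$, let $x=x_1,x_2,\dots$ be obtained by repeatedly passing to the right child, let $k=k(x,t)$ be minimal with $x_k\in L$ or $\varphi(x_k)\ne t$, and put $e_t(x)=x_k$. The tree is *compressed-like* if for every $y\in Y$ with $\varphi(y)=t$: (i) whenever $y$ is a descendant of $x_{\rm left}$ with $x\in Y$, $\varphi(x)=t$, the path $x=x_0,x_1,\dots,x_\ell=y_{\rm right}$ satisfies $\omega^{[t]}(x_i)=\omega^{[t]}(x)-i$ for all $i\in[\ell]$; (ii) $\omega^{[t']}(e_t(y_{\rm left}))\ge\omega^{[t']}(y_{\rm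 right})$ for all $t'\ne t$. The *$t$-signature* $\xi^{(t)}(x)$ of $x\in Y\cup L$ is the $a_t$-set $P\cup Q\cup R$, where $P$ is the set of all $\omega^{[t]}(v)$ with $v\in Y$, $\varphi(v)=t$ and both $v$ and $v_{\rm right}$ ancestors of $x$; $Q=\{\omega^{[t]}(x_i):1\le i\le k-1\}$ with $k=k(x,t)$; and $R$ is the colex-largest subset of $[\omega^{[t]}(x_k)]$ of size $a_t-|P|-(k-1)$. Let $x$ be $j$-leading, $j<i\le n$, such that the $i$-th entry of $\mathbf a-\nu(x)$ is positive. Define $\zeta^i_j(x)$ recursively: $\zeta^{i}_{i-1}(x)$ is the immediate predecessor of $x$ among the $(i-1)$-leading vertices in depth-first order (each $y \in Y$ first, then the descendants of $y_{\rm left}$, then those of $y_{\rm right}$). For $j+1<i$, let $\tilde x$ be the $(j+1)$-leading ancestor of $x$; then $\zeta^i_j(x)$ is the first vertex, in depth-first order, among the $j$-leading descendants $z$ of $\zeta^i_{j+1}(\tilde x)$ with $\xi^{(j+1)}(z)\ge\xi^{(j+1)}(x)$ in colex order. A compressed-like tree is *compatible* if for all $t<i$ in $[n]$ and all $t$-leading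 $x$ for which the $i$-th entry of $\mathbf a-\nu(x)$ is positive, $\zeta^i_t(x)$ exists and $\xi^{(t)}(x)\le\xi^{(t)}(\zeta^i_t(x))$ in colex order. A *generalized $\mathbf a$-Macaulay representation of $N$* is a condensed, compressed-like, compatible $\mathbf a$-Macaulay tree of $N$. **Theorem.** Let $n,N\in\mathbb P$ and $\mathbf a\in\mathbb P^n$. 1. An $\mathbf a$-Macaulay tree $(T,\varphi)$ of $N$ is the tree induced by the shedding tree of some pure color-compressed $\mathbf a$-balanced complex with $N$ facets if and only if $(T,\varphi)$ is condensed, compressed-like, and compatible. 2. Sending a complex to the tree induced by its shedding tree gives a well-defined bijection from the isomorphism classes of pure color-compressed $\mathbf a$-balanced complexes with $N$ facets to the generalized $\mathbf a$-Macaulay representations of $N$. This holds whether or not isomorphisms are required to be increasing on each class $V_i$: two isomorphic such complexes are also isomorphic by a bijection that is increasing on every class. -/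

import Mathlib

open Finset

universe u

namespace GenMac

section Trees

/-! ### Labeled trivalent planted binary trees

A (planar) trivalent planted binary tree with its root `r₀` removed is a full binary tree.  We
record, for the colours `[n]` (here `Fin n`, so the colour `i + 1` of `[n]` is `i : Fin n`), the
label in `[n]` of each trivalent vertex and the label of each terminal vertex.  Equality of terms
is isomorphism of labeled planar trees.  The label of `r₀` is always the type `a`, which is a
separate argument below. -/

/-- Planted binary trees (root removed), trivalent vertices labeled by colours, terminal vertices
labeled by elements of `α`; `node t l r` has left subtree `l` and right subtree `r`. -/
inductive LTree (n : ℕ) (α : Type u) : Type u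
  | leaf (x : α) : LTree n α
  | node (t : Fin n) (l r : LTree n α) : LTree n α

/-- Relabel the terminal vertices. -/
def LTree.map {n : ℕ} {α β : Type*} (f : α → β) : LTree n α → LTree n β
  | .leaf x => .leaf (f x)
  | .node t l r => .node t (l.map f) (r.map f)

/-- A vertex (in `Y ∪ L`) is addressed by the list of turns leading to it from the unique child of
the root (`false` is left, `true` is right); `T.sub p` is the subtree formed by the descendants of
the vertex `p`, and is `none` if there is no such vertex.  Hence `p` is an ancestor of `q` iff
`p <+: q`, and the depth-first order is the lexicographic order on lists. -/
def LTree.sub {n : ℕ} {α : Type*} : LTree n α → List Bool → Option (LTree n α)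
  | T, [] => some T
  | .leaf _, _ :: _ => none
  | .node _ l _, false :: p => l.sub p
  | .node _ _ r, true :: p => r.sub p

/-- Trees whose terminal vertices are labeled by `n`-tuples. -/
abbrev MTree (n : ℕ) := LTree n (Fin n → ℕ)

variable {n : ℕ}

/-- The left-weight `ω(v)` of the top vertex `v` of a tree. -/
def MTree.lw : MTree n → Fin n → ℕ
  | .leaf x => x
  | .node t l _ => MTree.lw l + Pi.single t 1

/-- The left-weight of the vertex `p` of `T`. -/
def weightAt (T : MTree n) (p : List Bool) : Fin n → ℕ :=
  ((T.sub p).map MTree.lw).getD 0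

/-- The label `ν` of the vertex `p` in the splitting tree induced by `T`, where `v` is the label of
the top vertex. -/
def splitLabel : MTree n → (Fin n → ℤ) → List Bool → Fin n → ℤ
  | .node _ l _, v, false :: p => splitLabel l v p
  | .node t _ r, v, true :: p => splitLabel r (v - Pi.single t 1) p
  | _, v, _ => v

/-- `ν` for the `a`-splitting tree induced by `T`. -/
def nu (a : Fin n → ℕ) (T : MTree n) (p : List Bool) : Fin n → ℤ :=
  splitLabel T (fun i => (a i : ℤ)) p

/-- Binomial coefficient, zero for a negative lower entry. -/
def binom (x : ℕ) (y : ℤ) : ℕ := if y < 0 then 0 else x.choose y.toNat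

/-- `∑_{u ∈ L} binom(φ(u), ν(u))`, where `v` is the value of `ν` at the top vertex. -/
def leafSum : MTree n → (Fin n → ℤ) → ℕ
  | .leaf x, v => ∏ i, binom (x i) (v i)
  | .node t l r, v => leafSum l v + leafSum r (v - Pi.single t 1)

/-- `(T, φ)` is an `a`-Macaulay tree of `N`. -/
structure IsMacaulayTree (a : Fin n → ℕ) (N : ℕ) (T : MTree n) : Prop where
  leaf_pos : ∀ p x, T.sub p = some (.leaf x) → ∀ i, 0 < x i
  antitone : ∀ p q t l r t' l' r', T.sub p = some (.node t l r) →
    T.sub (p ++ q) = some (.node t' l' r') → t' ≤ t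
  orderly : ∀ p t l r, T.sub p = some (.node t l r) →
    ∀ q q' x x', T.sub (p ++ q) = some (.leaf x) → T.sub (p ++ q') = some (.leaf x') →
    ∀ i, t < i → x i = x' i
  proper : ∀ p t l r, T.sub p = some (.node t l r) → MTree.lw r ≤ MTree.lw l
  nu_le : ∀ p x, T.sub p = some (.leaf x) → ∀ i, nu a T p i ≤ (x i : ℤ)
  nu_pos : ∀ p x, T.sub p = some (.leaf x) → 0 < nu a T p
  right_weight : ∀ p t l r, T.sub p = some (.node t l r) → nu a T p t = 1 →
    ∀ q S, r.sub q = some S → MTree.lw S t + 1 = MTree.lw (.node t l r) t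
  sum_eq : N = leafSum T (fun i => (a i : ℤ))

/-- `p` is a `k`-leading vertex of `T`, for `k ∈ {0, …, n}`.  (The colour `t : Fin n` stands for
`t + 1 ∈ [n]`, so "label `≤ k`" reads `t < k` and "label `> k`" reads `k ≤ t`.) -/
def IsLeading (T : MTree n) (k : ℕ) (p : List Bool) : Prop :=
  (∃ S, T.sub p = some S ∧ ∀ t l r, S = .node t l r → (t : ℕ) < k) ∧
  ∀ q b t l r, p = q ++ [b] → T.sub q = some (.node t l r) → k ≤ (t : ℕ)

/-- `p` is a cloning vertex of `T`. -/
def IsCloning (T : MTree n) (p : List Bool) : Prop :=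
  ∃ t l r, T.sub p = some (.node t l r) ∧ l = r ∧
    IsLeading T t (p ++ [false]) ∧ IsLeading T t (p ++ [true])

/-- `T` has no cloning vertices. -/
def IsCondensed (T : MTree n) : Prop := ∀ p, ¬ IsCloning T p

/-- For the right relative sequence `x₁, …, x_ℓ` of the top vertex, and `k` smallest such that `x_k`
is terminal or has label different from `t`: the subtree at `x_k`. -/
def runEnd (t : Fin n) : MTree n → MTree n
  | .leaf x => .leaf x
  | .node s l r => if s = t then runEnd t r else .node s l r

/-- With `x₁, …, x_k` as in `runEnd`: the set `{ω^[t](x_i) : 1 ≤ i ≤ k - 1}`. -/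
def runWeights (t : Fin n) : MTree n → Finset ℕ
  | .leaf _ => ∅
  | .node s l r => if s = t then insert (MTree.lw (.node s l r) t) (runWeights t r) else ∅

/-- With `x₁, …, x_k` as in `runEnd`: the number `k - 1`. -/
def runLength (t : Fin n) : MTree n → ℕ
  | .leaf _ => 0
  | .node s _ r => if s = t then runLength t r + 1 else 0

/-- `T` is compressed-like. -/
structure IsCompressedLike (T : MTree n) : Prop where
  /-- `x` is the vertex `q`, `y` is the vertex `q ++ false :: s`, and the `i`-th vertex of the path
  from `x` to `y_right` is a prefix of the address of `y_right`. -/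
  path : ∀ q s t l r l' r', T.sub q = some (.node t l r) →
    T.sub (q ++ false :: s) = some (.node t l' r') →
    ∀ i, 1 ≤ i → i ≤ s.length + 2 →
      weightAt T ((q ++ false :: s ++ [true]).take (q.length + i)) t + i = weightAt T q t
  run : ∀ p t l r, T.sub p = some (.node t l r) →
    ∀ t', t' ≠ t → MTree.lw r t' ≤ MTree.lw (runEnd t l) t'

/-- `ψ(p)`: the pairs `(ω^[φ(v)](v), φ(v))`, over the trivalent vertices `v` such that both `v` and
its right child are ancestors of `p`. -/
def psi : MTree n → List Bool → Finset (ℕ × Fin n)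
  | .node _ l _, false :: p => psi l p
  | .node t l r, true :: p => insert (MTree.lw (.node t l r) t, t) (psi r p)
  | _, _ => ∅

/-- `ψ^(t)(p) = {s : (s, t) ∈ ψ(p)}`. -/
def psiColor (T : MTree n) (t : Fin n) (p : List Bool) : Finset ℕ :=
  ((psi T p).filter fun z => z.2 = t).image Prod.fst

/-- The `t`-signature `ξ^(t)(p)`.  With `x₁, …, x_k` as in `runEnd` for the vertex `p`, it is the
union of `ψ^(t)(p)`, of `{ω^[t](x_i) : i < k}`, and of the colex-largest subset of `[ω^[t](x_k)]`
that makes the union an `a_t`-set; the colex-largest `m`-subset of `[w]` is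
`{w - m + 1, …, w}`. -/
def signature (a : Fin n → ℕ) (T : MTree n) (t : Fin n) (p : List Bool) : Finset ℕ :=
  match T.sub p with
  | none => ∅
  | some S =>
    psiColor T t p ∪ runWeights t S ∪
      Finset.Ioc
        (MTree.lw (runEnd t S) t - (a t - (psiColor T t p).card - runLength t S))
        (MTree.lw (runEnd t S) t)

/-- `IsZeta a T s j x y` says that `ζ^i_j(x)` is defined and equal to `y`, where `i = s + 1` is the
colour represented by `s : Fin n` and `0 ≤ j < i`.  For `j = i - 1` it is the immediate predecessor
of `x` among the `j`-leading vertices in depth-first order.  In the step from `j + 1` to `j`, `x'` is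
the `(j + 1)`-leading ancestor of `x` and `y' = ζ^i_{j+1}(x')`. -/
inductive IsZeta (a : Fin n → ℕ) (T : MTree n) (s : Fin n) :
    ℕ → List Bool → List Bool → Prop
  | base (x y : List Bool) (hx : IsLeading T s x)
      (hy : IsGreatest {z | IsLeading T s z ∧ z < x} y) : IsZeta a T s s x y
  | step (j : Fin n) (hj : j < s) (x x' y' y : List Bool)
      (hx : IsLeading T j x) (hx' : IsLeading T (j + 1) x') (hxx' : x' <+: x)
      (hz : IsZeta a T s (j + 1) x' y')
      (hy : IsLeast {z | IsLeading T j z ∧ y' <+: z ∧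
        toColex (signature a T j x) ≤ toColex (signature a T j z)} y) : IsZeta a T s j x y

/-- `T` is compatible.  Here `t < i` in `[n]` are represented by `c < s` in `Fin n`, so that
`t = c + 1` as a natural number. -/
def IsCompatible (a : Fin n → ℕ) (T : MTree n) : Prop :=
  ∀ c s : Fin n, c < s → ∀ x, IsLeading T (c + 1) x → 0 < (a s : ℤ) - nu a T x s →
    ∃ y, IsZeta a T s (c + 1) x y ∧
      toColex (signature a T c x) ≤ toColex (signature a T c y)

/-- `T` is a generalized `a`-Macaulay representation of `N` (for positive `N`). -/
structure IsGenMacaulayRep (a : Fin n → ℕ) (N : ℕ) (T : MTree n) : Prop where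
  macaulay : IsMacaulayTree a N T
  condensed : IsCondensed T
  compressedLike : IsCompressedLike T
  compatible : IsCompatible a T

end Trees

section Complexes

/-- A finite simplicial complex on a non-empty vertex set `V`, with an ordered partition
`(V₁, …, V_n)` of `V` into non-empty classes, each of which is linearly ordered.  The partition is
given by `color`, and the linear orders on the classes by the partial order on `V` that is their
disjoint union. -/
structure OrderedColoredComplex (n : ℕ) : Type (u + 1) where
  V : Type u
  [fintype : Fintype V]
  [nonempty : Nonempty V]
  [order : PartialOrder V]
  color : V → Fin n
  color_surjective : Function.Surjective color
  comparable_iff : ∀ v w, (v ≤ w ∨ w ≤ v) ↔ color v = color w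
  complex : AbstractSimplicialComplex V

attribute [instance] OrderedColoredComplex.fintype OrderedColoredComplex.nonempty
  OrderedColoredComplex.order

variable {n : ℕ}

namespace OrderedColoredComplex

open Classical in
/-- The class `V_t`. -/
noncomputable def part (K : OrderedColoredComplex.{u} n) (t : Fin n) : Finset K.V :=
  univ.filter fun v => K.color v = t

open Classical in
/-- All faces, including the empty face. -/
noncomputable def faces (K : OrderedColoredComplex.{u} n) : Finset (Finset K.V) :=
  univ.filter fun F => F = ∅ ∨ F ∈ K.complex

open Classical in
/-- The facets, i.e. the maximal faces. -/
noncomputable def facets (K : OrderedColoredComplex.{u} n) : Finset (Finset K.V) :=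
  K.faces.filter fun F => ∀ G ∈ K.faces, F ⊆ G → F = G

/-- All facets have the same dimension. -/
def IsPure (K : OrderedColoredComplex.{u} n) : Prop :=
  ∀ F ∈ K.facets, ∀ G ∈ K.facets, F.card = G.card

open Classical in
/-- `a`-balanced: coloured of type `a`, and of dimension `|a| - 1`. -/
def IsBalanced (K : OrderedColoredComplex.{u} n) (a : Fin n → ℕ) : Prop :=
  (∀ F ∈ K.faces, ∀ t, (F ∩ K.part t).card ≤ a t) ∧ K.faces.sup Finset.card = ∑ t, a t

open Classical in
/-- The traces on `V_t` of the faces that agree with `F` off `V_t` and have as many vertices as `F`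
in `V_t`. -/
noncomputable def traces (K : OrderedColoredComplex.{u} n) (F : Finset K.V) (t : Fin n) :
    Finset (Finset K.V) :=
  (K.faces.filter fun F' =>
    (F' ∩ K.part t).card = (F ∩ K.part t).card ∧ F' \ K.part t = F \ K.part t).image
      fun F' => F' ∩ K.part t

open Classical in
/-- Colour-compressed: each `K.traces F t` is a colex initial segment of the family of subsets of
`V_t` of size `|F ∩ V_t|`. -/
def IsColorCompressed (K : OrderedColoredComplex.{u} n) : Prop :=
  ∀ F ∈ K.faces, ∀ t, ∀ A ∈ K.traces F t, ∀ B ∈ (K.part t).powersetCard (F ∩ K.part t).card,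
    toColex B ≤ toColex A → B ∈ K.traces F t

/-- An isomorphism: a bijection of the vertex sets which preserves the ordered partition and
matches the faces. -/
def IsIso (K K' : OrderedColoredComplex.{u} n) (e : K.V ≃ K'.V) : Prop :=
  (∀ v, K'.color (e v) = K.color v) ∧ ∀ F : Finset K.V, F ∈ K.faces ↔ F.map e.toEmbedding ∈ K'.faces

/-- `K` and `K'` are isomorphic. -/
def Isomorphic (K K' : OrderedColoredComplex.{u} n) : Prop := ∃ e : K.V ≃ K'.V, IsIso K K' e

/-- `K` and `K'` are isomorphic by an isomorphism that is increasing on each class. -/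
def OrderIsomorphic (K K' : OrderedColoredComplex.{u} n) : Prop :=
  ∃ e : K.V ≃ K'.V, IsIso K K' e ∧ ∀ v w, v ≤ w ↔ e v ≤ e w

theorem Isomorphic.refl (K : OrderedColoredComplex.{u} n) : Isomorphic K K :=
  ⟨Equiv.refl _, fun _ => rfl, fun F => by simp⟩

theorem Isomorphic.symm {K K' : OrderedColoredComplex.{u} n} (h : Isomorphic K K') :
    Isomorphic K' K := by
  obtain ⟨e, h1, h2⟩ := h
  refine ⟨e.symm, fun v => ?_, fun F => ?_⟩
  · rw [← h1, Equiv.apply_symm_apply]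
  · rw [h2, Finset.map_map]
    have : e.symm.toEmbedding.trans e.toEmbedding = Function.Embedding.refl _ := by
      ext x; simp
    rw [this, Finset.map_refl]

theorem Isomorphic.trans {K K' K'' : OrderedColoredComplex.{u} n} (h : Isomorphic K K')
    (h' : Isomorphic K' K'') : Isomorphic K K'' := by
  obtain ⟨e, h1, h2⟩ := h
  obtain ⟨e', h1', h2'⟩ := h'
  refine ⟨e.trans e', fun v => ?_, fun F => ?_⟩
  · rw [Equiv.trans_apply, h1', h1]
  · rw [h2, h2', Finset.map_map]
    rfl

end OrderedColoredComplex

/-- The label `(a', Δ', π', λ')` of a terminal vertex in a shedding sequence.  The third entry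
`π' = (V₁', …, V_n')` is always the trace of the ordered partition on the vertex set of `Δ'`; it
is `SheddingLabel.part`. -/
structure SheddingLabel (n : ℕ) (V : Type u) where
  type : Fin n → ℕ
  faces : Finset (Finset V)
  lam : Fin n → ℕ

section Shedding

variable {V : Type u}

open Classical in
/-- The deletion of a vertex. -/
noncomputable def deletion (Δ : Finset (Finset V)) (v : V) : Finset (Finset V) :=
  Δ.filter fun F => v ∉ F

open Classical in
/-- The link of a vertex. -/
noncomputable def link (Δ : Finset (Finset V)) (v : V) : Finset (Finset V) :=
  Δ.filter fun F => v ∉ F ∧ insert v F ∈ Δ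

theorem card_deletion_lt {Δ : Finset (Finset V)} {v : V} (h : {v} ∈ Δ) :
    (deletion Δ v).card < Δ.card := by
  classical
  apply Finset.card_lt_card
  rw [Finset.ssubset_iff_of_subset (by intro F; simp +contextual [deletion])]
  exact ⟨{v}, h, by simp [deletion]⟩

theorem card_link_lt {Δ : Finset (Finset V)} {v : V} (h : {v} ∈ Δ) :
    (link Δ v).card < Δ.card := by
  classical
  apply Finset.card_lt_card
  rw [Finset.ssubset_iff_of_subset (by intro F; simp +contextual [link])]
  exact ⟨{v}, h, by simp [link]⟩

variable [Fintype V]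

open Classical in
/-- The vertices of colour `t` of the complex with faces `Δ`. -/
noncomputable def partOf (col : V → Fin n) (Δ : Finset (Finset V)) (t : Fin n) : Finset V :=
  univ.filter fun v => col v = t ∧ {v} ∈ Δ

theorem mem_partOf {col : V → Fin n} {Δ : Finset (Finset V)} {t : Fin n} {v : V} :
    v ∈ partOf col Δ t ↔ col v = t ∧ {v} ∈ Δ := by
  simp [partOf]

open Classical in
/-- The complex generated by the `k`-subsets of `S`. -/
noncomputable def genBy (S : Finset V) (k : ℕ) : Finset (Finset V) :=
  univ.filter fun A => ∃ B ∈ S.powersetCard k, A ⊆ B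

open Classical in
/-- `Δ` is the join of the complex generated by the `k`-subsets of `S` and some non-empty
simplicial complex with disjoint vertex set. -/
def IsFactorizable (Δ : Finset (Finset V)) (S : Finset V) (k : ℕ) : Prop :=
  ∃ Γ : Finset (Finset V), Γ.Nonempty ∧ (∀ G ∈ Γ, ∀ G' ⊆ G, G' ∈ Γ) ∧
    (∀ A ∈ genBy S k, ∀ G ∈ Γ, Disjoint A G) ∧
    Δ = Finset.image₂ (fun A G => A ∪ G) (genBy S k) Γ

/-- `κ(π ∩ W, x)`, where `W` is the vertex set of `Δ`. -/
noncomputable def kappa (col : V → Fin n) (Δ : Finset (Finset V)) (x : Fin n → ℕ) : Fin n → ℕ :=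
  fun i => if (partOf col Δ i).card = 0 then x i else (partOf col Δ i).card

/-- The label of the left child when a vertex labeled `s` is split at the vertex `v` of colour
`t`. -/
noncomputable def SheddingLabel.left (col : V → Fin n) (s : SheddingLabel n V) (t : Fin n) (v : V) :
    SheddingLabel n V where
  type := s.type
  faces := deletion s.faces v
  lam := kappa col (deletion s.faces v) (s.lam - Pi.single t 1)

/-- The label of the right child when a vertex labeled `s` is split at the vertex `v` of colour
`t`. -/
noncomputable def SheddingLabel.right (col : V → Fin n) (s : SheddingLabel n V) (t : Fin n)
    (v : V) : SheddingLabel n V where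
  type := s.type - Pi.single t 1
  faces := link s.faces v
  lam := kappa col (link s.faces v) (s.lam - Pi.single t 1)

/-- The entry `V_t'` of `π'`. -/
noncomputable def SheddingLabel.part (col : V → Fin n) (s : SheddingLabel n V) (t : Fin n) :
    Finset V :=
  partOf col s.faces t

variable [PartialOrder V]

/-- The terminal vertex labeled `s` has to be split at colour `t`: its complex is not
`t`-factorizable (and `V_t'` has a maximal element, which is automatic for pure balanced
complexes). -/
def SheddingLabel.MustSplit (col : V → Fin n) (s : SheddingLabel n V) (t : Fin n) : Prop :=
  ¬ IsFactorizable s.faces (s.part col t) (s.type t) ∧ ∃ v, IsGreatest (s.part col t : Set V) v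

theorem SheddingLabel.MustSplit.mem_faces {col : V → Fin n} {s : SheddingLabel n V} {t : Fin n}
    (h : s.MustSplit col t) : {h.2.choose} ∈ s.faces := by
  exact (mem_partOf.1 (Finset.mem_coe.1 h.2.choose_spec.1)).2

open Classical in
/-- The tree grown by the shedding algorithm below a terminal vertex labeled `s`, when only the
colours `1, …, t` remain to be treated.  While the complex is not `t`-factorizable, the vertex gets
the label `t` and is split by deletion and link at the maximal element of `V_t'`; then the algorithm
goes on with colour `t - 1`.  (Different terminal vertices do not interact, so the order in which
the algorithm treats them is immaterial.) -/
noncomputable def shed (col : V → Fin n) : ℕ → SheddingLabel n V → LTree n (SheddingLabel n V)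
  | 0, s => .leaf s
  | t + 1, s =>
    if ht : t < n then
      if h : s.MustSplit col ⟨t, ht⟩ then
        .node ⟨t, ht⟩ (shed col (t + 1) (s.left col ⟨t, ht⟩ h.2.choose))
          (shed col (t + 1) (s.right col ⟨t, ht⟩ h.2.choose))
      else shed col t s
    else shed col t s
termination_by t s => (t, s.faces.card)
decreasing_by
  · exact Prod.Lex.right _ (card_deletion_lt h.mem_faces)
  · exact Prod.Lex.right _ (card_link_lt h.mem_faces)
  · exact Prod.Lex.left _ _ (Nat.lt_succ_self t)
  · exact Prod.Lex.left _ _ (Nat.lt_succ_self t)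

end Shedding

namespace OrderedColoredComplex

/-- The shedding tree of `K`, as a complex of type `a`. -/
noncomputable def sheddingTree (K : OrderedColoredComplex.{u} n) (a : Fin n → ℕ) :
    LTree n (SheddingLabel n K.V) :=
  shed K.color n ⟨a, K.faces, fun t => (K.part t).card⟩

/-- The Macaulay tree induced by the shedding tree of `K`: terminal vertices keep the entry `λ'` of
their labels. -/
noncomputable def inducedTree (K : OrderedColoredComplex.{u} n) (a : Fin n → ℕ) : MTree n :=
  (K.sheddingTree a).map SheddingLabel.lam

end OrderedColoredComplex

/-- `K` is a pure colour-compressed `a`-balanced complex with `N` facets. -/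
structure IsPureCompressedBalanced (a : Fin n → ℕ) (N : ℕ) (K : OrderedColoredComplex.{u} n) :
    Prop where
  pure : K.IsPure
  compressed : K.IsColorCompressed
  balanced : K.IsBalanced a
  card_facets : K.facets.card = N

/-- The pure colour-compressed `a`-balanced complexes with `N` facets. -/
def CompressedComplex (a : Fin n → ℕ) (N : ℕ) : Type (u + 1) :=
  {K : OrderedColoredComplex.{u} n // IsPureCompressedBalanced a N K}

/-- Isomorphism of pure colour-compressed `a`-balanced complexes with `N` facets. -/
def isoSetoid (a : Fin n → ℕ) (N : ℕ) : Setoid (CompressedComplex.{u} a N) where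
  r K K' := OrderedColoredComplex.Isomorphic K.1 K'.1
  iseqv := ⟨fun K => .refl K.1, fun h => h.symm, fun h h' => h.trans h'⟩

/-- The generalized `a`-Macaulay representations of `N` (for positive `N`). -/
def GenMacaulayRep (a : Fin n → ℕ) (N : ℕ) : Type :=
  {T : MTree n // IsGenMacaulayRep a N T}

end Complexes

end GenMac

/-!
Identify a vertex of a complex with its colour and its rank in its class.  A facet of a pure
colour-compressed `a`-balanced complex becomes a tuple `B` of sets of positive integers, with
`#(B i) = a i`, and the set of facets becomes a family of tuples that is closed under replacing each
entry by a set that is smaller in the colex order (`IsCompressedFamily`).  Conversely, such a family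
gives a colour-compressed complex; this uses that the shadow of a colex initial segment
is a colex initial segment (`exists_superset_toColex_le`).

A tree encodes a family as well (`Mem`): a vertex labeled `t`, of left-weight `w` in the colour `t`,
sends `B` to the right if `w ∈ B t`, and to the left otherwise.  For the shedding tree of a complex,
this is the decomposition of the complex into the link and the deletion of its largest vertex of
colour `t`, so the induced tree encodes the facets.  The proof compares all objects with the trees
that satisfy a recursive list of conditions, called good trees (`Good`).  Besides the conditions on
Macaulay trees, these require that no vertex is cloning, and that the family below the first
`t`-leading vertex on the right of a vertex labeled `t` is contained in the family below the last
`t`-leading vertex on its left.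

* The family of a good tree is compressed (`Good.down`).  The only case that is not formal is the
  one where the largest element of colour `t` leaves `B t`, and there the containment condition is
  what is needed.
* The shedding algorithm produces good trees (`good_shed`), since factorizability of a complex means
  that the last set of colour `t` may replace any other (`Realizes.isFactorizable_iff`).
* A good tree is determined by its family and its left-weight (`Good.eq_of_mem_iff`): the label at
  the top is the largest colour in which the family is not factorizable, because the absence of
  cloning vertices prevents a tree with label `t` at the top from being `t`-factorizable.

Thus good trees correspond to compressed complexes, up to isomorphisms that are increasing on the
classes (`Good.exists_complex`, `inducedTree_eq_of_isomorphic`, `isomorphic_of_inducedTree_eq`).  An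
arbitrary isomorphism can be made increasing: if it reverses two vertices of a class, then these
have the same degree, so that transposing them is an automorphism (`orderIsomorphic_of_isomorphic`).

It remains to see that the good trees are the generalized Macaulay representations.  For the
conditions other than compatibility and the containment condition, this is a direct comparison
(`Good.isMacaulayTree`, `Good.isCompressedLike`, `good_of_isMacaulayTree`).  Below a
`(j + 1)`-leading vertex, the tuple `B` is sent to the first `j`-leading vertex whose `j`-signature
is at least `B j` (`Good.exists_isLeast_hang`).  Hence `ζ` maps a vertex `x` to the vertex `y` that
receives the signatures of `x` in the preceding subtree, and compatibility says, colour by colour,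
that the family below `x` is contained in the one below `y` (`compatible_below_iff`,
`compatible_node_iff`).
-/

namespace GenMac

section

variable {n : ℕ}

/-! ### Colex order on sets of positive integers -/

/-- `{1, …, m}` is the first `m`-set of positive integers. -/
theorem toColex_Icc_le {m : ℕ} {C : Finset ℕ} (hC : #C = m) (h0 : 0 ∉ C) :
    toColex (Icc 1 m) ≤ toColex C := by
  rw [Colex.toColex_le_toColex]
  intro x hx hxC
  by_contra! h
  have hsub : C ⊆ (Icc 1 m).erase x := by
    intro b hb
    have hb0 : b ≠ 0 := fun h => h0 (h ▸ hb)
    have hbm : b ∈ Icc 1 m := by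
      by_contra hbm
      have := h b hb hbm
      simp only [mem_Icc] at hx hbm
      omega
    exact mem_erase.2 ⟨fun h => hxC (h ▸ hb), hbm⟩
  have := card_le_card hsub
  rw [card_erase_of_mem hx] at this
  simp only [Nat.card_Icc] at this
  simp only [mem_Icc] at hx
  omega

/-- `{w - m + 1, …, w}` is the last `m`-subset of `{1, …, w}`. -/
theorem toColex_le_Ioc {m w : ℕ} {C : Finset ℕ} (hC : #C = m) (hw : C ⊆ Icc 1 w) :
    toColex C ≤ toColex (Ioc (w - m) w) := by
  rw [Colex.toColex_le_toColex]
  intro x hx hxt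
  have hm : m ≤ w := by simpa [hC] using card_le_card hw
  by_contra! h
  have hxw := mem_Icc.1 (hw hx)
  have hsub : Ioc (w - m) w ⊆ C.erase x := by
    intro b hb
    have hbC : b ∈ C := by
      by_contra hbC
      have := h b hb hbC
      simp only [mem_Ioc] at hxt hb
      omega
    exact mem_erase.2 ⟨fun h => hxt (h ▸ hb), hbC⟩
  have := card_le_card hsub
  rw [card_erase_of_mem hx, hC, Nat.card_Ioc] at this
  have := card_pos.2 ⟨x, hx⟩
  omega

theorem toColex_insert_le_insert {α : Type*} [PartialOrder α] [DecidableEq α] {A B : Finset α}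
    {w : α} (hA : w ∉ A) (hB : w ∉ B) :
    toColex (insert w A) ≤ toColex (insert w B) ↔ toColex A ≤ toColex B := by
  rw [← Colex.toColex_sdiff_le_toColex_sdiff (u := {w}) (by simp) (by simp)]
  rw [insert_sdiff_of_mem _ (mem_singleton_self w), insert_sdiff_of_mem _ (mem_singleton_self w),
    sdiff_singleton_eq_erase, sdiff_singleton_eq_erase, erase_eq_of_notMem hA,
    erase_eq_of_notMem hB]

theorem toColex_erase_le_erase {α : Type*} [PartialOrder α] [DecidableEq α] {A B : Finset α}
    {w : α} (hA : w ∈ A) (hB : w ∈ B) :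
    toColex (A.erase w) ≤ toColex (B.erase w) ↔ toColex A ≤ toColex B := by
  rw [← toColex_insert_le_insert (w := w) (by simp) (by simp), insert_erase hA, insert_erase hB]

theorem toColex_lt_of_mem {A B : Finset ℕ} {w : ℕ} (hA : ∀ x ∈ A, x < w) (hB : w ∈ B) :
    toColex A < toColex B := by
  rw [← not_le]
  intro h
  exact lt_irrefl w (Colex.forall_lt_mono h hA w hB)

theorem subset_Icc_of_toColex_le {A B : Finset ℕ} {w : ℕ} (h : toColex A ≤ toColex B)
    (h0 : 0 ∉ A) (hB : B ⊆ Icc 1 w) : A ⊆ Icc 1 w := by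
  intro x hx
  have := Colex.forall_le_mono h (fun b hb => (mem_Icc.1 (hB hb)).2) x hx
  have hx0 : x ≠ 0 := fun h => h0 (h ▸ hx)
  exact mem_Icc.2 ⟨by omega, this⟩

theorem subset_Icc_pred {A : Finset ℕ} {w : ℕ} (h : A ⊆ Icc 1 (w + 1)) (hw : w + 1 ∉ A) :
    A ⊆ Icc 1 w := by
  intro x hx
  have h1 := mem_Icc.1 (h hx)
  have h2 : x ≠ w + 1 := fun h => hw (h ▸ hx)
  exact mem_Icc.2 ⟨h1.1, by omega⟩

theorem succ_notMem_of_subset_Icc {A : Finset ℕ} {w : ℕ} (h : A ⊆ Icc 1 w) : w + 1 ∉ A := by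
  intro hw
  have := (mem_Icc.1 (h hw)).2
  omega

theorem erase_Ioc_succ {w m : ℕ} (hm : 0 < m) :
    (Ioc (w + 1 - m) (w + 1)).erase (w + 1) = Ioc (w - (m - 1)) w := by
  ext x
  simp only [mem_erase, mem_Ioc]
  omega

theorem Ioc_sub_subset_Icc (w m : ℕ) : Ioc (w - m) w ⊆ Icc 1 w := by
  intro x
  simp only [mem_Ioc, mem_Icc]
  omega

/-! ### Trees as families of sets -/

theorem lw_leaf (x : Fin n → ℕ) : MTree.lw (.leaf x) = x := rfl

theorem lw_node (t : Fin n) (l r : MTree n) :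
    MTree.lw (.node t l r) = MTree.lw l + Pi.single t 1 := rfl

theorem lw_node_self (t : Fin n) (l r : MTree n) :
    MTree.lw (.node t l r) t = MTree.lw l t + 1 := by
  simp [lw_node]

theorem lw_node_of_ne {t i : Fin n} (h : i ≠ t) (l r : MTree n) :
    MTree.lw (.node t l r) i = MTree.lw l i := by
  simp [lw_node, h]

theorem lw_le_lw_node (t : Fin n) (l r : MTree n) :
    MTree.lw l ≤ MTree.lw (.node t l r) := by
  rw [lw_node]
  exact le_self_add

/-- All trivalent vertices of the tree have a label that is less than `k`. -/
def Below {α : Type*} (k : ℕ) : LTree n α → Prop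
  | .leaf _ => True
  | .node t l r => (t : ℕ) < k ∧ Below k l ∧ Below k r

theorem Below.mono {α : Type*} {k k' : ℕ} (hk : k ≤ k') {T : LTree n α} (h : Below k T) :
    Below k' T := by
  induction T with
  | leaf x => trivial
  | node t l r ihl ihr => exact ⟨h.1.trans_le hk, ihl h.2.1, ihr h.2.2⟩

theorem below_card {α : Type*} (T : LTree n α) : Below n T := by
  induction T with
  | leaf x => trivial
  | node t l r ihl ihr => exact ⟨t.2, ihl, ihr⟩

/-- The subtree at the last vertex of the path that starts at the top vertex, turns left at every
vertex labeled `t`, and stops at the first vertex that is terminal or has a different label. -/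
def leftEnd (t : Fin n) : MTree n → MTree n
  | .leaf x => .leaf x
  | .node s l r => if s = t then leftEnd t l else .node s l r

/-- At every vertex labeled `t`, the `t`-th entry of the left-weight drops by exactly one on
passing to the right child. -/
def Full (t : Fin n) : MTree n → Prop
  | .leaf _ => True
  | .node s l r => (s = t → MTree.lw r t = MTree.lw l t) ∧ Full t l ∧ Full t r

/-- The tuple `B` of sets belongs to the family encoded by the tree, as far as the colours less
than `k` are concerned.  A vertex labeled `t`, of left-weight `w` in the colour `t`, sends `B`
to the right or to the left according to whether `w` belongs to `B t`, and `w` is removed in the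
former case; at a terminal vertex labeled `x`, what remains of `B i` has to be contained in
`{1, …, x i}`. -/
def Mem (k : ℕ) : MTree n → (Fin n → Finset ℕ) → Prop
  | .leaf x, B => ∀ i : Fin n, (i : ℕ) < k → B i ⊆ Icc 1 (x i)
  | .node t l r, B =>
    if MTree.lw l t + 1 ∈ B t then Mem k r (Function.update B t ((B t).erase (MTree.lw l t + 1)))
    else Mem k l B

theorem mem_node_of_mem {k : ℕ} {t : Fin n} {l r : MTree n} {B : Fin n → Finset ℕ}
    (h : MTree.lw l t + 1 ∈ B t) :
    Mem k (.node t l r) B ↔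
      Mem k r (Function.update B t ((B t).erase (MTree.lw l t + 1))) := by
  rw [Mem, if_pos h]

theorem mem_node_of_notMem {k : ℕ} {t : Fin n} {l r : MTree n} {B : Fin n → Finset ℕ}
    (h : MTree.lw l t + 1 ∉ B t) : Mem k (.node t l r) B ↔ Mem k l B := by
  rw [Mem, if_neg h]

/-- A recursive form of the conditions on generalized Macaulay representations.  Here `a` is the
type of the whole tree, and `m` is the value of `ν` at the top vertex.

At a vertex labeled `t`, the entries of `m` in the smaller colours are still those of `a`, the
labels below are at most `t`, and the left-weights on the two sides agree in the larger colours;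
`Full t l` is the condition on paths in compressed-like trees, and `¬ (l = r ∧ Below t l)` says that
the vertex is not cloning.  The last condition replaces compatibility: of the two families encoded
by the last `t`-leading vertex on the left and the first `t`-leading vertex on the right, the former
contains the latter. -/
def Good (a : Fin n → ℕ) : MTree n → (Fin n → ℕ) → Prop
  | .leaf x, m => (∀ i, 0 < x i) ∧ ∀ i, m i ≤ x i
  | .node t l r, m =>
    0 < m t ∧ (∀ i < t, m i = a i) ∧ Below (t + 1) l ∧ Below (t + 1) r ∧
    MTree.lw r ≤ MTree.lw l ∧ (∀ i, t < i → MTree.lw r i = MTree.lw l i) ∧ Full t l ∧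
    (m t = 1 → MTree.lw r t = MTree.lw l t) ∧ ¬ (l = r ∧ Below t l) ∧
    Good a l m ∧ Good a r (m - Pi.single t 1) ∧
    ∀ B : Fin n → Finset ℕ, (∀ i < t, #(B i) = a i) → Mem t (leftEnd t r) B → Mem t (runEnd t l) B

variable {a m : Fin n → ℕ}

theorem Good.below {t : Fin n} {l r : MTree n} (h : Good a (.node t l r) m) :
    Below (t + 1) (LTree.node t l r) :=
  ⟨Nat.lt_succ_self _, h.2.2.1, h.2.2.2.1⟩

theorem sub_single_of_ne {m : Fin n → ℕ} {t i : Fin n} (h : i ≠ t) :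
    (m - Pi.single t 1 : Fin n → ℕ) i = m i := by simp [h]

theorem sub_single_self (m : Fin n → ℕ) (t : Fin n) :
    (m - Pi.single t 1 : Fin n → ℕ) t = m t - 1 := by simp

theorem Good.le_lw {T : MTree n} (h : Good a T m) (i : Fin n) : m i ≤ MTree.lw T i := by
  induction T generalizing m with
  | leaf x => exact h.2 i
  | node t l r ihl ihr =>
    obtain ⟨-, -, -, -, -, -, -, -, -, hl, -, -⟩ := h
    exact (ihl hl).trans (lw_le_lw_node t l r i)

theorem Good.lw_pos {T : MTree n} (h : Good a T m) (i : Fin n) : 0 < MTree.lw T i := by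
  induction T generalizing m with
  | leaf x => exact h.1 i
  | node t l r ihl ihr =>
    obtain ⟨-, -, -, -, -, -, -, -, -, hl, -, -⟩ := h
    exact (ihl hl).trans_le (lw_le_lw_node t l r i)

theorem Good.below_or {T : MTree n} (h : Good a T m) {t : Fin n} (hT : Below (t + 1) T) :
    Below t T ∨ ∃ l r, T = .node t l r := by
  cases T with
  | leaf x => exact Or.inl trivial
  | node s l r =>
    by_cases hs : s = t
    · exact Or.inr ⟨l, r, by rw [hs]⟩
    · left
      have h1 := hT.1
      have : (s : ℕ) ≠ t := fun h => hs (Fin.ext h)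
      exact h.below.mono (by omega)

theorem runEnd_eq_of_below {T : MTree n} {t : Fin n} (h : Below t T) : runEnd t T = T := by
  cases T with
  | leaf x => rfl
  | node s l r =>
    have : s ≠ t := fun hs => by have := h.1; rw [hs] at this; omega
    rw [runEnd, if_neg this]

theorem Good.below_runEnd {T : MTree n} {t : Fin n} (h : Good a T m) (hT : Below (t + 1) T) :
    Below t (runEnd t T) := by
  induction T generalizing m with
  | leaf x => trivial
  | node s l r ihl ihr =>
    rcases h.below_or hT with hb | ⟨l', r', heq⟩
    · rwa [runEnd_eq_of_below hb]
    · cases heq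
      rw [runEnd, if_pos rfl]
      obtain ⟨-, -, -, -, -, -, -, -, -, -, hr, -⟩ := h
      exact ihr hr hT.2.2

theorem leftEnd_eq_of_below {T : MTree n} {t : Fin n} (h : Below t T) : leftEnd t T = T := by
  cases T with
  | leaf x => rfl
  | node s l r =>
    have : s ≠ t := fun hs => by have := h.1; rw [hs] at this; omega
    rw [leftEnd, if_neg this]

theorem full_of_below {T : MTree n} {t : Fin n} (h : Below t T) : Full t T := by
  induction T with
  | leaf x => trivial
  | node s l r ihl ihr =>
    refine ⟨fun hs => ?_, ihl h.2.1, ihr h.2.2⟩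
    have := h.1
    rw [hs] at this
    omega

theorem Good.below_leftEnd {T : MTree n} {t : Fin n} (h : Good a T m) (hT : Below (t + 1) T) :
    Below t (leftEnd t T) := by
  induction T generalizing m with
  | leaf x => trivial
  | node s l r ihl ihr =>
    rcases h.below_or hT with hb | ⟨l', r', heq⟩
    · rwa [leftEnd_eq_of_below hb]
    · cases heq
      rw [leftEnd, if_pos rfl]
      obtain ⟨-, -, -, -, -, -, -, -, -, hl, -, -⟩ := h
      exact ihl hl hT.2.1

theorem mem_congr {k : ℕ} {T : MTree n} (hT : Below k T) {B C : Fin n → Finset ℕ}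
    (h : ∀ i : Fin n, (i : ℕ) < k → B i = C i) : Mem k T B ↔ Mem k T C := by
  induction T generalizing B C with
  | leaf x =>
    constructor <;> intro H i hi
    · rw [← h i hi]; exact H i hi
    · rw [h i hi]; exact H i hi
  | node t l r ihl ihr =>
    simp only [Mem, h t hT.1]
    split_ifs
    · refine ihr hT.2.2 fun i hi => ?_
      by_cases hit : i = t
      · subst hit; simp
      · simp [hit, h i hi]
    · exact ihl hT.2.1 h

theorem Good.subset_of_mem {k : ℕ} {T : MTree n} (h : Good a T m) {B : Fin n → Finset ℕ}
    (hB : Mem k T B) {i : Fin n} (hi : (i : ℕ) < k) : B i ⊆ Icc 1 (MTree.lw T i) := by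
  induction T generalizing m B with
  | leaf x => exact hB i hi
  | node t l r ihl ihr =>
    obtain ⟨-, -, -, -, hle, -, -, -, -, hl, hr, -⟩ := h
    by_cases hw : MTree.lw l t + 1 ∈ B t
    · rw [mem_node_of_mem hw] at hB
      have h1 := ihr hr hB
      by_cases hit : i = t
      · subst hit
        rw [Function.update_self] at h1
        rw [lw_node_self]
        intro x hx
        by_cases hxw : x = MTree.lw l i + 1
        · simp [hxw]
        · have h2 := mem_Icc.1 (h1 (mem_erase.2 ⟨hxw, hx⟩))
          have h3 : MTree.lw r i ≤ MTree.lw l i := hle i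
          exact mem_Icc.2 ⟨h2.1, by omega⟩
      · rw [Function.update_of_ne hit] at h1
        rw [lw_node_of_ne hit]
        exact h1.trans (Icc_subset_Icc_right (hle i))
    · rw [mem_node_of_notMem hw] at hB
      exact (ihl hl hB).trans (Icc_subset_Icc_right (lw_le_lw_node t l r i))

/-- Colours that do not occur as labels only matter at the terminal vertices, and their entries in
the terminal labels are constant. -/
theorem Good.mem_iff {k k' : ℕ} (hk : k ≤ k') {T : MTree n} (h : Good a T m) (hT : Below k T)
    {B : Fin n → Finset ℕ} :
    Mem k' T B ↔ Mem k T B ∧ ∀ i : Fin n, k ≤ i → (i : ℕ) < k' → B i ⊆ Icc 1 (MTree.lw T i) := by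
  induction T generalizing m B with
  | leaf x =>
    refine ⟨fun H => ⟨fun i hi => H i (by omega), fun i _ hi => H i hi⟩, fun H i hi => ?_⟩
    by_cases hik : (i : ℕ) < k
    · exact H.1 i hik
    · exact H.2 i (by omega) hi
  | node t l r ihl ihr =>
    obtain ⟨-, -, -, -, -, hc, -, -, -, hl, hr, -⟩ := h
    obtain ⟨htk, hTl, hTr⟩ := hT
    by_cases hw : MTree.lw l t + 1 ∈ B t
    · rw [mem_node_of_mem hw, mem_node_of_mem hw, ihr hr hTr]
      refine and_congr_right fun _ => forall_congr' fun i => ?_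
      refine imp_congr_right fun hi => imp_congr_right fun _ => ?_
      have hit : i ≠ t := fun h => by rw [h] at hi; omega
      rw [Function.update_of_ne hit, lw_node_of_ne hit, hc i (Fin.lt_def.2 (by omega))]
    · rw [mem_node_of_notMem hw, mem_node_of_notMem hw, ihl hl hTl]
      refine and_congr_right fun _ => forall_congr' fun i => ?_
      refine imp_congr_right fun hi => imp_congr_right fun _ => ?_
      have hit : i ≠ t := fun h => by rw [h] at hi; omega
      rw [lw_node_of_ne hit]

/-- If `B t` is the first set of its size, then `B` is sent to the left at all vertices labeled `t`,
so only the first `t`-leading vertex matters. -/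
theorem Good.mem_first {k : ℕ} {t : Fin n} (hk : (t : ℕ) < k) {T : MTree n} (h : Good a T m)
    (hT : Below (t + 1) T) {B : Fin n → Finset ℕ} (hB : B t = Icc 1 (m t)) :
    Mem k T B ↔ Mem t (leftEnd t T) B ∧
      ∀ i : Fin n, t < i → (i : ℕ) < k → B i ⊆ Icc 1 (MTree.lw T i) := by
  have base : ∀ T : MTree n, Good a T m → Below t T → (Mem k T B ↔ Mem t (leftEnd t T) B ∧
      ∀ i : Fin n, t < i → (i : ℕ) < k → B i ⊆ Icc 1 (MTree.lw T i)) := by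
    intro T h hT
    rw [h.mem_iff hk.le hT, leftEnd_eq_of_below hT]
    refine and_congr_right fun _ => ⟨fun H i hi => H i hi.le, fun H i hi hik => ?_⟩
    rcases (Fin.le_def.2 hi : t ≤ i).eq_or_lt with rfl | hi'
    · rw [hB]; exact Icc_subset_Icc_right (h.le_lw _)
    · exact H i hi' hik
  induction T with
  | leaf x => exact base _ h trivial
  | node s l r ihl ihr =>
    rcases h.below_or hT with hb | ⟨l', r', heq⟩
    · exact base _ h hb
    · cases heq
      obtain ⟨-, -, -, -, -, -, -, -, -, hl, -, -⟩ := h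
      have hw : MTree.lw l t + 1 ∉ B t := by
        rw [hB]
        have := hl.le_lw t
        simp only [mem_Icc]
        omega
      rw [mem_node_of_notMem hw, leftEnd, if_pos rfl]
      refine (ihl hl hT.2.1).trans ?_
      refine and_congr_right fun _ => forall_congr' fun i => ?_
      refine imp_congr_right fun hi => imp_congr_right fun _ => ?_
      rw [lw_node_of_ne hi.ne']

/-- If `B t` is the last subset of `{1, …, w}` of its size, where `w` is the left-weight, then `B`
is sent to the right at all vertices labeled `t`, so only the last `t`-leading vertex matters. -/
theorem Good.mem_last {k : ℕ} {t : Fin n} (hk : (t : ℕ) < k) {T : MTree n} (h : Good a T m)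
    (hT : Below (t + 1) T) (hF : Full t T) {B : Fin n → Finset ℕ}
    (hB : B t = Ioc (MTree.lw T t - m t) (MTree.lw T t)) :
    Mem k T B ↔ Mem t (runEnd t T) B ∧
      ∀ i : Fin n, t < i → (i : ℕ) < k → B i ⊆ Icc 1 (MTree.lw T i) := by
  have base : ∀ (m : Fin n → ℕ) (B : Fin n → Finset ℕ) (T : MTree n), Good a T m → Below t T →
      B t = Ioc (MTree.lw T t - m t) (MTree.lw T t) → (Mem k T B ↔ Mem t (runEnd t T) B ∧
      ∀ i : Fin n, t < i → (i : ℕ) < k → B i ⊆ Icc 1 (MTree.lw T i)) := by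
    intro m B T h hT hB
    rw [h.mem_iff hk.le hT, runEnd_eq_of_below hT]
    refine and_congr_right fun _ => ⟨fun H i hi => H i hi.le, fun H i hi hik => ?_⟩
    rcases (Fin.le_def.2 hi : t ≤ i).eq_or_lt with rfl | hi'
    · rw [hB]; exact Ioc_sub_subset_Icc _ _
    · exact H i hi' hik
  induction T generalizing m B with
  | leaf x => exact base _ _ _ h trivial hB
  | node s l r ihl ihr =>
    rcases h.below_or hT with hb | ⟨l', r', heq⟩
    · exact base _ _ _ h hb hB
    · cases heq
      obtain ⟨hm, -, -, -, -, hc, -, -, -, hl, hr, -⟩ := h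
      have hlr := hF.1 rfl
      rw [lw_node_self] at hB
      have hw : MTree.lw l t + 1 ∈ B t := by
        rw [hB]
        simp only [mem_Ioc]
        omega
      have hB' : Function.update B t ((B t).erase (MTree.lw l t + 1)) t =
          Ioc (MTree.lw r t - (m - Pi.single t 1 : Fin n → ℕ) t) (MTree.lw r t) := by
        rw [Function.update_self, hB, erase_Ioc_succ hm, sub_single_self, hlr]
      rw [mem_node_of_mem hw, runEnd, if_pos rfl]
      refine (ihr hr hT.2.2 hF.2.2 hB').trans ?_
      refine and_congr (mem_congr (hr.below_runEnd hT.2.2) fun i hi => ?_)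
        (forall_congr' fun i => imp_congr_right fun hi => imp_congr_right fun _ => ?_)
      · rw [Function.update_of_ne (fun h => by rw [h] at hi; omega)]
      · rw [lw_node_of_ne hi.ne', Function.update_of_ne hi.ne', hc i hi]
end

section

variable {n : ℕ} {a m : Fin n → ℕ}

/-! ### The family encoded by a good tree is compressed -/

/-- `B i` is a set of `m i` positive integers, for all colours `i < k`. -/
def Typ (k : ℕ) (m : Fin n → ℕ) (B : Fin n → Finset ℕ) : Prop :=
  ∀ i : Fin n, (i : ℕ) < k → #(B i) = m i ∧ 0 ∉ B i

theorem Typ.update {k : ℕ} {B : Fin n → Finset ℕ} (h : Typ k m B) {t : Fin n} {A : Finset ℕ}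
    (hA : #A = m t) (h0 : 0 ∉ A) : Typ k m (Function.update B t A) := by
  intro i hi
  by_cases hit : i = t
  · subst hit; simpa using ⟨hA, h0⟩
  · simpa [hit] using h i hi

theorem Typ.update' {k : ℕ} {m' : Fin n → ℕ} {B : Fin n → Finset ℕ} (h : Typ k m' B) {t : Fin n}
    {A : Finset ℕ} (hm : ∀ i ≠ t, m' i = m i) (hA : #A = m t) (h0 : 0 ∉ A) :
    Typ k m (Function.update B t A) := by
  intro i hi
  by_cases hit : i = t
  · subst hit; simpa using ⟨hA, h0⟩
  · simpa [hit, hm i hit] using h i hi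

theorem Typ.erase {k : ℕ} {B : Fin n → Finset ℕ} (h : Typ k m B) {t : Fin n} (ht : (t : ℕ) < k)
    {w : ℕ} (hw : w ∈ B t) :
    Typ k (m - Pi.single t 1) (Function.update B t ((B t).erase w)) := by
  refine h.update' (fun i hi => (sub_single_of_ne hi).symm) ?_ ?_
  · rw [card_erase_of_mem hw, (h t ht).1, sub_single_self]
  · exact fun h0 => (h t ht).2 (mem_of_mem_erase h0)

theorem Typ.insert {k : ℕ} {B : Fin n → Finset ℕ} {t : Fin n} (h : Typ k (m - Pi.single t 1) B)
    (ht : (t : ℕ) < k) (hm : 0 < m t) {w : ℕ} (hw : w + 1 ∉ B t) :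
    Typ k m (Function.update B t (insert (w + 1) (B t))) := by
  refine h.update' (fun i hi => sub_single_of_ne hi) ?_ ?_
  · rw [card_insert_of_notMem hw, (h t ht).1, sub_single_self]
    omega
  · simpa using (h t ht).2

theorem card_Ioc_sub {w m : ℕ} (h : m ≤ w) : #(Ioc (w - m) w) = m := by
  rw [Nat.card_Ioc]; omega

/-- The family encoded by a good tree is closed under replacing sets by sets that are smaller in
the colex order.  The only case that is not a formal consequence of the induction hypotheses is the
one where the largest element leaves `B t`: there, `B t` may first be replaced by the first set that
contains the largest element, then, by the containment condition of a good tree, by the last set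
that does not contain it. -/
theorem Good.down {k : ℕ} {T : MTree n} (h : Good a T m) (hT : Below k T)
    {B C : Fin n → Finset ℕ} (hB : Typ k m B) (hC : Typ k m C)
    (hCB : ∀ i : Fin n, (i : ℕ) < k → toColex (C i) ≤ toColex (B i)) (hM : Mem k T B) :
    Mem k T C := by
  induction T generalizing m B C with
  | leaf x => exact fun i hi => subset_Icc_of_toColex_le (hCB i hi) (hC i hi).2 (hM i hi)
  | node t l r ihl ihr =>
    have hsub := h.subset_of_mem hM hT.1
    obtain ⟨hm, hma, hbl, hbr, hle, hc, hF, h1, -, hl, hr, hcont⟩ := h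
    obtain ⟨htk, hTl, hTr⟩ := hT
    rw [lw_node_self] at hsub
    have hCsub : C t ⊆ Icc 1 (MTree.lw l t + 1) :=
      subset_Icc_of_toColex_le (hCB t htk) (hC t htk).2 hsub
    by_cases hwB : MTree.lw l t + 1 ∈ B t
    · rw [mem_node_of_mem hwB] at hM
      by_cases hwC : MTree.lw l t + 1 ∈ C t
      · rw [mem_node_of_mem hwC]
        refine ihr hr hTr (hB.erase htk hwB) (hC.erase htk hwC) (fun i hi => ?_) hM
        by_cases hit : i = t
        · subst hit
          simpa using (toColex_erase_le_erase hwC hwB).2 (hCB i hi)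
        · simpa [hit] using hCB i hi
      · rw [mem_node_of_notMem hwC]
        have hBe := hB.erase htk hwB
        have hBt : Function.update B t (Icc 1 (m t - 1)) t =
            Icc 1 ((m - Pi.single t 1 : Fin n → ℕ) t) := by
          simp
        have hB2 : Typ k (m - Pi.single t 1) (Function.update B t (Icc 1 (m t - 1))) := by
          refine hB.update' (fun i hi => (sub_single_of_ne hi).symm) ?_ (by simp)
          simp
        have hM2 : Mem k r (Function.update B t (Icc 1 (m t - 1))) := by
          refine ihr hr hTr hBe hB2 (fun i hi => ?_) hM
          by_cases hit : i = t
          · subst hit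
            have := hBe i hi
            simp only [Function.update_self] at this ⊢
            rw [sub_single_self] at this
            exact toColex_Icc_le this.1 this.2
          · simp [hit]
        obtain ⟨hM3, hM4⟩ := (hr.mem_first htk hbr hBt).1 hM2
        have hlt : ∀ i : Fin n, i < t → i ≠ t ∧ (i : ℕ) < k := fun i hi =>
          ⟨hi.ne, (Fin.lt_def.1 hi).trans htk⟩
        have hM5 := hcont _ (fun i hi => by
          rw [Function.update_of_ne (hlt i hi).1, (hB i (hlt i hi).2).1, hma i hi]) hM3
        have hcl := card_Ioc_sub (hl.le_lw t)
        have hM6 : Mem k l (Function.update B t (Ioc (MTree.lw l t - m t) (MTree.lw l t))) := by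
          rw [hl.mem_last htk hbl hF (by simp)]
          refine ⟨(mem_congr (hl.below_runEnd hbl) fun i hi => ?_).1 hM5, fun i hi hik => ?_⟩
          · rw [Function.update_of_ne (Fin.ne_of_lt hi), Function.update_of_ne (Fin.ne_of_lt hi)]
          · have := hM4 i hi hik
            rw [Function.update_of_ne hi.ne'] at this ⊢
            rwa [← hc i hi]
        refine ihl hl hTl (hB.update hcl (by simp)) hC (fun i hi => ?_) hM6
        by_cases hit : i = t
        · subst hit
          rw [Function.update_self]
          exact toColex_le_Ioc (hC i hi).1 (subset_Icc_pred hCsub hwC)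
        · simpa [hit] using hCB i hi
    · have hwC : MTree.lw l t + 1 ∉ C t := succ_notMem_of_subset_Icc
        (subset_Icc_of_toColex_le (hCB t htk) (hC t htk).2 (subset_Icc_pred hsub hwB))
      rw [mem_node_of_notMem hwB] at hM
      rw [mem_node_of_notMem hwC]
      exact ihl hl hTl hB hC hCB hM

theorem mem_node_insert {k : ℕ} {t : Fin n} {l r : MTree n} {B : Fin n → Finset ℕ}
    (hw : MTree.lw l t + 1 ∉ B t) :
    Mem k (.node t l r) (Function.update B t (insert (MTree.lw l t + 1) (B t))) ↔ Mem k r B := by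
  rw [mem_node_of_mem (by simp)]
  simp [erase_insert hw]

/-- The family encoded by a good tree is non-empty, and the left-weight at the top is the largest
element that occurs in each colour `i` (if there is any). -/
theorem Good.exists_mem {T : MTree n} (h : Good a T m) (i : Fin n) :
    ∃ B, Typ n m B ∧ Mem n T B ∧ (0 < m i → MTree.lw T i ∈ B i) := by
  induction T generalizing m with
  | leaf x =>
    refine ⟨fun i => Ioc (x i - m i) (x i), fun j _ => ⟨card_Ioc_sub (h.2 j), by simp⟩,
      fun j _ => Ioc_sub_subset_Icc _ _, fun hi => ?_⟩
    have := h.1 i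
    simp only [lw_leaf, mem_Ioc]
    omega
  | node t l r ihl ihr =>
    obtain ⟨hm, -, -, -, hle, -, -, -, -, hl, hr, -⟩ := h
    by_cases hit : i = t
    · subst hit
      obtain ⟨B, hB, hM, -⟩ := ihr hr
      have hw : MTree.lw l i + 1 ∉ B i := succ_notMem_of_subset_Icc
        ((hr.subset_of_mem hM i.2).trans (Icc_subset_Icc_right (hle i)))
      refine ⟨_, hB.insert i.2 hm hw, (mem_node_insert hw).2 hM, fun _ => ?_⟩
      simp [lw_node_self]
    · obtain ⟨B, hB, hM, hi⟩ := ihl hl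
      have hw : MTree.lw l t + 1 ∉ B t := succ_notMem_of_subset_Icc (hl.subset_of_mem hM t.2)
      refine ⟨B, hB, (mem_node_of_notMem hw).2 hM, fun h => ?_⟩
      rw [lw_node_of_ne hit]
      exact hi h

/-- The type of a good tree may be changed in the colours that do not occur as labels. -/
theorem Good.change {k : ℕ} {T : MTree n} (h : Good a T m) (hT : Below k T) {m' : Fin n → ℕ}
    (h1 : ∀ i : Fin n, (i : ℕ) < k → m' i = m i)
    (h2 : ∀ i : Fin n, k ≤ i → m' i ≤ MTree.lw T i) : Good a T m' := by
  induction T generalizing m m' with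
  | leaf x =>
    refine ⟨h.1, fun i => ?_⟩
    by_cases hi : (i : ℕ) < k
    · rw [h1 i hi]; exact h.2 i
    · exact h2 i (not_lt.1 hi)
  | node t l r ihl ihr =>
    obtain ⟨hm, hma, hbl, hbr, hle, hc, hF, hone, hcl, hl, hr, hcont⟩ := h
    obtain ⟨htk, hTl, hTr⟩ := hT
    have hne : ∀ i : Fin n, k ≤ i → i ≠ t := fun i hi h => by rw [h] at hi; omega
    refine ⟨by rwa [h1 t htk], fun i hi => ?_, hbl, hbr, hle, hc, hF, by rwa [h1 t htk], hcl,
      ihl hl hTl h1 fun i hi => ?_, ihr hr hTr (fun i hi => ?_) fun i hi => ?_, hcont⟩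
    · rw [h1 i ((Fin.lt_def.1 hi).trans htk), hma i hi]
    · have := h2 i hi
      rwa [lw_node_of_ne (hne i hi)] at this
    · simp [h1 i hi]
    · have := h2 i hi
      rw [lw_node_of_ne (hne i hi)] at this
      rwa [sub_single_of_ne (hne i hi), hc i (Fin.lt_def.2 (by omega))]

/-! ### A good tree is determined by its family -/

/-- The family encoded by the tree does not depend on the colour `t`, that is, the complex is
`t`-factorizable. -/
def Factor (t : Fin n) (T : MTree n) (m : Fin n → ℕ) : Prop :=
  ∀ B, Typ n m B → Mem n T B →
    Mem n T (Function.update B t (Ioc (MTree.lw T t - m t) (MTree.lw T t)))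

theorem Good.factor_of_below {T : MTree n} (h : Good a T m) {t : Fin n} (hT : Below t T) :
    Factor t T m := by
  intro B hB hM
  rw [h.mem_iff t.2.le hT] at hM ⊢
  refine ⟨(mem_congr hT fun i hi => ?_).1 hM.1, fun i hi hik => ?_⟩
  · rw [Function.update_of_ne (Fin.ne_of_lt hi)]
  · by_cases hit : i = t
    · subst hit
      rw [Function.update_self]
      exact Ioc_sub_subset_Icc _ _
    · rw [Function.update_of_ne hit]
      exact hM.2 i hi hik

/-- Good trees of the same type that have the same left-weight at the top and encode the same
family are equal. -/
def Determined (T T' : MTree n) : Prop :=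
  ∀ {a m : Fin n → ℕ}, (∀ i, 0 < a i) → Good a T m → Good a T' m → MTree.lw T = MTree.lw T' →
    (∀ B, Typ n m B → (Mem n T B ↔ Mem n T' B)) → T = T'

/-- The family encoded by a good tree with label `t` at the top is not `t`-factorizable.  Otherwise
the families of both children would be, so `t` would not occur as a label below.  Then these
families would agree, and the children would be equal by determinacy: the top would be cloning. -/
theorem Good.not_factor_of_node {t : Fin n} {l r : MTree n} (ha : ∀ i, 0 < a i)
    (h : Good a (.node t l r) m)
    (ihl : ∀ l' r', l = .node t l' r' → ¬ Factor t l m)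
    (ihr : ∀ l' r', r = .node t l' r' → ¬ Factor t r (m - Pi.single t 1))
    (ih : Determined l r) : ¬ Factor t (.node t l r) m := by
  intro hf
  have hd := fun {B C : Fin n → Finset ℕ} => h.down (B := B) (C := C) (below_card _)
  obtain ⟨hm, hma, hbl, hbr, hle, hc, hF, hone, hcl, hl, hr, hcont⟩ := h
  have hlw := hl.le_lw t
  have hml : ∀ B, Mem n l B → MTree.lw l t + 1 ∉ B t := fun B hB =>
    succ_notMem_of_subset_Icc (hl.subset_of_mem hB t.2)
  have hmr : ∀ B, Mem n r B → MTree.lw l t + 1 ∉ B t := fun B hB =>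
    succ_notMem_of_subset_Icc
      ((hr.subset_of_mem hB t.2).trans (Icc_subset_Icc_right (hle t)))
  simp only [Factor, lw_node_self] at hf
  -- the last set of colour `t` contains the largest element, hence is sent to the right
  have htop : ∀ B, Typ n m B → Mem n (.node t l r) B →
      Mem n r (Function.update B t (Ioc (MTree.lw l t - (m t - 1)) (MTree.lw l t))) := by
    intro B hB hM
    have h1 := hf B hB hM
    rw [mem_node_of_mem (by simp; omega)] at h1
    simpa [erase_Ioc_succ hm] using h1
  have hfl : Factor t l m := by
    intro B hB hM
    have h1 := hf B hB ((mem_node_of_notMem (hml B hM)).2 hM)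
    have h2 := hd (hB.update (card_Ioc_sub (by omega)) (by simp))
      (hB.update (card_Ioc_sub hlw) (by simp)) (fun i _ => ?_) h1
    · rwa [mem_node_of_notMem (by simp)] at h2
    · by_cases hit : i = t
      · subst hit
        rw [Function.update_self, Function.update_self]
        exact toColex_le_Ioc (card_Ioc_sub hlw)
          ((Ioc_sub_subset_Icc _ _).trans (Icc_subset_Icc_right (Nat.le_succ _)))
      · simp [hit]
  have hrt : MTree.lw r t = MTree.lw l t := by
    by_cases h1 : m t = 1
    · exact hone h1
    · obtain ⟨B, hB, hM, -⟩ := hl.exists_mem t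
      have h2 := htop B hB ((mem_node_of_notMem (hml B hM)).2 hM)
      have h3 := hr.subset_of_mem h2 t.2
      rw [Function.update_self] at h3
      have h4 : MTree.lw l t ∈ Ioc (MTree.lw l t - (m t - 1)) (MTree.lw l t) := by
        simp only [mem_Ioc]; omega
      exact le_antisymm (hle t) (mem_Icc.1 (h3 h4)).2
  have hfr : Factor t r (m - Pi.single t 1) := by
    intro B hB hM
    have h1 := htop _ (hB.insert t.2 hm (hmr B hM)) ((mem_node_insert (hmr B hM)).2 hM)
    rw [sub_single_self, hrt]
    simpa using h1
  have hl' : Below t l := by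
    rcases hl.below_or hbl with h | ⟨l', r', h⟩
    · exact h
    · exact absurd hfl (ihl _ _ h)
  have hr' : Below t r := by
    rcases hr.below_or hbr with h | ⟨l', r', h⟩
    · exact h
    · exact absurd hfr (ihr _ _ h)
  rw [leftEnd_eq_of_below hr', runEnd_eq_of_below hl'] at hcont
  have hw : ∀ i, t ≤ i → MTree.lw r i = MTree.lw l i := fun i hi => by
    rcases hi.eq_or_lt with rfl | hi
    · exact hrt
    · exact hc i hi
  have hr2 : Good a r m := by
    refine hr.change hr' (fun i hi => ?_) fun i hi => ?_
    · rw [sub_single_of_ne (Fin.ne_of_lt hi)]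
    · rw [hw i hi]; exact hl.le_lw i
  have hmem : ∀ B, Typ n m B → (Mem n l B ↔ Mem n r B) := by
    intro B hB
    rw [hl.mem_iff t.2.le hl', hr.mem_iff t.2.le hr']
    refine and_congr ⟨fun hM => ?_, fun hM => ?_⟩ (forall_congr' fun i =>
      imp_congr_right fun hi => by rw [hw i hi])
    · obtain ⟨B', hB', hM', -⟩ := hl.exists_mem t
      -- only the colours less than `t` matter, so the others may be borrowed from a member `B'`
      let C : Fin n → Finset ℕ := fun i => if i < t then B i else B' i
      have hC : Typ n m C := fun i hi => by
        by_cases hit : i < t <;> simp only [C, hit, if_true, if_false]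
        · exact hB i hi
        · exact hB' i hi
      have hCM : Mem n l C := by
        rw [hl.mem_iff t.2.le hl'] at hM' ⊢
        refine ⟨(mem_congr hl' fun i hi => ?_).1 hM, fun i hi hin => ?_⟩
        · simp [C, Fin.lt_def.2 hi]
        · simpa [C, Fin.not_lt.2 (Fin.le_def.2 hi)] using hM'.2 i hi hin
      have h2 := htop C hC ((mem_node_of_notMem (hml C hCM)).2 hCM)
      refine (mem_congr hr' fun i hi => ?_).1 ((hr.mem_iff t.2.le hr').1 h2).1
      rw [Function.update_of_ne (Fin.ne_of_lt hi)]
      simp [C, Fin.lt_def.2 hi]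
    · refine hcont B (fun i hi => ?_) hM
      rw [(hB i i.2).1, hma i hi]
  have hlw' : MTree.lw l = MTree.lw r := by
    funext i
    rcases lt_or_ge i t with hi | hi
    · obtain ⟨B, hB, hM, hi'⟩ := hl.exists_mem i
      have h1 := hr.subset_of_mem ((hmem B hB).1 hM) i.2
      refine le_antisymm (mem_Icc.1 (h1 (hi' ?_))).2 (hle i)
      rw [hma i hi]
      exact ha i
    · exact (hw i hi).symm
  exact hcl ⟨ih ha hl hr2 hlw' hmem, hl'⟩

/-- The number of vertices of a tree. -/
def LTree.size {α : Type*} : LTree n α → ℕ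
  | .leaf _ => 1
  | .node _ l r => l.size + r.size + 1

theorem size_pos {α : Type*} (T : LTree n α) : 0 < T.size := by
  cases T <;> simp [LTree.size]

/-- The two statements need each other for smaller trees: if the families of two good trees agree,
then factorizability forces the labels at the top to agree. -/
theorem determined_aux (s : ℕ) :
    (∀ (a : Fin n → ℕ), (∀ i, 0 < a i) → ∀ (t : Fin n) (l r : MTree n) (m : Fin n → ℕ),
      LTree.size (.node t l r) ≤ s → Good a (.node t l r) m → ¬ Factor t (.node t l r) m) ∧
    ∀ T T' : MTree n, T.size + T'.size ≤ s → Determined T T' := by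
  induction s with
  | zero =>
    refine ⟨fun a ha t l r m h => by simp [LTree.size] at h, fun T T' h => ?_⟩
    have := size_pos T
    omega
  | succ s ih =>
    obtain ⟨ih1, ih2⟩ := ih
    constructor
    · intro a ha t l r m hs hg
      have hl := hg.2.2.2.2.2.2.2.2.2.1
      have hr := hg.2.2.2.2.2.2.2.2.2.2.1
      simp only [LTree.size] at hs
      refine hg.not_factor_of_node ha ?_ ?_ (ih2 l r (by omega))
      · rintro l' r' rfl
        exact ih1 a ha t l' r' m (by omega) hl
      · rintro l' r' rfl
        exact ih1 a ha t l' r' _ (by omega) hr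
    · intro T T' hs a m ha h h' hlw hmem
      have hfac : ∀ t, Factor t T m ↔ Factor t T' m := fun t => by
        refine forall_congr' fun B => imp_congr_right fun hB => ?_
        rw [hmem B hB, ← hlw, hmem _ (hB.update (card_Ioc_sub (h.le_lw t)) (by simp))]
      have hsT := size_pos T
      have hsT' := size_pos T'
      cases T with
      | leaf x =>
        cases T' with
        | leaf x' => exact congrArg _ hlw
        | node t' l' r' =>
          have := h.factor_of_below (t := t') trivial
          rw [hfac] at this
          exact absurd this (ih1 a ha t' l' r' m (by omega) h')
      | node t l r =>
        have hT := ih1 a ha t l r m (by omega) h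
        cases T' with
        | leaf x' =>
          have := h'.factor_of_below (t := t) trivial
          rw [← hfac] at this
          exact absurd this hT
        | node t' l' r' =>
          have hT' := ih1 a ha t' l' r' m (by omega) h'
          have htt : t = t' := by
            by_contra hne
            rcases lt_or_gt_of_ne hne with hlt | hlt
            · exact hT' ((hfac t').1 (h.factor_of_below (h.below.mono hlt)))
            · exact hT ((hfac t).2 (h'.factor_of_below (h'.below.mono hlt)))
          subst htt
          obtain ⟨hm, hma, hbl, hbr, hle, hc, -, hone, -, hl, hr, -⟩ := h
          obtain ⟨-, -, hbl', hbr', hle', hc', -, hone', -, hl', hr', -⟩ := h'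
          simp only [LTree.size] at hs
          have hlwl : MTree.lw l = MTree.lw l' := by
            rw [lw_node, lw_node] at hlw
            exact add_right_cancel hlw
          have heql : l = l' := by
            refine ih2 l l' (by omega) ha hl hl' hlwl fun B hB => ?_
            by_cases hw : MTree.lw l t + 1 ∈ B t
            · refine iff_of_false (fun hM => ?_) fun hM => ?_
              · exact succ_notMem_of_subset_Icc (hl.subset_of_mem hM t.2) hw
              · rw [hlwl] at hw
                exact succ_notMem_of_subset_Icc (hl'.subset_of_mem hM t.2) hw
            · have := hmem B hB
              rwa [mem_node_of_notMem hw, mem_node_of_notMem (by rwa [← hlwl])] at this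
          have hmemr : ∀ B, Typ n (m - Pi.single t 1) B → (Mem n r B ↔ Mem n r' B) := by
            intro B hB
            by_cases hw : MTree.lw l t + 1 ∈ B t
            · refine iff_of_false (fun hM => ?_) fun hM => ?_
              · exact succ_notMem_of_subset_Icc
                  ((hr.subset_of_mem hM t.2).trans (Icc_subset_Icc_right (hle t))) hw
              · rw [hlwl] at hw
                exact succ_notMem_of_subset_Icc
                  ((hr'.subset_of_mem hM t.2).trans (Icc_subset_Icc_right (hle' t))) hw
            · have := hmem _ (hB.insert t.2 hm hw)
              rw [mem_node_insert hw, hlwl, mem_node_insert (by rwa [← hlwl])] at this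
              exact this
          have hpos : ∀ i, 0 < (m - Pi.single t 1 : Fin n → ℕ) i →
              MTree.lw r i = MTree.lw r' i := by
            intro i hi
            apply le_antisymm
            · obtain ⟨B, hB, hM, hi'⟩ := hr.exists_mem i
              exact (mem_Icc.1 (hr'.subset_of_mem ((hmemr B hB).1 hM) i.2 (hi' hi))).2
            · obtain ⟨B, hB, hM, hi'⟩ := hr'.exists_mem i
              exact (mem_Icc.1 (hr.subset_of_mem ((hmemr B hB).2 hM) i.2 (hi' hi))).2
          have hlwr : MTree.lw r = MTree.lw r' := by
            funext i
            rcases lt_trichotomy i t with hi | rfl | hi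
            · apply hpos
              rw [sub_single_of_ne hi.ne, hma i hi]
              exact ha i
            · by_cases h1 : m i = 1
              · rw [hone h1, hone' h1, hlwl]
              · apply hpos
                rw [sub_single_self]
                omega
            · rw [hc i hi, hc' i hi, hlwl]
          rw [heql, ih2 r r' (by omega) ha hr hr' hlwr hmemr]

/-- A good tree is determined by the family it encodes and by its left-weight at the top. -/
theorem Good.eq_of_mem_iff {T T' : MTree n} (ha : ∀ i, 0 < a i) (h : Good a T m)
    (h' : Good a T' m) (hlw : MTree.lw T = MTree.lw T')
    (hmem : ∀ B, Typ n m B → (Mem n T B ↔ Mem n T' B)) : T = T' :=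
  (determined_aux _).2 T T' le_rfl ha h h' hlw hmem

end

section

variable {n : ℕ} {a m : Fin n → ℕ}

/-! ### Counting -/

theorem binom_natCast (x y : ℕ) : binom x (y : ℤ) = x.choose y := by
  simp [binom]

theorem natCast_sub_single {m : Fin n → ℕ} {t : Fin n} (h : 0 < m t) :
    (fun i => (m i : ℤ)) - Pi.single t 1 =
      fun i => (((m - Pi.single t 1 : Fin n → ℕ) i : ℕ) : ℤ) := by
  funext i
  by_cases hi : i = t
  · subst hi
    simp only [Pi.sub_apply, Pi.single_eq_same]
    omega
  · simp [hi]

/-- The size of the family encoded by a good tree is the sum of the products of binomial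
coefficients over the terminal vertices. -/
theorem Good.exists_finset_card {T : MTree n} (h : Good a T m) :
    ∃ S : Finset (Fin n → Finset ℕ), (∀ B, B ∈ S ↔ Typ n m B ∧ Mem n T B) ∧
      #S = leafSum T (fun i => (m i : ℤ)) := by
  induction T generalizing m with
  | leaf x =>
    refine ⟨Fintype.piFinset fun i => powersetCard (m i) (Icc 1 (x i)), fun B => ?_, ?_⟩
    · simp only [Fintype.mem_piFinset, mem_powersetCard]
      refine ⟨fun H => ⟨fun i _ => ⟨(H i).2, fun h0 => ?_⟩, fun i _ => (H i).1⟩,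
        fun H i => ⟨H.2 i i.2, (H.1 i i.2).1⟩⟩
      simpa using (H i).1 h0
    · simp [leafSum, binom_natCast]
  | node t l r ihl ihr =>
    obtain ⟨hm, -, -, -, hle, -, -, -, -, hl, hr, -⟩ := h
    obtain ⟨S, hS, hSc⟩ := ihl hl
    obtain ⟨S', hS', hSc'⟩ := ihr hr
    have hwl : ∀ B ∈ S, MTree.lw l t + 1 ∉ B t := fun B hB =>
      succ_notMem_of_subset_Icc (hl.subset_of_mem ((hS B).1 hB).2 t.2)
    have hwr : ∀ B ∈ S', MTree.lw l t + 1 ∉ B t := fun B hB =>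
      succ_notMem_of_subset_Icc
        ((hr.subset_of_mem ((hS' B).1 hB).2 t.2).trans (Icc_subset_Icc_right (hle t)))
    refine ⟨S ∪ S'.image fun B => Function.update B t (insert (MTree.lw l t + 1) (B t)),
      fun B => ?_, ?_⟩
    · rw [mem_union, mem_image]
      by_cases hw : MTree.lw l t + 1 ∈ B t
      · rw [mem_node_of_mem hw]
        constructor
        · rintro (hB | ⟨B', hB', rfl⟩)
          · exact absurd hw (hwl B hB)
          · have h1 := (hS' B').1 hB'
            refine ⟨h1.1.insert t.2 hm (hwr B' hB'), ?_⟩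
            simpa [erase_insert (hwr B' hB')] using h1.2
        · rintro ⟨h1, h2⟩
          exact Or.inr ⟨_, (hS' _).2 ⟨h1.erase t.2 hw, h2⟩, by simp [insert_erase hw]⟩
      · rw [mem_node_of_notMem hw, ← hS]
        refine or_iff_left ?_
        rintro ⟨B', -, rfl⟩
        simp at hw
    · rw [card_union_of_disjoint, card_image_of_injOn, hSc, hSc', leafSum, natCast_sub_single hm]
      · intro B hB C hC hBC
        have h1 := hwr B hB
        have h2 := hwr C hC
        funext i
        by_cases hi : i = t
        · subst hi
          have := congrFun hBC i
          simp only [Function.update_self] at this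
          rw [← erase_insert h1, this, erase_insert h2]
        · simpa [hi] using congrFun hBC i
      · rw [disjoint_left]
        intro B hB hB'
        obtain ⟨B', -, rfl⟩ := mem_image.1 hB'
        exact hwl _ hB (by simp)

/-! ### Ends of runs -/

theorem Good.good_leftEnd {T : MTree n} (h : Good a T m) (t : Fin n) :
    Good a (leftEnd t T) m := by
  induction T with
  | leaf x => exact h
  | node s l r ihl ihr =>
    rw [leftEnd]
    split_ifs with hs
    · exact ihl h.2.2.2.2.2.2.2.2.2.1
    · exact h

theorem Good.good_runEnd {T : MTree n} (h : Good a T m) (t : Fin n) :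
    ∃ m' : Fin n → ℕ, Good a (runEnd t T) m' ∧ ∀ i ≠ t, m' i = m i := by
  induction T generalizing m with
  | leaf x => exact ⟨m, h, fun _ _ => rfl⟩
  | node s l r ihl ihr =>
    rw [runEnd]
    split_ifs with hs
    · subst hs
      obtain ⟨m', h1, h2⟩ := ihr h.2.2.2.2.2.2.2.2.2.2.1
      exact ⟨m', h1, fun i hi => by rw [h2 i hi, sub_single_of_ne hi]⟩
    · exact ⟨m, h, fun _ _ => rfl⟩

/-- If the last set of the colour `t` occurs in the family encoded by a good tree, then no link
that is taken in the colour `t` loses vertices of that colour. -/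
theorem Good.full_of_mem {t : Fin n} {T : MTree n} (h : Good a T m) (hT : Below (t + 1) T)
    {B : Fin n → Finset ℕ} (hM : Mem n T B)
    (hB : B t = Ioc (MTree.lw T t - m t) (MTree.lw T t)) : Full t T := by
  induction T generalizing m B with
  | leaf x => trivial
  | node s l r ihl ihr =>
    rcases h.below_or hT with hb | ⟨l', r', heq⟩
    · exact full_of_below hb
    · cases heq
      have hlw := h.le_lw t
      obtain ⟨hm, -, hbl, hbr, hle, -, hF, hone, -, hl, hr, -⟩ := h
      rw [lw_node_self] at hB hlw
      have hle' : MTree.lw r t ≤ MTree.lw l t := hle t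
      have hw : MTree.lw l t + 1 ∈ B t := by rw [hB, mem_Ioc]; omega
      rw [mem_node_of_mem hw] at hM
      have h1 := hr.subset_of_mem hM t.2
      rw [Function.update_self, hB, erase_Ioc_succ hm] at h1
      have hrl : MTree.lw r t = MTree.lw l t := by
        by_cases h2 : m t = 1
        · exact hone h2
        · have h3 : MTree.lw l t ∈ Ioc (MTree.lw l t - (m t - 1)) (MTree.lw l t) := by
            rw [mem_Ioc]; omega
          exact le_antisymm hle' (mem_Icc.1 (h1 h3)).2
      refine ⟨fun _ => hrl, hF, ihr hr hbr hM ?_⟩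
      rw [Function.update_self, hB, erase_Ioc_succ hm, sub_single_self, hrl]

/-! ### Compressed families -/

/-- `P` is a non-empty family of tuples of sets, closed under replacing sets by sets that are
smaller in the colex order, such that `lam i` is the number of vertices of each colour `i` that
occurs; `lam i` is arbitrary, but positive, for the other colours.  Such families are the sets of
facets of the complexes met by the shedding algorithm. -/
structure IsCompressedFamily (m lam : Fin n → ℕ) (P : Set (Fin n → Finset ℕ)) : Prop where
  typ : ∀ B ∈ P, Typ n m B
  down : ∀ B ∈ P, ∀ C, Typ n m C → (∀ i, toColex (C i) ≤ toColex (B i)) → C ∈ P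
  nonempty : P.Nonempty
  bound : ∀ B ∈ P, ∀ i, B i ⊆ Icc 1 (lam i)
  attained : ∀ i, 0 < m i → ∃ B ∈ P, lam i ∈ B i
  pos : ∀ i, 0 < lam i

theorem Good.isCompressedFamily {T : MTree n} (h : Good a T m) :
    IsCompressedFamily m (MTree.lw T) {B | Typ n m B ∧ Mem n T B} where
  typ B hB := hB.1
  down B hB C hC hCB := ⟨hC, h.down (below_card T) hB.1 hC (fun i _ => hCB i) hB.2⟩
  nonempty := by
    by_cases hn : Nonempty (Fin n)
    · obtain ⟨i⟩ := hn
      obtain ⟨B, h1, h2, -⟩ := h.exists_mem i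
      exact ⟨B, h1, h2⟩
    · refine ⟨fun _ => ∅, fun i => absurd ⟨i⟩ hn, ?_⟩
      cases T with
      | leaf x => exact fun i => absurd ⟨i⟩ hn
      | node t l r => exact absurd ⟨t⟩ hn
  bound B hB i := h.subset_of_mem hB.2 i.2
  attained i hi := by
    obtain ⟨B, h1, h2, h3⟩ := h.exists_mem i
    exact ⟨B, ⟨h1, h2⟩, h3 hi⟩
  pos := h.lw_pos

variable {lam : Fin n → ℕ} {P : Set (Fin n → Finset ℕ)}

/-- The last `m t`-subset of `{1, …, lam t}` may replace any set of colour `t`. -/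
def FactorSet (m lam : Fin n → ℕ) (P : Set (Fin n → Finset ℕ)) (t : Fin n) : Prop :=
  ∀ B ∈ P, Function.update B t (Ioc (lam t - m t) (lam t)) ∈ P

namespace IsCompressedFamily

theorem le (h : IsCompressedFamily m lam P) (i : Fin n) : m i ≤ lam i := by
  obtain ⟨B, hB⟩ := h.nonempty
  rw [← (h.typ B hB i i.2).1]
  simpa using card_le_card (h.bound B hB i)

theorem update_mem (h : IsCompressedFamily m lam P) {B : Fin n → Finset ℕ} (hB : B ∈ P) {t : Fin n}
    {A : Finset ℕ} (hA : #A = m t) (h0 : 0 ∉ A) (hAB : toColex A ≤ toColex (B t)) :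
    Function.update B t A ∈ P := by
  refine h.down B hB _ ((h.typ B hB).update hA h0) fun i => ?_
  by_cases hi : i = t
  · subst hi; simpa using hAB
  · simp [hi]

/-- Exchange an element of a set for a smaller one. -/
theorem exchange_mem (h : IsCompressedFamily m lam P) {B : Fin n → Finset ℕ} (hB : B ∈ P)
    {t : Fin n} {x y : ℕ} (hx : x ∈ B t) (hy : y ∉ B t) (h0 : 0 < y) (hyx : y < x) :
    Function.update B t (insert y ((B t).erase x)) ∈ P := by
  have hB' := h.typ B hB t t.2
  refine h.update_mem hB ?_ ?_ ?_
  · rw [card_insert_of_notMem (fun hy' => hy (mem_of_mem_erase hy')), card_erase_of_mem hx, hB'.1]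
    have := card_pos.2 ⟨x, hx⟩
    omega
  · simp only [mem_insert, mem_erase, not_or, not_and]
    exact ⟨h0.ne, fun _ => hB'.2⟩
  · conv_rhs => rw [← insert_erase hx]
    rw [Colex.insert_le_insert (fun hy' => hy (mem_of_mem_erase hy')) (by simp)]
    exact hyx.le

theorem exists_mem (h : IsCompressedFamily m lam P) {i : Fin n} (hi : 0 < m i) {x : ℕ}
    (hx : x ∈ Icc 1 (lam i)) : ∃ B ∈ P, x ∈ B i := by
  obtain ⟨B, hB, hl⟩ := h.attained i hi
  by_cases hxB : x ∈ B i
  · exact ⟨B, hB, hxB⟩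
  · have hx' := mem_Icc.1 hx
    have hne : x ≠ lam i := fun h => hxB (h ▸ hl)
    exact ⟨_, h.exchange_mem hB hl hxB hx'.1 (by omega), by simp⟩

theorem factorSet_of_eq_zero (h : IsCompressedFamily m lam P) {t : Fin n} (ht : m t = 0) :
    FactorSet m lam P t := by
  intro B hB
  have : B t = ∅ := by rw [← card_eq_zero, (h.typ B hB t t.2).1, ht]
  have h2 : Ioc (lam t - m t) (lam t) = B t := by simp [ht, this]
  rwa [h2, Function.update_eq_self]

theorem lt_of_not_factorSet (h : IsCompressedFamily m lam P) {t : Fin n}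
    (hf : ¬ FactorSet m lam P t) : m t < lam t := by
  by_contra! hle
  refine hf fun B hB => ?_
  have h1 := h.le t
  have h2 : B t = Ioc (lam t - m t) (lam t) := by
    have hz : lam t - m t = 0 := by omega
    rw [hz]
    refine eq_of_subset_of_card_le (h.bound B hB t) ?_
    rw [(h.typ B hB t t.2).1, Nat.card_Ioc]
    omega
  rwa [← h2, Function.update_eq_self]

theorem pos_of_not_factorSet (h : IsCompressedFamily m lam P) {t : Fin n}
    (hf : ¬ FactorSet m lam P t) : 0 < m t := by
  by_contra! hle
  exact hf (h.factorSet_of_eq_zero (by omega))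

/-- Remove the largest vertex of colour `t` while keeping given other vertices. -/
theorem exists_notMem (h : IsCompressedFamily m lam P) {t : Fin n} (ht : m t < lam t)
    {B : Fin n → Finset ℕ} (hB : B ∈ P) :
    ∃ B' ∈ P, lam t ∉ B' t ∧ (∀ i ≠ t, B' i = B i) ∧ (B t).erase (lam t) ⊆ B' t := by
  by_cases hl : lam t ∈ B t
  · have hBt := h.typ B hB t t.2
    obtain ⟨y, hy, hyB⟩ : ∃ y ∈ Icc 1 (lam t), y ∉ B t := by
      by_contra! hsub
      have := card_le_card hsub
      rw [hBt.1, Nat.card_Icc] at this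
      omega
    have hy' := mem_Icc.1 hy
    have hne : y ≠ lam t := fun h => hyB (h ▸ hl)
    refine ⟨_, h.exchange_mem hB hl hyB hy'.1 (by omega), ?_, fun i hi => by simp [hi], ?_⟩
    · simp [hne.symm]
    · simp
  · exact ⟨B, hB, hl, fun _ _ => rfl, erase_subset _ _⟩

/-- The family of facets of the deletion of the largest vertex of colour `t`. -/
theorem deletion (h : IsCompressedFamily m lam P) {t : Fin n} (hf : ¬ FactorSet m lam P t) :
    IsCompressedFamily m (lam - Pi.single t 1) {B | B ∈ P ∧ lam t ∉ B t} := by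
  have hlt := h.lt_of_not_factorSet hf
  have hpos := h.pos_of_not_factorSet hf
  have hbound : ∀ B, (B ∈ P ∧ lam t ∉ B t) →
      ∀ i, B i ⊆ Icc 1 ((lam - Pi.single t 1 : Fin n → ℕ) i) := by
    intro B hB i
    by_cases hi : i = t
    · subst hi
      rw [sub_single_self]
      apply subset_Icc_pred
      · rw [Nat.sub_add_cancel (h.pos i)]; exact h.bound B hB.1 i
      · rw [Nat.sub_add_cancel (h.pos i)]; exact hB.2
    · rw [sub_single_of_ne hi]
      exact h.bound B hB.1 i
  refine ⟨fun B hB => h.typ B hB.1, fun B hB C hC hCB => ⟨h.down B hB.1 C hC hCB, ?_⟩, ?_,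
    hbound, fun i hi => ?_, fun i => ?_⟩
  · have h1 := subset_Icc_of_toColex_le (hCB t) (hC t t.2).2 (hbound B hB t)
    rw [sub_single_self] at h1
    intro h2
    have := (mem_Icc.1 (h1 h2)).2
    have := h.pos t
    omega
  · obtain ⟨B, hB⟩ := h.nonempty
    obtain ⟨B', h1, h2, -⟩ := h.exists_notMem hlt hB
    exact ⟨B', h1, h2⟩
  · by_cases hit : i = t
    · subst hit
      obtain ⟨B, hB, hx⟩ := h.exists_mem hi (x := lam i - 1) (by rw [mem_Icc]; omega)
      obtain ⟨B', h1, h2, h3, h4⟩ := h.exists_notMem hlt hB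
      refine ⟨B', ⟨h1, h2⟩, ?_⟩
      rw [sub_single_self]
      exact h4 (mem_erase.2 ⟨by omega, hx⟩)
    · obtain ⟨B, hB, hx⟩ := h.attained i hi
      obtain ⟨B', h1, h2, h3, h4⟩ := h.exists_notMem hlt hB
      refine ⟨B', ⟨h1, h2⟩, ?_⟩
      rw [sub_single_of_ne hit, h3 i hit]
      exact hx
  · by_cases hit : i = t
    · subst hit
      rw [sub_single_self]
      omega
    · rw [sub_single_of_ne hit]
      exact h.pos i

/-- The family of facets of the link of the largest vertex of colour `t`. -/
theorem link (h : IsCompressedFamily m lam P) {t : Fin n} (hf : ¬ FactorSet m lam P t) :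
    ∃ lam' : Fin n → ℕ, IsCompressedFamily (m - Pi.single t 1) lam'
        {B | lam t ∉ B t ∧ Function.update B t (insert (lam t) (B t)) ∈ P} ∧
      (∀ i, (m - Pi.single t 1 : Fin n → ℕ) i = 0 →
        lam' i = (lam - Pi.single t 1 : Fin n → ℕ) i) ∧
      lam' ≤ lam - Pi.single t 1 := by
  have hlt := h.lt_of_not_factorSet hf
  have hpos := h.pos_of_not_factorSet hf
  set m' : Fin n → ℕ := m - Pi.single t 1 with hm'
  set Q := {B : Fin n → Finset ℕ |
    lam t ∉ B t ∧ Function.update B t (insert (lam t) (B t)) ∈ P} with hQ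
  have htyp : ∀ B ∈ Q, Typ n m' B := by
    intro B hB
    have h1 := (h.typ _ hB.2).erase (w := lam t) (t := t) t.2 (by simp)
    simpa [erase_insert hB.1] using h1
  have hbound : ∀ B ∈ Q, ∀ i, B i ⊆ Icc 1 ((lam - Pi.single t 1 : Fin n → ℕ) i) := by
    intro B hB i
    have h1 := h.bound _ hB.2 i
    by_cases hi : i = t
    · subst hi
      rw [Function.update_self] at h1
      rw [sub_single_self]
      apply subset_Icc_pred
      · rw [Nat.sub_add_cancel (h.pos i)]; exact (subset_insert _ _).trans h1
      · rw [Nat.sub_add_cancel (h.pos i)]; exact hB.1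
    · rw [Function.update_of_ne hi] at h1
      rwa [sub_single_of_ne hi]
  have hne : Q.Nonempty := by
    obtain ⟨B, hB, hl⟩ := h.attained t hpos
    refine ⟨Function.update B t ((B t).erase (lam t)), by simp, ?_⟩
    simpa [insert_erase hl] using hB
  -- a colour without vertices in the link gets the value prescribed by the shedding algorithm
  let lam' : Fin n → ℕ := fun i =>
    if m' i = 0 then (lam - Pi.single t 1 : Fin n → ℕ) i else sSup {x | ∃ B ∈ Q, x ∈ B i}
  have hbdd : ∀ i, BddAbove {x | ∃ B ∈ Q, x ∈ B i} := fun i =>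
    ⟨_, by rintro x ⟨B, hB, hx⟩; exact (mem_Icc.1 (hbound B hB i hx)).2⟩
  have hatt : ∀ i, 0 < m' i → ∃ B ∈ Q, lam' i ∈ B i := by
    intro i hi
    have h1 : {x | ∃ B ∈ Q, x ∈ B i}.Nonempty := by
      obtain ⟨B, hB⟩ := hne
      have h2 := (htyp B hB i i.2).1
      obtain ⟨x, hx⟩ := card_pos.1 (h2 ▸ hi)
      exact ⟨x, B, hB, hx⟩
    have h2 := Nat.sSup_mem h1 (hbdd i)
    simp only [lam', hi.ne', if_false]
    exact h2
  have hle : lam' ≤ lam - Pi.single t 1 := by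
    intro i
    by_cases hi : m' i = 0
    · simp [lam', hi]
    · obtain ⟨B, hB, hx⟩ := hatt i (Nat.pos_of_ne_zero hi)
      exact (mem_Icc.1 (hbound B hB i hx)).2
  refine ⟨lam', ⟨htyp, fun B hB C hC hCB => ?_, hne, fun B hB i x hx => ?_, hatt, fun i => ?_⟩,
    fun i hi => by simp [lam', hi], hle⟩
  · have h1 := subset_Icc_of_toColex_le (hCB t) (hC t t.2).2 (hbound B hB t)
    rw [sub_single_self] at h1
    have h2 : lam t ∉ C t := by
      intro h2
      have := (mem_Icc.1 (h1 h2)).2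
      have := h.pos t
      omega
    refine ⟨h2, h.down _ hB.2 _ ?_ fun i => ?_⟩
    · have := hC.insert (w := lam t - 1) t.2 hpos (by rwa [Nat.sub_add_cancel (h.pos t)])
      rwa [Nat.sub_add_cancel (h.pos t)] at this
    · by_cases hi : i = t
      · subst hi
        simpa using (toColex_insert_le_insert h2 hB.1).2 (hCB i)
      · simpa [hi] using hCB i
  · have h1 := mem_Icc.1 (hbound B hB i hx)
    rw [mem_Icc]
    refine ⟨h1.1, ?_⟩
    by_cases hi : m' i = 0
    · simpa [lam', hi] using h1.2
    · simp only [lam', hi, if_false]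
      exact le_csSup (hbdd i) ⟨B, hB, hx⟩
  · by_cases hi : m' i = 0
    · simp only [lam', hi, if_true]
      by_cases hit : i = t
      · subst hit
        rw [sub_single_self]
        omega
      · rw [sub_single_of_ne hit]
        exact h.pos i
    · obtain ⟨B, hB, hx⟩ := hatt i (Nat.pos_of_ne_zero hi)
      exact (mem_Icc.1 (hbound B hB i hx)).1

/-- A family that is factorizable in all colours consists of all tuples. -/
theorem mem_iff_of_factorSet (h : IsCompressedFamily m lam P) (hf : ∀ i, FactorSet m lam P i)
    (B : Fin n → Finset ℕ) : B ∈ P ↔ Typ n m B ∧ ∀ i, B i ⊆ Icc 1 (lam i) := by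
  refine ⟨fun hB => ⟨h.typ B hB, h.bound B hB⟩, fun hB => ?_⟩
  obtain ⟨B₀, hB₀⟩ := h.nonempty
  have key : ∀ S : Finset (Fin n),
      (fun i => if i ∈ S then Ioc (lam i - m i) (lam i) else B₀ i) ∈ P := by
    intro S
    induction S using Finset.induction_on with
    | empty => simpa using hB₀
    | insert j S hj ih =>
      convert hf j _ ih using 1
      funext i
      by_cases hij : i = j
      · subst hij; simp
      · simp [hij]
  refine h.down _ (key univ) B hB.1 fun i => ?_
  simpa using toColex_le_Ioc (hB.1 i i.2).1 (hB.2 i)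

end IsCompressedFamily

end

section

variable {n : ℕ} {a m lam : Fin n → ℕ} {P : Set (Fin n → Finset ℕ)}

/-! ### The shedding tree of a compressed complex -/

section Shed

variable {V : Type u}

/-- `Δ` is the complex whose facets correspond to the tuples in `P`, where a vertex `v` is
identified with its colour `col v` and its rank `rk v` in the colour class. -/
structure Realizes (col : V → Fin n) (rk : V → ℕ) (Δ : Finset (Finset V))
    (P : Set (Fin n → Finset ℕ)) : Prop where
  mem_iff : ∀ F, F ∈ Δ ↔ ∃ B ∈ P, ∀ v ∈ F, rk v ∈ B (col v)
  exists_vertex : ∀ B ∈ P, ∀ i, ∀ x ∈ B i, ∃ v, col v = i ∧ rk v = x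

variable {col : V → Fin n} {rk : V → ℕ} {Δ : Finset (Finset V)}

namespace Realizes

theorem deletion (hR : Realizes col rk Δ P) (h : IsCompressedFamily m lam P)
    (hinj : ∀ v w, col v = col w → rk v = rk w → v = w) {t : Fin n}
    (hf : ¬ FactorSet m lam P t) {v : V} (hv : col v = t) (hvl : rk v = lam t) :
    Realizes col rk (deletion Δ v) {B | B ∈ P ∧ lam t ∉ B t} := by
  classical
  refine ⟨fun F => ?_, fun B hB => hR.exists_vertex B hB.1⟩
  rw [GenMac.deletion, mem_filter, hR.mem_iff]
  constructor
  · rintro ⟨⟨B, hB, hFB⟩, hvF⟩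
    obtain ⟨B', h1, h2, h3, h4⟩ := h.exists_notMem (h.lt_of_not_factorSet hf) hB
    refine ⟨B', ⟨h1, h2⟩, fun w hw => ?_⟩
    by_cases hwt : col w = t
    · rw [hwt]
      refine h4 (mem_erase.2 ⟨fun hwl => hvF ?_, by rw [← hwt]; exact hFB w hw⟩)
      rwa [hinj v w (by rw [hv, hwt]) (by rw [hvl, hwl])]
    · rw [h3 _ hwt]
      exact hFB w hw
  · rintro ⟨B, ⟨hB, hl⟩, hFB⟩
    refine ⟨⟨B, hB, hFB⟩, fun hvF => hl ?_⟩
    have := hFB v hvF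
    rwa [hv, hvl] at this

theorem link (hR : Realizes col rk Δ P)
    (hinj : ∀ v w, col v = col w → rk v = rk w → v = w) {t : Fin n}
    {v : V} (hv : col v = t) (hvl : rk v = lam t) :
    Realizes col rk (link Δ v)
      {B | lam t ∉ B t ∧ Function.update B t (insert (lam t) (B t)) ∈ P} := by
  classical
  refine ⟨fun F => ?_, fun B hB i x hx => hR.exists_vertex _ hB.2 i x ?_⟩
  · rw [GenMac.link, mem_filter]
    constructor
    · rintro ⟨-, hvF, hF⟩
      obtain ⟨B, hB, hFB⟩ := (hR.mem_iff _).1 hF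
      have hl : lam t ∈ B t := by
        have := hFB v (mem_insert_self _ _)
        rwa [hv, hvl] at this
      refine ⟨Function.update B t ((B t).erase (lam t)), ⟨by simp, ?_⟩, fun w hw => ?_⟩
      · simpa [insert_erase hl] using hB
      · have hwB := hFB w (mem_insert_of_mem hw)
        by_cases hwt : col w = t
        · rw [hwt] at hwB ⊢
          rw [Function.update_self]
          refine mem_erase.2 ⟨fun hwl => hvF ?_, hwB⟩
          rwa [hinj v w (by rw [hv, hwt]) (by rw [hvl, hwl])]
        · rwa [Function.update_of_ne hwt]
    · rintro ⟨B, ⟨hl, hB⟩, hFB⟩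
      have hFB' : ∀ w ∈ F, rk w ∈ Function.update B t (insert (lam t) (B t)) (col w) := by
        intro w hw
        by_cases hwt : col w = t
        · have := hFB w hw
          rw [hwt] at this ⊢
          simp [this]
        · rw [Function.update_of_ne hwt]
          exact hFB w hw
      refine ⟨(hR.mem_iff _).2 ⟨_, hB, hFB'⟩, fun hvF => hl ?_,
        (hR.mem_iff _).2 ⟨_, hB, fun w hw => ?_⟩⟩
      · have := hFB v hvF
        rwa [hv, hvl] at this
      · rcases mem_insert.1 hw with rfl | hw
        · rw [hv, hvl]; simp
        · exact hFB' w hw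
  · by_cases hi : i = t
    · subst hi; simp [hx]
    · simpa [hi] using hx

end Realizes

variable [Fintype V]

/-- The set of vertices that corresponds to a tuple. -/
def vertexSet (col : V → Fin n) (rk : V → ℕ) (B : Fin n → Finset ℕ) : Finset V :=
  univ.filter fun v => rk v ∈ B (col v)

theorem mem_vertexSet {B : Fin n → Finset ℕ} {v : V} :
    v ∈ vertexSet col rk B ↔ rk v ∈ B (col v) := by
  simp [vertexSet]

namespace Realizes

theorem mem_partOf_iff (hR : Realizes col rk Δ P) {i : Fin n} {v : V} :
    v ∈ partOf col Δ i ↔ col v = i ∧ ∃ B ∈ P, rk v ∈ B i := by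
  rw [mem_partOf, hR.mem_iff]
  constructor
  · rintro ⟨rfl, B, hB, h⟩
    exact ⟨rfl, B, hB, h v (mem_singleton_self v)⟩
  · rintro ⟨rfl, B, hB, h⟩
    refine ⟨rfl, B, hB, fun w hw => ?_⟩
    rwa [mem_singleton.1 hw]

theorem partOf_eq_empty (hR : Realizes col rk Δ P) (h : IsCompressedFamily m lam P) {i : Fin n}
    (hi : m i = 0) : partOf col Δ i = ∅ := by
  rw [eq_empty_iff_forall_notMem]
  intro v hv
  obtain ⟨-, B, hB, hx⟩ := hR.mem_partOf_iff.1 hv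
  have := (h.typ B hB i i.2).1
  rw [hi, card_eq_zero] at this
  simp [this] at hx

theorem exists_mem_partOf (hR : Realizes col rk Δ P) (h : IsCompressedFamily m lam P) {i : Fin n}
    (hi : 0 < m i) {x : ℕ} (hx : x ∈ Icc 1 (lam i)) : ∃ v ∈ partOf col Δ i, rk v = x := by
  obtain ⟨B, hB, hxB⟩ := h.exists_mem hi hx
  obtain ⟨v, hv, hvx⟩ := hR.exists_vertex B hB i x hxB
  exact ⟨v, hR.mem_partOf_iff.2 ⟨hv, B, hB, by rwa [hvx]⟩, hvx⟩

theorem rk_mem_of_mem_partOf (hR : Realizes col rk Δ P) (h : IsCompressedFamily m lam P)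
    {i : Fin n} {v : V} (hv : v ∈ partOf col Δ i) : rk v ∈ Icc 1 (lam i) := by
  obtain ⟨-, B, hB, hx⟩ := hR.mem_partOf_iff.1 hv
  exact h.bound B hB i hx

theorem card_partOf (hR : Realizes col rk Δ P) (h : IsCompressedFamily m lam P)
    (hinj : ∀ v w, col v = col w → rk v = rk w → v = w) {i : Fin n} (hi : 0 < m i) :
    (partOf col Δ i).card = lam i := by
  have : (partOf col Δ i).card = #(Icc 1 (lam i)) := by
    refine card_bij (fun v _ => rk v) (fun v hv => hR.rk_mem_of_mem_partOf h hv)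
      (fun v hv w hw hvw => hinj v w ?_ hvw) fun x hx => ?_
    · rw [(mem_partOf.1 hv).1, (mem_partOf.1 hw).1]
    · obtain ⟨v, hv, hvx⟩ := hR.exists_mem_partOf h hi hx
      exact ⟨v, hv, hvx⟩
  rw [this, Nat.card_Icc]
  omega

theorem kappa_eq (hR : Realizes col rk Δ P) (h : IsCompressedFamily m lam P)
    (hinj : ∀ v w, col v = col w → rk v = rk w → v = w) {x : Fin n → ℕ}
    (hx : ∀ i, m i = 0 → x i = lam i) : kappa col Δ x = lam := by
  funext i
  by_cases hi : m i = 0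
  · rw [kappa, hR.partOf_eq_empty h hi]
    simp [hx i hi]
  · rw [kappa, hR.card_partOf h hinj (Nat.pos_of_ne_zero hi)]
    simp [(h.pos i).ne']

/-- For compressed families, being factorizable means that a facet stays a facet when its set of
colour `t` is replaced with the last set of the same size. -/
theorem isFactorizable_iff (hR : Realizes col rk Δ P) (h : IsCompressedFamily m lam P)
    (hinj : ∀ v w, col v = col w → rk v = rk w → v = w) {t : Fin n} (ht : 0 < m t) :
    IsFactorizable Δ (partOf col Δ t) (m t) ↔ FactorSet m lam P t := by
  classical
  have hcard := hR.card_partOf h hinj ht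
  have hle := h.le t
  -- the vertices of colour `t` with ranks in a given set
  have himg : ∀ A : Finset ℕ, A ⊆ Icc 1 (lam t) → #A = m t →
      (partOf col Δ t).filter (fun v => rk v ∈ A) ∈ (partOf col Δ t).powersetCard (m t) := by
    intro A hA hAc
    rw [mem_powersetCard]
    refine ⟨filter_subset _ _, ?_⟩
    rw [← hAc]
    refine card_bij (fun v _ => rk v) (fun v hv => (mem_filter.1 hv).2)
      (fun v hv w hw hvw => hinj v w ?_ hvw) fun x hx => ?_
    · rw [(mem_partOf.1 (mem_filter.1 hv).1).1, (mem_partOf.1 (mem_filter.1 hw).1).1]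
    · obtain ⟨v, hv, hvx⟩ := hR.exists_mem_partOf h ht (hA hx)
      exact ⟨v, mem_filter.2 ⟨hv, by rwa [hvx]⟩, hvx⟩
  constructor
  · rintro ⟨Γ, -, hΓd, hdisj, hΔ⟩ B hB
    have hF : vertexSet col rk B ∈ Δ :=
      (hR.mem_iff _).2 ⟨B, hB, fun v hv => mem_vertexSet.1 hv⟩
    rw [hΔ, mem_image₂] at hF
    obtain ⟨A, hA, G, hG, hAG⟩ := hF
    have hGt : ∀ v ∈ G, v ∉ partOf col Δ t := by
      intro v hv hvt
      obtain ⟨C, hvC, hC⟩ : ∃ C, {v} ⊆ C ∧ C ∈ (partOf col Δ t).powersetCard (m t) := by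
        obtain ⟨C, h1, h2, h3⟩ := exists_subsuperset_card_eq (singleton_subset_iff.2 hvt)
          (n := m t) (by rw [card_singleton]; exact ht) (by omega)
        exact ⟨C, h1, mem_powersetCard.2 ⟨h2, h3⟩⟩
      have hv' : {v} ∈ genBy (partOf col Δ t) (m t) := by
        simp only [genBy, mem_filter, mem_univ, true_and]
        exact ⟨C, hC, hvC⟩
      have h1 := hdisj {v} hv' G hG
      exact disjoint_left.1 h1 (mem_singleton_self v) hv
    have hA' : ∀ v ∈ A, v ∈ partOf col Δ t := by
      intro v hv
      simp only [genBy, mem_filter, mem_univ, true_and] at hA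
      obtain ⟨C, hC, hAC⟩ := hA
      exact (mem_powersetCard.1 hC).1 (hAC hv)
    have htop := himg (Ioc (lam t - m t) (lam t)) (Ioc_sub_subset_Icc _ _) (card_Ioc_sub hle)
    set A' := (partOf col Δ t).filter fun v => rk v ∈ Ioc (lam t - m t) (lam t) with hA'def
    have hF' : A' ∪ G ∈ Δ := by
      rw [hΔ, mem_image₂]
      refine ⟨A', ?_, G, hG, rfl⟩
      simp only [genBy, mem_filter, mem_univ, true_and]
      exact ⟨A', htop, subset_rfl⟩
    obtain ⟨B', hB', hsub⟩ := (hR.mem_iff _).1 hF'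
    convert hB' using 1
    funext i
    by_cases hi : i = t
    · subst hi
      rw [Function.update_self]
      refine eq_of_subset_of_card_le (fun x hx => ?_) ?_
      · obtain ⟨v, hv, hvx⟩ := hR.exists_mem_partOf h ht (Ioc_sub_subset_Icc _ _ hx)
        have := hsub v (mem_union_left _ (mem_filter.2 ⟨hv, by rwa [hvx]⟩))
        rwa [hvx, (mem_partOf.1 hv).1] at this
      · rw [(h.typ B' hB' i i.2).1, card_Ioc_sub hle]
    · rw [Function.update_of_ne hi]
      refine eq_of_subset_of_card_le (fun x hx => ?_) ?_
      · obtain ⟨v, hvi, hvx⟩ := hR.exists_vertex B hB i x hx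
        have hv : v ∈ A ∪ G := by
          rw [hAG, mem_vertexSet, hvi, hvx]; exact hx
        have hvG : v ∈ G := by
          rcases mem_union.1 hv with hv | hv
          · exact absurd ((mem_partOf.1 (hA' v hv)).1.symm.trans hvi) (Ne.symm hi)
          · exact hv
        have := hsub v (mem_union_right _ hvG)
        rwa [hvi, hvx] at this
      · rw [(h.typ B' hB' i i.2).1, (h.typ B hB i i.2).1]
  · intro hf
    refine ⟨Δ.filter fun G => ∀ v ∈ G, col v ≠ t, ?_, ?_, ?_, ?_⟩
    · obtain ⟨B, hB⟩ := h.nonempty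
      exact ⟨∅, mem_filter.2 ⟨(hR.mem_iff _).2 ⟨B, hB, by simp⟩, by simp⟩⟩
    · intro G hG G' hG'
      rw [mem_filter] at hG ⊢
      obtain ⟨B, hB, hGB⟩ := (hR.mem_iff _).1 hG.1
      exact ⟨(hR.mem_iff _).2 ⟨B, hB, fun v hv => hGB v (hG' hv)⟩, fun v hv => hG.2 v (hG' hv)⟩
    · intro A hA G hG
      simp only [genBy, mem_filter, mem_univ, true_and] at hA
      obtain ⟨C, hC, hAC⟩ := hA
      rw [disjoint_left]
      intro v hv hvG
      exact (mem_filter.1 hG).2 v hvG (mem_partOf.1 ((mem_powersetCard.1 hC).1 (hAC hv))).1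
    · ext F
      rw [mem_image₂]
      constructor
      · intro hF
        obtain ⟨B, hB, hFB⟩ := (hR.mem_iff _).1 hF
        refine ⟨F.filter fun v => col v = t, ?_, F.filter fun v => col v ≠ t, ?_,
          filter_union_filter_not_eq _ _⟩
        · simp only [genBy, mem_filter, mem_univ, true_and]
          refine ⟨_, himg (B t) (h.bound B hB t) (h.typ B hB t t.2).1, fun v hv => ?_⟩
          obtain ⟨hv, hvt⟩ := mem_filter.1 hv
          have hvB := hFB v hv
          rw [hvt] at hvB
          exact mem_filter.2 ⟨hR.mem_partOf_iff.2 ⟨hvt, B, hB, hvB⟩, hvB⟩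
        · rw [mem_filter]
          refine ⟨(hR.mem_iff _).2 ⟨B, hB, fun v hv => hFB v (mem_filter.1 hv).1⟩,
            fun v hv => (mem_filter.1 hv).2⟩
      · rintro ⟨A, hA, G, hG, rfl⟩
        simp only [genBy, mem_filter, mem_univ, true_and] at hA
        obtain ⟨C, hC, hAC⟩ := hA
        rw [mem_filter] at hG
        obtain ⟨B, hB, hGB⟩ := (hR.mem_iff _).1 hG.1
        rw [mem_powersetCard] at hC
        have hCi : ∀ v ∈ C, col v = t := fun v hv => (mem_partOf.1 (hC.1 hv)).1
        have hCimg : #(C.image rk) = m t := by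
          rw [card_image_of_injOn, hC.2]
          intro v hv w hw hvw
          exact hinj v w (by rw [hCi v hv, hCi w hw]) hvw
        have hCsub : C.image rk ⊆ Icc 1 (lam t) := by
          intro x hx
          obtain ⟨v, hv, rfl⟩ := mem_image.1 hx
          exact hR.rk_mem_of_mem_partOf h (hC.1 hv)
        refine (hR.mem_iff _).2 ⟨Function.update B t (C.image rk), ?_, fun v hv => ?_⟩
        · have h1 := h.update_mem (hf B hB) (t := t) (A := C.image rk) hCimg
            (fun h0 => by simpa using hCsub h0)
            (by simpa using toColex_le_Ioc hCimg hCsub)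
          simpa using h1
        · rcases mem_union.1 hv with hv | hv
          · rw [hCi v (hAC hv), Function.update_self]
            exact mem_image_of_mem _ (hAC hv)
          · rw [Function.update_of_ne (hG.2 v hv)]
            exact hGB v hv

end Realizes

/-- Factorizable colours keep all their vertices in the link. -/
theorem IsCompressedFamily.link_lam_eq {t i : Fin n} (h : IsCompressedFamily m lam P)
    {lam' : Fin n → ℕ}
    (hst : IsCompressedFamily (m - Pi.single t 1) lam'
      {B | lam t ∉ B t ∧ Function.update B t (insert (lam t) (B t)) ∈ P})
    (hlam0 : ∀ i, (m - Pi.single t 1 : Fin n → ℕ) i = 0 →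
      lam' i = (lam - Pi.single t 1 : Fin n → ℕ) i)
    (hlam' : lam' ≤ lam - Pi.single t 1) (hit : i ≠ t) (hf : FactorSet m lam P i) :
    lam' i = lam i := by
  by_cases hi0 : (m - Pi.single t 1 : Fin n → ℕ) i = 0
  · rw [hlam0 i hi0, sub_single_of_ne hit]
  · obtain ⟨B, hB⟩ := hst.nonempty
    have h1 := hf _ hB.2
    rw [Function.update_comm hit.symm] at h1
    have h2 := hst.bound (Function.update B i (Ioc (lam i - m i) (lam i)))
      ⟨by rw [Function.update_of_ne hit.symm]; exact hB.1,
        by rw [Function.update_of_ne hit.symm]; exact h1⟩ i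
    rw [Function.update_self] at h2
    rw [sub_single_of_ne hit] at hi0
    have h3 : lam i ∈ Ioc (lam i - m i) (lam i) := by
      have := h.pos i
      rw [mem_Ioc]; omega
    have h4 := hlam' i
    rw [sub_single_of_ne hit] at h4
    exact le_antisymm h4 (mem_Icc.1 (h2 h3)).2

/-- A vertex of the shedding tree is split in the way that the conditions on good trees require,
provided that this holds for its two children. -/
theorem IsCompressedFamily.good_node (h : IsCompressedFamily m lam P) {t : Fin n}
    (hf : ¬ FactorSet m lam P t) (hfac : ∀ i, t < i → FactorSet m lam P i)
    (hma : ∀ i < t, m i = a i)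
    {lam' : Fin n → ℕ}
    (hst : IsCompressedFamily (m - Pi.single t 1) lam'
      {B | lam t ∉ B t ∧ Function.update B t (insert (lam t) (B t)) ∈ P})
    (hlam0 : ∀ i, (m - Pi.single t 1 : Fin n → ℕ) i = 0 →
      lam' i = (lam - Pi.single t 1 : Fin n → ℕ) i)
    (hlam' : lam' ≤ lam - Pi.single t 1) {l r : MTree n}
    (hl : Good a l m) (hll : MTree.lw l = lam - Pi.single t 1) (hbl : Below (t + 1) l)
    (hml : ∀ B, (B ∈ P ∧ lam t ∉ B t) ↔ Typ n m B ∧ Mem n l B)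
    (hr : Good a r (m - Pi.single t 1)) (hlr : MTree.lw r = lam') (hbr : Below (t + 1) r)
    (hmr : ∀ B, (lam t ∉ B t ∧ Function.update B t (insert (lam t) (B t)) ∈ P) ↔
      Typ n (m - Pi.single t 1) B ∧ Mem n r B) :
    Good a (.node t l r) m ∧ MTree.lw (.node t l r) = lam ∧
      ∀ B, B ∈ P ↔ Typ n m B ∧ Mem n (.node t l r) B := by
  have hpos := h.pos_of_not_factorSet hf
  have hlt := h.lt_of_not_factorSet hf
  have hw : MTree.lw l t + 1 = lam t := by
    rw [hll, sub_single_self]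
    have := h.pos t
    omega
  have hwl : MTree.lw l t = lam t - 1 := by omega
  have hmem : ∀ B, B ∈ P ↔ Typ n m B ∧ Mem n (.node t l r) B := by
    intro B
    by_cases hB : lam t ∈ B t
    · rw [mem_node_of_mem (by rwa [hw]), hw]
      constructor
      · intro hBP
        refine ⟨h.typ B hBP, ((hmr _).1 ⟨by simp, ?_⟩).2⟩
        simpa [insert_erase hB] using hBP
      · rintro ⟨h1, h2⟩
        have h3 := ((hmr _).2 ⟨h1.erase t.2 hB, h2⟩).2
        simpa [insert_erase hB] using h3
    · rw [mem_node_of_notMem (by rwa [hw]), ← hml]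
      exact ⟨fun h => ⟨h, hB⟩, fun h => h.1⟩
  have hlast : ∀ B ∈ P, lam t ∈ B t →
      Mem n l (Function.update B t (Ioc (MTree.lw l t - m t) (MTree.lw l t))) := by
    intro B hB hlB
    have h1 : Function.update B t (Ioc (MTree.lw l t - m t) (MTree.lw l t)) ∈ P := by
      refine h.update_mem hB (card_Ioc_sub (hl.le_lw t)) (by simp) (toColex_lt_of_mem ?_ hlB).le
      intro x hx
      rw [mem_Ioc] at hx
      omega
    refine ((hml _).1 ⟨h1, ?_⟩).2
    rw [Function.update_self, mem_Ioc]
    omega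
  have hrw : ∀ i, t < i → MTree.lw r i = MTree.lw l i := by
    intro i hi
    rw [hll, hlr, h.link_lam_eq hst hlam0 hlam' hi.ne' (hfac i hi), sub_single_of_ne hi.ne']
  refine ⟨⟨hpos, hma, hbl, hbr, by rw [hlr, hll]; exact hlam', hrw, ?_, fun h1 => ?_, ?_, hl, hr,
    ?_⟩, ?_, hmem⟩
  · obtain ⟨B, hB, hlB⟩ := h.attained t hpos
    exact hl.full_of_mem hbl (hlast B hB hlB) (by simp)
  · rw [hlr, hll]
    refine hlam0 t ?_
    rw [sub_single_self, h1]
  · -- equal children without further vertices labeled `t` make the family factorizable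
    rintro ⟨rfl, hb⟩
    refine hf fun B hB => ?_
    have h1 := (hmem B).1 hB
    have hB' : Mem t l B := by
      by_cases hlB : lam t ∈ B t
      · have h2 := h1.2
        rw [mem_node_of_mem (by rwa [hw])] at h2
        refine (mem_congr hb fun i hi => ?_).1 ((hl.mem_iff t.2.le hb).1 h2).1
        rw [Function.update_of_ne (Fin.ne_of_lt hi)]
      · have h2 := h1.2
        rw [mem_node_of_notMem (by rwa [hw])] at h2
        exact ((hl.mem_iff t.2.le hb).1 h2).1
    refine (hmem _).2 ⟨h1.1.update (card_Ioc_sub hlt.le) (by simp), ?_⟩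
    have h3 : lam t - (m t) < lam t := by omega
    rw [mem_node_of_mem (by rw [hw, Function.update_self, mem_Ioc]; omega), Function.update_idem,
      Function.update_self, hl.mem_iff t.2.le hb]
    refine ⟨(mem_congr hb fun i hi => ?_).1 hB', fun i hi hin => ?_⟩
    · rw [Function.update_of_ne (Fin.ne_of_lt hi)]
    · rcases (Fin.le_def.2 hi : t ≤ i).eq_or_lt with rfl | hi'
      · rw [Function.update_self, ← hw, erase_Ioc_succ hpos]
        exact Ioc_sub_subset_Icc _ _
      · rw [Function.update_of_ne hi'.ne']
        have h4 := h.bound B hB i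
        rwa [hll, sub_single_of_ne hi'.ne']
  · intro B hBa hBM
    -- complete `B` to a member `C` of the link, add the largest vertex of colour `t`, and replace
    -- the resulting set of colour `t` with the last one that avoids this vertex
    obtain ⟨B₀, hB₀, hB₀M, -⟩ := hr.exists_mem t
    have hBl := fun i (hi : i < t) => (hr.good_leftEnd t).subset_of_mem hBM hi
    let C : Fin n → Finset ℕ := fun i =>
      if i < t then B i else if i = t then Icc 1 (m t - 1) else B₀ i
    have hCt : C t = Icc 1 (m t - 1) := by simp [C]
    have hClt : ∀ i < t, C i = B i := fun i hi => by simp [C, hi]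
    have hCgt : ∀ i, t < i → C i = B₀ i := fun i hi => by simp [C, hi.not_gt, hi.ne']
    have hC : Typ n (m - Pi.single t 1) C := by
      intro i _
      rcases lt_trichotomy i t with hi | rfl | hi
      · rw [hClt i hi, sub_single_of_ne hi.ne, hBa i hi, hma i hi]
        exact ⟨rfl, fun h0 => by simpa using hBl i hi h0⟩
      · rw [hCt, sub_single_self]
        simp
      · rw [hCgt i hi]
        exact hB₀ i i.2
    have hCM : Mem n r C := by
      rw [hr.mem_first t.2 hbr (by rw [hCt, sub_single_self])]
      refine ⟨(mem_congr (hr.below_leftEnd hbr) fun i hi => ?_).1 hBM, fun i hi _ => ?_⟩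
      · rw [hClt i hi]
      · rw [hCgt i hi]
        exact hr.subset_of_mem hB₀M i.2
    have h1 := hlast _ ((hmr C).2 ⟨hC, hCM⟩).2 (by simp)
    rw [Function.update_idem, hl.mem_last t.2 hbl ?_ (by simp)] at h1
    · refine (mem_congr (hl.below_runEnd hbl) fun i hi => ?_).1 h1.1
      rw [Function.update_of_ne (Fin.ne_of_lt hi), hClt i hi]
    · obtain ⟨B', hB', hlB'⟩ := h.attained t hpos
      exact hl.full_of_mem hbl (hlast B' hB' hlB') (by simp)
  · funext i
    by_cases hi : i = t
    · subst hi
      rw [lw_node_self, hw]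
    · rw [lw_node_of_ne hi, hll, sub_single_of_ne hi]

variable [PartialOrder V]

theorem mustSplit_iff {s : SheddingLabel n V} (hR : Realizes col rk s.faces P)
    (h : IsCompressedFamily s.type s.lam P) (hinj : ∀ v w, col v = col w → rk v = rk w → v = w)
    (hle : ∀ v w, col v = col w → rk v ≤ rk w → v ≤ w) {t : Fin n} :
    s.MustSplit col t ↔ ¬ FactorSet s.type s.lam P t := by
  constructor
  · rintro ⟨h1, v, hv⟩ h2
    refine h1 ((hR.isFactorizable_iff h hinj (Nat.pos_of_ne_zero fun h0 => ?_)).2 h2)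
    have h3 := hv.1
    rw [SheddingLabel.part, hR.partOf_eq_empty h h0] at h3
    simp at h3
  · intro hf
    have hpos := h.pos_of_not_factorSet hf
    refine ⟨fun h1 => hf ((hR.isFactorizable_iff h hinj hpos).1 h1), ?_⟩
    obtain ⟨v, hv, hvl⟩ := hR.exists_mem_partOf h hpos (x := s.lam t)
      (mem_Icc.2 ⟨h.pos t, le_rfl⟩)
    refine ⟨v, hv, fun w hw => hle w v ?_ ?_⟩
    · rw [(mem_partOf.1 hw).1, (mem_partOf.1 hv).1]
    · rw [hvl]
      exact (mem_Icc.1 (hR.rk_mem_of_mem_partOf h hw)).2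

theorem rk_of_isGreatest {s : SheddingLabel n V} (hR : Realizes col rk s.faces P)
    (h : IsCompressedFamily s.type s.lam P) (hlt : ∀ v w, col v = col w → v ≤ w → rk v ≤ rk w)
    {t : Fin n} (hpos : 0 < s.type t) {v : V} (hv : IsGreatest (s.part col t : Set V) v) :
    col v = t ∧ rk v = s.lam t := by
  have hvt := (mem_partOf.1 (mem_coe.1 hv.1)).1
  refine ⟨hvt, le_antisymm (mem_Icc.1 (hR.rk_mem_of_mem_partOf h hv.1)).2 ?_⟩
  obtain ⟨w, hw, hwl⟩ := hR.exists_mem_partOf h hpos (x := s.lam t)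
    (mem_Icc.2 ⟨h.pos t, le_rfl⟩)
  rw [← hwl]
  exact hlt w v (by rw [hvt, (mem_partOf.1 hw).1]) (hv.2 hw)

/-- The tree grown by the shedding algorithm is good, and it encodes the given family. -/
theorem good_shed (hord : ∀ v w, col v = col w → (v ≤ w ↔ rk v ≤ rk w)) (k : ℕ)
    (s : SheddingLabel n V) (P : Set (Fin n → Finset ℕ)) (hR : Realizes col rk s.faces P)
    (h : IsCompressedFamily s.type s.lam P) (hfac : ∀ i : Fin n, k ≤ i → FactorSet s.type s.lam P i)
    (hma : ∀ i : Fin n, (i : ℕ) + 1 < k → s.type i = a i) :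
    Good a ((shed col k s).map SheddingLabel.lam) s.type ∧
      MTree.lw ((shed col k s).map SheddingLabel.lam) = s.lam ∧
      Below k ((shed col k s).map SheddingLabel.lam) ∧
      ∀ B, B ∈ P ↔ Typ n s.type B ∧ Mem n ((shed col k s).map SheddingLabel.lam) B := by
  have hinj : ∀ v w, col v = col w → rk v = rk w → v = w := fun v w hc hr =>
    le_antisymm ((hord v w hc).2 hr.le) ((hord w v hc.symm).2 hr.ge)
  induction k generalizing s P with
  | zero =>
    rw [shed, LTree.map]
    refine ⟨⟨h.pos, h.le⟩, rfl, trivial, fun B => ?_⟩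
    rw [h.mem_iff_of_factorSet fun i => hfac i (Nat.zero_le _)]
    exact and_congr_right fun _ => ⟨fun H i _ => H i, fun H i => H i i.2⟩
  | succ k ihk =>
    induction hc : s.faces.card using Nat.strong_induction_on generalizing s P with
    | _ c ihc =>
    have stay : (∀ ht : k < n, FactorSet s.type s.lam P ⟨k, ht⟩) →
        Good a ((shed col k s).map SheddingLabel.lam) s.type ∧
        MTree.lw ((shed col k s).map SheddingLabel.lam) = s.lam ∧
        Below (k + 1) ((shed col k s).map SheddingLabel.lam) ∧
        ∀ B, B ∈ P ↔ Typ n s.type B ∧ Mem n ((shed col k s).map SheddingLabel.lam) B := by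
      intro hk
      have hfac' : ∀ i : Fin n, k ≤ i → FactorSet s.type s.lam P i := by
        intro i hi
        rcases hi.eq_or_lt with rfl | hi
        · exact hk i.2
        · exact hfac i hi
      obtain ⟨h1, h2, h3, h4⟩ := ihk s P hR h hfac' fun i hi => hma i (by omega)
      exact ⟨h1, h2, h3.mono (Nat.le_succ k), h4⟩
    rw [shed]
    split_ifs with ht hs
    · have hf := (mustSplit_iff hR h hinj fun v w hc => (hord v w hc).2).1 hs
      set t : Fin n := ⟨k, ht⟩ with htdef
      have hpos := h.pos_of_not_factorSet hf
      obtain ⟨hv, hvl⟩ := rk_of_isGreatest hR h (fun v w hc => (hord v w hc).1) hpos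
        hs.2.choose_spec
      set v := hs.2.choose with hvdef
      obtain ⟨lam', hst', hl0, hlle⟩ := h.link hf
      have hstl := h.deletion hf
      have hRl := hR.deletion h hinj hf hv hvl
      have hRr := hR.link hinj hv hvl
      have hkl : (s.left col t v).lam = s.lam - Pi.single t 1 :=
        hRl.kappa_eq hstl hinj fun _ _ => rfl
      have hkr : (s.right col t v).lam = lam' :=
        hRr.kappa_eq hst' hinj fun i hi => (hl0 i hi).symm
      have htlt : ∀ i : Fin n, t < i ↔ k + 1 ≤ i := fun i => by
        rw [Fin.lt_def, htdef]
        exact Nat.lt_iff_add_one_le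
      obtain ⟨l1, l2, l3, l4⟩ := ihc _ (hc ▸ card_deletion_lt hs.mem_faces) (s.left col t v) _
        hRl (by rw [hkl]; exact hstl) (fun i hi => by
          have hti := (htlt i).2 hi
          rintro B ⟨hB, hB'⟩
          rw [hkl, sub_single_of_ne hti.ne']
          exact ⟨hfac i hi B hB, by rwa [Function.update_of_ne hti.ne]⟩) hma rfl
      have hlamr : ∀ i : Fin n, k + 1 ≤ i → lam' i = s.lam i := fun i hi =>
        h.link_lam_eq hst' hl0 hlle ((htlt i).2 hi).ne' (hfac i hi)
      obtain ⟨r1, r2, r3, r4⟩ := ihc _ (hc ▸ card_link_lt hs.mem_faces) (s.right col t v) _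
        hRr (by rw [hkr]; exact hst') (fun i hi => by
          have hti := (htlt i).2 hi
          rintro B ⟨hB, hB'⟩
          rw [hkr, hlamr i hi]
          refine ⟨by rwa [Function.update_of_ne hti.ne], ?_⟩
          rw [Function.update_of_ne hti.ne, Function.update_comm hti.ne']
          have h5 : (s.right col t v).type i = s.type i := sub_single_of_ne hti.ne'
          rw [h5]
          exact hfac i hi _ hB') (fun i hi => by
            have hti : i ≠ t := fun h => by rw [h, htdef] at hi; simp at hi
            have h5 : (s.right col t v).type i = s.type i := sub_single_of_ne hti
            rw [h5, hma i hi]) rfl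
      obtain ⟨g1, g2, g3⟩ := h.good_node hf (fun i hi => hfac i ((htlt i).1 hi))
        (fun i hi => hma i (by rw [Fin.lt_def, htdef] at hi; simpa using hi)) hst' hl0 hlle
        l1 (l2.trans hkl) l3 l4 r1 (r2.trans hkr) r3 r4
      exact ⟨g1, g2, ⟨Nat.lt_succ_self k, l3, r3⟩, g3⟩
    · refine stay fun _ => ?_
      by_contra hf
      exact hs ((mustSplit_iff hR h hinj fun v w hc => (hord v w hc).2).2 hf)
    · exact stay fun ht' => absurd ht' ht

end Shed

end

section

variable {n : ℕ} {a m lam : Fin n → ℕ} {P : Set (Fin n → Finset ℕ)}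

/-! ### Shadows in the colex order -/

/-- Adding a suitable element to the smaller of two sets of equal size does not make it overtake the
other set, to which an arbitrary element is added. -/
theorem exists_insert_toColex_le {A B : Finset ℕ} {x : ℕ} (hx : x ∉ A) (h0 : 0 ∉ A) (hx0 : x ≠ 0)
    (hc : #B = #A) (hBA : toColex B ≤ toColex A) :
    ∃ y, y ∉ B ∧ y ≠ 0 ∧ toColex (insert y B) ≤ toColex (insert x A) := by
  -- take for `y` the smallest positive integer outside `B`
  have hex : ∃ y, y ∉ B ∧ y ≠ 0 := by
    obtain ⟨y, hy⟩ := Infinite.exists_notMem_finset (insert 0 B)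
    simp only [mem_insert, not_or] at hy
    exact ⟨y, hy.2, hy.1⟩
  classical
  obtain ⟨hyB, hy0⟩ := Nat.find_spec hex
  have hmin : ∀ z, z < Nat.find hex → z ≠ 0 → z ∈ B := fun z hz hz0 => by
    by_contra hzB
    exact Nat.find_min hex hz ⟨hzB, hz0⟩
  set y := Nat.find hex
  refine ⟨y, hyB, hy0, ?_⟩
  by_contra hlt
  rw [not_le, Colex.toColex_lt_toColex_iff_exists_forall_lt] at hlt
  obtain ⟨d, hd, hdx, hd'⟩ := hlt
  simp only [mem_insert, not_or] at hd hdx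
  have hne : ∀ z ∈ A, z ≠ 0 := fun z hz h => h0 (h ▸ hz)
  have hxd : x ∉ B → x ≠ y → x < d := fun h1 h2 => hd' x (by simp) (by simp [h1, h2])
  rcases hd with rfl | hdB
  · have hsub : A ⊆ B := by
      intro z hz
      by_contra hzB
      have hzd : z ≠ y := fun h => hdx.2 (h ▸ hz)
      exact hzB (hmin z (hd' z (by simp [hz]) (by simp [hzB, hzd])) (hne z hz))
    have heq := eq_of_subset_of_card_le hsub hc.le
    have hxB : x ∉ B := heq ▸ hx
    exact hxB (hmin x (hxd hxB (Ne.symm hdx.1)) hx0)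
  · obtain ⟨c, hcA, hcB, hdc⟩ := Colex.toColex_le_toColex.1 hBA hdB hdx.2
    have hcy : c = y := by
      by_contra hcy
      have := hd' c (by simp [hcA]) (by simp [hcB, hcy])
      omega
    subst hcy
    have hdy : d < y := lt_of_le_of_ne hdc fun h => hcB (h ▸ hdB)
    have hsub : A \ B ⊆ {y} := by
      intro z hz
      rw [mem_sdiff] at hz
      by_contra hzc
      rw [mem_singleton] at hzc
      have := hd' z (by simp [hz.1]) (by simp [hz.2, hzc])
      exact hz.2 (hmin z (by omega) (hne z hz.1))
    have hcard : #(B \ A) ≤ 1 := by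
      have h1 := card_sdiff_add_card_inter A B
      have h2 := card_sdiff_add_card_inter B A
      rw [inter_comm] at h2
      have h3 : #(A \ B) ≤ 1 := by simpa using card_le_card hsub
      omega
    have hxc : x ≠ y := fun h => hx (h ▸ hcA)
    by_cases hxB : x ∈ B
    · have := card_le_one.1 hcard x (mem_sdiff.2 ⟨hxB, hx⟩) d (mem_sdiff.2 ⟨hdB, hdx.2⟩)
      exact hdx.1 this.symm
    · have := hxd hxB hxc
      exact hxB (hmin x (by omega) hx0)

/-- The shadow of a colex initial segment is a colex initial segment. -/
theorem exists_superset_toColex_le {A A' B : Finset ℕ} (hA : A ⊆ A') (h0 : 0 ∉ A') (hB0 : 0 ∉ B)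
    (hc : #B = #A) (hBA : toColex B ≤ toColex A) :
    ∃ B', B ⊆ B' ∧ #B' = #A' ∧ 0 ∉ B' ∧ toColex B' ≤ toColex A' := by
  induction hk : #A' - #A generalizing A B with
  | zero =>
    have := eq_of_subset_of_card_le hA (by omega)
    subst this
    exact ⟨B, subset_rfl, hc, hB0, hBA⟩
  | succ k ih =>
    have hss : A ⊂ A' := by
      refine hA.ssubset_of_ne fun h => ?_
      rw [h] at hk
      omega
    obtain ⟨x, hx, hxA⟩ := exists_of_ssubset hss
    have hx0 : x ≠ 0 := fun h => h0 (h ▸ hx)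
    obtain ⟨y, hy, hy0, hle⟩ := exists_insert_toColex_le hxA (fun h => h0 (hA h)) hx0 hc hBA
    obtain ⟨B', h1, h2⟩ := ih (A := insert x A) (B := insert y B) (insert_subset hx hA)
      (by simp [hy0.symm, hB0]) (by rw [card_insert_of_notMem hy, card_insert_of_notMem hxA, hc])
      hle (by rw [card_insert_of_notMem hxA]; omega)
    exact ⟨B', (subset_insert _ _).trans h1, h2⟩

/-! ### Compressed complexes and compressed families -/

namespace OrderedColoredComplex

variable {K : OrderedColoredComplex.{u} n}

theorem mem_part {t : Fin n} {v : K.V} : v ∈ K.part t ↔ K.color v = t := by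
  simp [part]

theorem mem_faces {F : Finset K.V} : F ∈ K.faces ↔ F = ∅ ∨ F ∈ K.complex := by
  simp [faces]

theorem empty_mem_faces : ∅ ∈ K.faces := mem_faces.2 (Or.inl rfl)

theorem singleton_mem_faces (v : K.V) : {v} ∈ K.faces :=
  mem_faces.2 (Or.inr (K.complex.singleton_mem v))

theorem mem_faces_of_subset {F G : Finset K.V} (hF : F ∈ K.faces) (hGF : G ⊆ F) :
    G ∈ K.faces := by
  rcases G.eq_empty_or_nonempty with rfl | hG
  · exact empty_mem_faces
  · rcases mem_faces.1 hF with rfl | hF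
    · rw [subset_empty] at hGF
      rw [hGF]
      exact empty_mem_faces
    · exact mem_faces.2 (Or.inr ((K.complex.isRelLowerSet_faces hF).2 hGF hG))

theorem mem_facets {F : Finset K.V} :
    F ∈ K.facets ↔ F ∈ K.faces ∧ ∀ G ∈ K.faces, F ⊆ G → F = G := by
  classical
  simp [facets]

open Classical in
theorem mem_traces {F A : Finset K.V} {t : Fin n} :
    A ∈ K.traces F t ↔ ∃ F' ∈ K.faces, #(F' ∩ K.part t) = #(F ∩ K.part t) ∧
      F' \ K.part t = F \ K.part t ∧ F' ∩ K.part t = A := by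
  simp only [traces, mem_image, mem_filter]
  constructor
  · rintro ⟨F', ⟨h1, h2, h3⟩, h4⟩
    exact ⟨F', h1, h2, h3, h4⟩
  · rintro ⟨F', h1, h2, h3, h4⟩
    exact ⟨F', ⟨h1, h2, h3⟩, h4⟩

open Classical in
theorem card_eq_sum_card_inter_part (F : Finset K.V) : #F = ∑ i, #(F ∩ K.part i) := by
  rw [card_eq_sum_card_fiberwise (f := K.color) (t := univ) (by simp)]
  refine sum_congr rfl fun i _ => congrArg _ ?_
  ext v
  simp [mem_part]

theorem exists_facet {F : Finset K.V} (hF : F ∈ K.faces) : ∃ G ∈ K.facets, F ⊆ G := by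
  obtain ⟨G, hFG, hG⟩ := K.faces.exists_le_maximal hF
  exact ⟨G, mem_facets.2 ⟨hG.1, fun H hH hGH => le_antisymm hGH (hG.2 hH hGH)⟩, hFG⟩

end OrderedColoredComplex

open OrderedColoredComplex

section Realized

variable {K : OrderedColoredComplex.{u} n} {rk : K.V → ℕ}

/-- Vertices of the same colour are ordered by the values of `rk`. -/
def IsRanking (K : OrderedColoredComplex.{u} n) (rk : K.V → ℕ) : Prop :=
  ∀ v w, K.color v = K.color w → (v ≤ w ↔ rk v ≤ rk w)

theorem vertexSet_mem_faces (hR : Realizes K.color rk K.faces P) {B : Fin n → Finset ℕ}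
    (hB : B ∈ P) : vertexSet K.color rk B ∈ K.faces :=
  (hR.mem_iff _).2 ⟨B, hB, fun _ hv => mem_vertexSet.1 hv⟩

open Classical in
theorem image_rk_inter_part (hR : Realizes K.color rk K.faces P) {B : Fin n → Finset ℕ}
    (hB : B ∈ P) (i : Fin n) : (vertexSet K.color rk B ∩ K.part i).image rk = B i := by
  ext x
  simp only [mem_image, mem_inter, mem_vertexSet, mem_part]
  constructor
  · rintro ⟨v, ⟨h1, rfl⟩, rfl⟩
    exact h1
  · intro hx
    obtain ⟨v, rfl, rfl⟩ := hR.exists_vertex B hB i x hx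
    exact ⟨v, ⟨hx, rfl⟩, rfl⟩

theorem rk_injective_of_order (hord : IsRanking K rk) :
    ∀ v w, K.color v = K.color w → rk v = rk w → v = w :=
  fun v w hc hr => le_antisymm ((hord v w hc).2 hr.le) ((hord w v hc.symm).2 hr.ge)

open Classical in
theorem card_image_rk (hord : IsRanking K rk) {F : Finset K.V} {i : Fin n}
    (hF : F ⊆ K.part i) : #(F.image rk) = #F := by
  refine card_image_of_injOn fun v hv w hw hvw => rk_injective_of_order hord v w ?_ hvw
  rw [mem_part.1 (hF hv), mem_part.1 (hF hw)]

open Classical in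
theorem toColex_image_rk_le (hord : IsRanking K rk) {A B : Finset K.V} {i : Fin n}
    (hA : A ⊆ K.part i) (hB : B ⊆ K.part i) (h : toColex B ≤ toColex A) :
    toColex (B.image rk) ≤ toColex (A.image rk) := by
  rw [Colex.toColex_le_toColex] at h ⊢
  intro x hx hxA
  obtain ⟨v, hv, rfl⟩ := mem_image.1 hx
  obtain ⟨w, hw, hwB, hvw⟩ := h hv fun hv => hxA (mem_image_of_mem _ hv)
  refine ⟨rk w, mem_image_of_mem _ hw, fun hwB' => hwB ?_, (hord v w ?_).1 hvw⟩
  · obtain ⟨u, hu, huw⟩ := mem_image.1 hwB'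
    rwa [← rk_injective_of_order hord u w (by rw [mem_part.1 (hB hu), mem_part.1 (hA hw)]) huw]
  · rw [mem_part.1 (hB hv), mem_part.1 (hA hw)]

open Classical in
theorem card_vertexSet_inter_part (hord : IsRanking K rk) (hR : Realizes K.color rk K.faces P)
    (h : IsCompressedFamily a lam P) {B : Fin n → Finset ℕ} (hB : B ∈ P) (i : Fin n) :
    #(vertexSet K.color rk B ∩ K.part i) = a i := by
  rw [← card_image_rk hord inter_subset_right, image_rk_inter_part hR hB, (h.typ B hB i i.2).1]

theorem card_vertexSet (hord : IsRanking K rk) (hR : Realizes K.color rk K.faces P)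
    (h : IsCompressedFamily a lam P) {B : Fin n → Finset ℕ} (hB : B ∈ P) :
    #(vertexSet K.color rk B) = ∑ i, a i := by
  classical
  rw [card_eq_sum_card_inter_part]
  exact sum_congr rfl fun i _ => card_vertexSet_inter_part hord hR h hB i

theorem mem_facets_iff_of_realizes (hord : IsRanking K rk)
    (hR : Realizes K.color rk K.faces P) (h : IsCompressedFamily a lam P)
    {F : Finset K.V} : F ∈ K.facets ↔ ∃ B ∈ P, vertexSet K.color rk B = F := by
  rw [mem_facets]
  constructor
  · rintro ⟨hF, hmax⟩
    obtain ⟨B, hB, hFB⟩ := (hR.mem_iff _).1 hF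
    exact ⟨B, hB, (hmax _ (vertexSet_mem_faces hR hB) fun v hv => mem_vertexSet.2 (hFB v hv)).symm⟩
  · rintro ⟨B, hB, rfl⟩
    refine ⟨vertexSet_mem_faces hR hB, fun G hG hBG => ?_⟩
    obtain ⟨C, hC, hGC⟩ := (hR.mem_iff _).1 hG
    refine eq_of_subset_of_card_le hBG ?_
    rw [card_vertexSet hord hR h hB, ← card_vertexSet hord hR h hC]
    exact card_le_card fun v hv => mem_vertexSet.2 (hGC v hv)

theorem card_facets_of_realizes (hord : IsRanking K rk) (hR : Realizes K.color rk K.faces P)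
    (h : IsCompressedFamily a lam P) {S : Finset (Fin n → Finset ℕ)} (hS : ∀ B, B ∈ S ↔ B ∈ P) :
    #K.facets = #S := by
  classical
  refine (card_bij (fun B _ => vertexSet K.color rk B) (fun B hB => ?_) (fun B hB C hC hBC => ?_)
    fun F hF => ?_).symm
  · exact (mem_facets_iff_of_realizes hord hR h).2 ⟨B, (hS B).1 hB, rfl⟩
  · funext i
    rw [← image_rk_inter_part hR ((hS B).1 hB), hBC, image_rk_inter_part hR ((hS C).1 hC)]
  · obtain ⟨B, hB, hF⟩ := (mem_facets_iff_of_realizes hord hR h).1 hF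
    exact ⟨B, (hS B).2 hB, hF⟩

theorem isColorCompressed_of_realizes (hord : IsRanking K rk)
    (hR : Realizes K.color rk K.faces P) (h : IsCompressedFamily a lam P) :
    K.IsColorCompressed := by
  classical
  intro F hF t A hA B hB hBA
  obtain ⟨F', hF', hc, hd, rfl⟩ := mem_traces.1 hA
  obtain ⟨hBt, hBc⟩ := mem_powersetCard.1 hB
  obtain ⟨C, hC, hFC⟩ := (hR.mem_iff _).1 hF'
  have hpos : ∀ v, 0 ≠ rk v := by
    intro v hv
    obtain ⟨C', hC', hvC⟩ := (hR.mem_iff _).1 (singleton_mem_faces v)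
    have := hvC v (mem_singleton_self v)
    rw [← hv] at this
    exact (h.typ C' hC' (K.color v) (K.color v).2).2 this
  obtain ⟨D, hBD, hDc, hD0, hDC⟩ := exists_superset_toColex_le (A := (F' ∩ K.part t).image rk)
    (A' := C t) (B := B.image rk)
    (by
      intro x hx
      obtain ⟨v, hv, rfl⟩ := mem_image.1 hx
      rw [mem_inter, mem_part] at hv
      have := hFC v hv.1
      rwa [hv.2] at this)
    (h.typ C hC t t.2).2
    (fun h0 => by
      obtain ⟨v, -, hv⟩ := mem_image.1 h0
      exact hpos v hv.symm)
    (by rw [card_image_rk hord hBt, card_image_rk hord inter_subset_right, hBc, hc])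
    (toColex_image_rk_le hord inter_subset_right hBt (by convert hBA))
  have hmem := h.update_mem hC (hDc.trans (h.typ C hC t t.2).1) hD0 hDC
  have h1 : (B ∪ F \ K.part t) ∩ K.part t = B := by
    rw [union_inter_distrib_right, inter_eq_left.2 hBt, sdiff_inter_self, union_empty]
  refine mem_traces.2 ⟨B ∪ F \ K.part t, ?_, ?_, ?_, h1⟩
  · refine (hR.mem_iff _).2 ⟨_, hmem, fun v hv => ?_⟩
    rcases mem_union.1 hv with hv | hv
    · rw [mem_part.1 (hBt hv), Function.update_self]
      exact hBD (mem_image_of_mem _ hv)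
    · rw [← hd, mem_sdiff, mem_part] at hv
      rw [Function.update_of_ne hv.2]
      exact hFC v hv.1
  · rw [h1, hBc]
  · rw [union_sdiff_distrib, sdiff_eq_empty_iff_subset.2 hBt, empty_union, Finset.sdiff_idem]

/-- A complex that realizes a compressed family is a compressed complex. -/
theorem isPureCompressedBalanced_of_realizes (hord : IsRanking K rk)
    (hR : Realizes K.color rk K.faces P) (h : IsCompressedFamily a lam P)
    {S : Finset (Fin n → Finset ℕ)} (hS : ∀ B, B ∈ S ↔ B ∈ P) :
    IsPureCompressedBalanced a (#S) K where
  pure F hF G hG := by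
    obtain ⟨B, hB, rfl⟩ := (mem_facets_iff_of_realizes hord hR h).1 hF
    obtain ⟨C, hC, rfl⟩ := (mem_facets_iff_of_realizes hord hR h).1 hG
    rw [card_vertexSet hord hR h hB, card_vertexSet hord hR h hC]
  compressed := isColorCompressed_of_realizes hord hR h
  balanced := by
    classical
    constructor
    · intro F hF t
      obtain ⟨B, hB, hFB⟩ := (hR.mem_iff _).1 hF
      rw [← card_vertexSet_inter_part hord hR h hB t]
      convert card_le_card (inter_subset_inter_right (u := K.part t) (s := F)
        fun v hv => mem_vertexSet.2 (hFB v hv))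
    · apply le_antisymm
      · refine Finset.sup_le fun F hF => ?_
        obtain ⟨B, hB, hFB⟩ := (hR.mem_iff _).1 hF
        rw [← card_vertexSet hord hR h hB]
        exact card_le_card fun v hv => mem_vertexSet.2 (hFB v hv)
      · obtain ⟨B, hB⟩ := h.nonempty
        rw [← card_vertexSet hord hR h hB]
        exact Finset.le_sup (f := Finset.card) (vertexSet_mem_faces hR hB)
  card_facets := card_facets_of_realizes hord hR h hS

end Realized

section Ranks

variable (K : OrderedColoredComplex.{u} n)

open Classical in
/-- The rank of a vertex in its colour class, starting from one. -/
noncomputable def rank (v : K.V) : ℕ := #((K.part (K.color v)).filter fun w => w ≤ v)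

variable {K}

theorem rank_le_rank_iff {v w : K.V} (h : K.color v = K.color w) : v ≤ w ↔ rank K v ≤ rank K w := by
  classical
  have mono : ∀ v w : K.V, K.color v = K.color w → v ≤ w → rank K v ≤ rank K w := by
    intro v w h hvw
    refine card_le_card fun u hu => ?_
    rw [mem_filter] at hu ⊢
    exact ⟨h ▸ hu.1, hu.2.trans hvw⟩
  refine ⟨mono v w h, fun hr => ?_⟩
  by_contra hvw
  have hwv : w ≤ v := ((K.comparable_iff v w).2 h).resolve_left hvw
  have : rank K w < rank K v := by
    refine card_lt_card ⟨fun u hu => ?_, fun hsub => ?_⟩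
    · rw [mem_filter] at hu ⊢
      exact ⟨h ▸ hu.1, hu.2.trans hwv⟩
    · have := hsub (mem_filter.2 ⟨mem_part.2 rfl, le_rfl⟩)
      exact hvw (mem_filter.1 this).2
  omega

theorem rank_injective {v w : K.V} (h : K.color v = K.color w) (hr : rank K v = rank K w) :
    v = w :=
  le_antisymm ((rank_le_rank_iff h).2 hr.le) ((rank_le_rank_iff h.symm).2 hr.ge)

theorem rank_mem_Icc (v : K.V) : rank K v ∈ Icc 1 #(K.part (K.color v)) := by
  classical
  rw [mem_Icc]
  refine ⟨card_pos.2 ⟨v, mem_filter.2 ⟨mem_part.2 rfl, le_rfl⟩⟩, card_le_card (filter_subset _ _)⟩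

theorem exists_rank_eq {i : Fin n} {x : ℕ} (hx : x ∈ Icc 1 #(K.part i)) :
    ∃ v : K.V, K.color v = i ∧ rank K v = x := by
  classical
  have himg : (K.part i).image (rank K) = Icc 1 #(K.part i) := by
    refine eq_of_subset_of_card_le (fun y hy => ?_) ?_
    · obtain ⟨v, hv, rfl⟩ := mem_image.1 hy
      have := rank_mem_Icc v
      rwa [mem_part.1 hv] at this
    · rw [card_image_of_injOn, Nat.card_Icc]
      · omega
      · intro v hv w hw hvw
        exact rank_injective ((mem_part.1 hv).trans (mem_part.1 hw).symm) hvw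
  rw [← himg, mem_image] at hx
  obtain ⟨v, hv, hvx⟩ := hx
  exact ⟨v, mem_part.1 hv, hvx⟩

variable (K) in
/-- The tuples of sets of ranks that correspond to the facets of a complex of type `a`. -/
def facetFamily (a : Fin n → ℕ) : Set (Fin n → Finset ℕ) :=
  {B | Typ n a B ∧ (∀ i, B i ⊆ Icc 1 #(K.part i)) ∧ vertexSet K.color (rank K) B ∈ K.faces}

open Classical in
theorem card_vertexSet_rank_inter_part {B : Fin n → Finset ℕ} {i : Fin n}
    (hB : B i ⊆ Icc 1 #(K.part i)) :
    #(vertexSet K.color (rank K) B ∩ K.part i) = #(B i) := by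
  refine card_bij (fun v _ => rank K v) (fun v hv => ?_) (fun v hv w hw hvw => ?_) fun x hx => ?_
  · rw [mem_inter, mem_vertexSet, mem_part] at hv
    rw [← hv.2]
    exact hv.1
  · rw [mem_inter, mem_part] at hv hw
    exact rank_injective (hv.2.trans hw.2.symm) hvw
  · obtain ⟨v, rfl, rfl⟩ := exists_rank_eq (hB hx)
    exact ⟨v, mem_inter.2 ⟨mem_vertexSet.2 hx, mem_part.2 rfl⟩, rfl⟩

open Classical in
theorem facetFamily_update_mem (hK : K.IsColorCompressed) {B : Fin n → Finset ℕ}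
    (hB : B ∈ facetFamily K a) {t : Fin n} {A : Finset ℕ} (hA : #A = a t) (h0 : 0 ∉ A)
    (hAB : toColex A ≤ toColex (B t)) : Function.update B t A ∈ facetFamily K a := by
  obtain ⟨h1, h2, h3⟩ := hB
  have hAs : A ⊆ Icc 1 #(K.part t) := subset_Icc_of_toColex_le hAB h0 (h2 t)
  have h2' : ∀ i, Function.update B t A i ⊆ Icc 1 #(K.part i) := by
    intro i
    by_cases hi : i = t
    · subst hi; simpa using hAs
    · simpa [hi] using h2 i
  refine ⟨h1.update hA h0, h2', ?_⟩
  have hvt : ∀ v ∈ vertexSet K.color (rank K) (Function.update B t A) ∩ K.part t, rank K v ∈ A := by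
    intro v hv
    rw [mem_inter, mem_vertexSet, mem_part] at hv
    simpa [hv.2] using hv.1
  have hvB : ∀ v : K.V, K.color v = t → rank K v ∈ B t →
      v ∈ vertexSet K.color (rank K) B ∩ K.part t := by
    rintro v rfl hv
    exact mem_inter.2 ⟨mem_vertexSet.2 hv, mem_part.2 rfl⟩
  have hvA : ∀ v : K.V, K.color v = t → rank K v ∈ A →
      v ∈ vertexSet K.color (rank K) (Function.update B t A) ∩ K.part t := by
    rintro v rfl hv
    exact mem_inter.2 ⟨mem_vertexSet.2 (by simpa using hv), mem_part.2 rfl⟩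
  have h4 := hK _ h3 t (vertexSet K.color (rank K) B ∩ K.part t)
    (mem_traces.2 ⟨_, h3, rfl, rfl, rfl⟩)
    (vertexSet K.color (rank K) (Function.update B t A) ∩ K.part t)
    (mem_powersetCard.2 ⟨inter_subset_right, by
      rw [card_vertexSet_rank_inter_part (h2' t), card_vertexSet_rank_inter_part (h2 t),
        Function.update_self, hA, (h1 t t.2).1]⟩) (by
      rw [Colex.toColex_le_toColex] at hAB ⊢
      intro v hv hvn
      have hc := mem_part.1 (mem_inter.1 hv).2
      obtain ⟨y, hy, hyA, hle⟩ := hAB (hvt v hv) fun h => hvn (hvB v hc h)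
      obtain ⟨w, hw, rfl⟩ := exists_rank_eq (h2 t hy)
      exact ⟨w, hvB w hw hy, fun h => hyA (hvt w h),
        (rank_le_rank_iff (hc.trans hw.symm)).2 hle⟩)
  obtain ⟨F', hF', -, hd, hi⟩ := mem_traces.1 h4
  convert hF' using 1
  rw [← sdiff_union_inter F' (K.part t), hd, hi]
  ext v
  by_cases hv : K.color v = t
  · subst hv
    simp [mem_vertexSet, mem_part]
  · simp [mem_vertexSet, mem_part, hv]

/-- The colour classes of a facet may be replaced one after the other. -/
theorem facetFamily_down (hK : K.IsColorCompressed) {B C : Fin n → Finset ℕ}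
    (hB : B ∈ facetFamily K a) (hC : Typ n a C) (hCB : ∀ i, toColex (C i) ≤ toColex (B i)) :
    C ∈ facetFamily K a := by
  have key : ∀ S : Finset (Fin n), (fun i => if i ∈ S then C i else B i) ∈ facetFamily K a := by
    intro S
    induction S using Finset.induction_on with
    | empty => simpa using hB
    | insert j S hj ih =>
      have := facetFamily_update_mem hK ih (t := j) (hC j j.2).1 (hC j j.2).2
        (by simpa [hj] using hCB j)
      convert this using 1
      funext i
      by_cases hij : i = j
      · subst hij; simp
      · simp [hij]
  simpa using key univ

variable {N : ℕ}

open Classical in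
theorem IsPureCompressedBalanced.card_facet_inter_part (hK : IsPureCompressedBalanced a N K)
    {F : Finset K.V} (hF : F ∈ K.facets) (i : Fin n) : #(F ∩ K.part i) = a i := by
  have hcard : #F = ∑ i, a i := by
    obtain ⟨G, hG, hGc⟩ := exists_mem_eq_sup K.faces ⟨∅, empty_mem_faces⟩ Finset.card
    rw [← hK.balanced.2, hGc]
    refine hK.pure F hF G (mem_facets.2 ⟨hG, fun H hH hGH => eq_of_subset_of_card_le hGH ?_⟩)
    rw [← hGc]
    exact Finset.le_sup (f := Finset.card) hH
  rw [card_eq_sum_card_inter_part] at hcard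
  refine (sum_eq_sum_iff_of_le fun i _ => ?_).1 hcard i (mem_univ i)
  convert hK.balanced.1 F (mem_facets.1 hF).1 i

theorem IsPureCompressedBalanced.exists_mem_facetFamily (hK : IsPureCompressedBalanced a N K)
    {F : Finset K.V} (hF : F ∈ K.faces) :
    ∃ B ∈ facetFamily K a, ∀ v ∈ F, rank K v ∈ B (K.color v) := by
  classical
  obtain ⟨G, hG, hFG⟩ := exists_facet hF
  have hGB : vertexSet K.color (rank K) (fun i => (G ∩ K.part i).image (rank K)) = G := by
    ext v
    rw [mem_vertexSet, mem_image]
    constructor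
    · rintro ⟨w, hw, hwv⟩
      rw [mem_inter, mem_part] at hw
      rw [← rank_injective hw.2 hwv]
      exact hw.1
    · exact fun hv => ⟨v, mem_inter.2 ⟨hv, mem_part.2 rfl⟩, rfl⟩
  have hmem : ∀ i, ∀ x ∈ (G ∩ K.part i).image (rank K), x ∈ Icc 1 #(K.part i) := by
    intro i x hx
    obtain ⟨v, hv, rfl⟩ := mem_image.1 hx
    have := rank_mem_Icc v
    rwa [mem_part.1 (mem_inter.1 hv).2] at this
  refine ⟨fun i => (G ∩ K.part i).image (rank K), ⟨fun i _ => ⟨?_, fun h0 => ?_⟩, fun i => ?_, ?_⟩,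
    fun v hv => mem_image_of_mem _ (mem_inter.2 ⟨hFG hv, mem_part.2 rfl⟩)⟩
  · rw [card_image_of_injOn, hK.card_facet_inter_part hG]
    intro v hv w hw hvw
    rw [mem_coe, mem_inter, mem_part] at hv hw
    exact rank_injective (hv.2.trans hw.2.symm) hvw
  · simpa using hmem i 0 h0
  · exact hmem i
  · rw [hGB]
    exact (mem_facets.1 hG).1

theorem IsPureCompressedBalanced.realizes (hK : IsPureCompressedBalanced a N K) :
    Realizes K.color (rank K) K.faces (facetFamily K a) where
  mem_iff F := by
    refine ⟨hK.exists_mem_facetFamily, ?_⟩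
    rintro ⟨B, hB, hFB⟩
    exact mem_faces_of_subset hB.2.2 fun v hv => mem_vertexSet.2 (hFB v hv)
  exists_vertex B hB i x hx := exists_rank_eq (hB.2.1 i hx)

theorem IsPureCompressedBalanced.isCompressedFamily (hK : IsPureCompressedBalanced a N K) :
    IsCompressedFamily a (fun i => #(K.part i)) (facetFamily K a) where
  typ B hB := hB.1
  down B hB C hC hCB := facetFamily_down hK.compressed hB hC hCB
  nonempty := by
    obtain ⟨B, hB, -⟩ := hK.exists_mem_facetFamily empty_mem_faces
    exact ⟨B, hB⟩
  bound B hB i := hB.2.1 i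
  attained i _ := by
    have hpos : 0 < #(K.part i) := by
      obtain ⟨v, hv⟩ := K.color_surjective i
      exact card_pos.2 ⟨v, mem_part.2 hv⟩
    obtain ⟨v, hv, hvx⟩ := exists_rank_eq (K := K) (i := i) (mem_Icc.2 ⟨hpos, le_rfl⟩)
    obtain ⟨B, hB, hvB⟩ := hK.exists_mem_facetFamily (singleton_mem_faces v)
    refine ⟨B, hB, ?_⟩
    have := hvB v (mem_singleton_self v)
    rwa [hvx, hv] at this
  pos i := by
    obtain ⟨v, hv⟩ := K.color_surjective i
    exact card_pos.2 ⟨v, mem_part.2 hv⟩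

/-- The tree induced by the shedding tree of a compressed complex is good, and it encodes the
facets of the complex. -/
theorem good_inducedTree_of_realizes {K : OrderedColoredComplex.{u} n} {rk : K.V → ℕ}
    (hord : IsRanking K rk)
    (hR : Realizes K.color rk K.faces P) (h : IsCompressedFamily a (fun i => #(K.part i)) P) :
    Good a (K.inducedTree a) a ∧ MTree.lw (K.inducedTree a) = (fun i => #(K.part i)) ∧
      ∀ B, B ∈ P ↔ Typ n a B ∧ Mem n (K.inducedTree a) B := by
  obtain ⟨h1, h2, -, h3⟩ := good_shed (a := a) hord n ⟨a, K.faces, fun t => #(K.part t)⟩ P hR h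
    (fun i hi => absurd i.2 (not_lt.2 hi)) fun _ _ => rfl
  exact ⟨h1, h2, h3⟩

theorem IsPureCompressedBalanced.good_inducedTree (hK : IsPureCompressedBalanced a N K) :
    Good a (K.inducedTree a) a ∧ MTree.lw (K.inducedTree a) = (fun i => #(K.part i)) ∧
      (∀ B, B ∈ facetFamily K a ↔ Typ n a B ∧ Mem n (K.inducedTree a) B) ∧
      N = leafSum (K.inducedTree a) (fun i => (a i : ℤ)) := by
  have hord : IsRanking K (rank K) :=
    fun v w h => rank_le_rank_iff h
  obtain ⟨h1, h2, h3⟩ := good_inducedTree_of_realizes hord hK.realizes hK.isCompressedFamily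
  obtain ⟨S, hS, hSc⟩ := h1.exists_finset_card
  refine ⟨h1, h2, h3, ?_⟩
  rw [← hSc, ← hK.card_facets]
  exact card_facets_of_realizes hord hK.realizes hK.isCompressedFamily fun B => by rw [hS, h3]

end Ranks

section Construction

/-- The vertices of the complex of a compressed family: `lam i` vertices of each colour `i`. -/
abbrev FamilyVertex (lam : Fin n → ℕ) : Type u := ULift.{u} (Σ i : Fin n, Fin (lam i))

theorem FamilyVertex.ext {v w : FamilyVertex.{u} lam} (h1 : v.down.1 = w.down.1)
    (h2 : (v.down.2 : ℕ) = w.down.2) : v = w := by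
  obtain ⟨i, x⟩ := v
  obtain ⟨j, y⟩ := w
  simp only at h1
  subst h1
  simp only at h2
  rw [Fin.ext h2]

/-- The complex whose facets are given by a compressed family. -/
def complexOfFamily (hn : 0 < n) (ha : ∀ i, 0 < a i) (h : IsCompressedFamily a lam P) :
    OrderedColoredComplex.{u} n where
  V := FamilyVertex.{u} lam
  nonempty := ⟨⟨⟨⟨0, hn⟩, ⟨0, h.pos _⟩⟩⟩⟩
  order :=
    { le := fun v w => v.down.1 = w.down.1 ∧ (v.down.2 : ℕ) ≤ w.down.2
      lt := fun v w => (v.down.1 = w.down.1 ∧ (v.down.2 : ℕ) ≤ w.down.2) ∧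
        ¬ (w.down.1 = v.down.1 ∧ (w.down.2 : ℕ) ≤ v.down.2)
      lt_iff_le_not_ge := fun _ _ => Iff.rfl
      le_refl := fun v => ⟨rfl, le_rfl⟩
      le_trans := fun u v w h1 h2 => ⟨h1.1.trans h2.1, h1.2.trans h2.2⟩
      le_antisymm := fun v w h1 h2 => FamilyVertex.ext h1.1 (le_antisymm h1.2 h2.2) }
  color v := v.down.1
  color_surjective i := ⟨⟨⟨i, ⟨0, h.pos i⟩⟩⟩, rfl⟩
  comparable_iff v w := by
    constructor
    · rintro (h | h)
      · exact h.1
      · exact h.1.symm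
    · intro h
      rcases le_total (v.down.2 : ℕ) w.down.2 with h' | h'
      · exact Or.inl ⟨h, h'⟩
      · exact Or.inr ⟨h.symm, h'⟩
  complex :=
    { faces := {F | F.Nonempty ∧ ∃ B ∈ P, ∀ v ∈ F, (v.down.2 : ℕ) + 1 ∈ B v.down.1}
      isRelLowerSet_faces := by
        rintro F ⟨hF, B, hB, hFB⟩
        exact ⟨hF, fun G hG hGn => ⟨hGn, B, hB, fun v hv => hFB v (hG hv)⟩⟩
      singleton_mem := fun v => by
        obtain ⟨B, hB, hx⟩ := h.exists_mem (ha v.down.1) (x := (v.down.2 : ℕ) + 1)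
          (mem_Icc.2 ⟨by omega, v.down.2.2⟩)
        refine ⟨singleton_nonempty v, B, hB, fun w hw => ?_⟩
        rwa [mem_singleton.1 hw] }

/-- Every good tree is induced by the shedding tree of a compressed complex. -/
theorem Good.exists_complex (hn : 0 < n) (ha : ∀ i, 0 < a i) {T : MTree n} (hT : Good a T a) :
    ∃ K : OrderedColoredComplex.{u} n,
      IsPureCompressedBalanced a (leafSum T fun i => (a i : ℤ)) K ∧ K.inducedTree a = T := by
  classical
  have h := hT.isCompressedFamily
  set lam := MTree.lw T with hlam
  set P := {B | Typ n a B ∧ Mem n T B} with hP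
  let K : OrderedColoredComplex.{u} n := complexOfFamily hn ha h
  let rk : K.V → ℕ := fun v => (ULift.down (α := Σ i : Fin n, Fin (lam i)) v).2 + 1
  have hord : IsRanking K rk := by
    intro v w hc
    constructor
    · exact fun h => Nat.succ_le_succ h.2
    · exact fun h => ⟨hc, Nat.le_of_succ_le_succ h⟩
  have hR : Realizes K.color rk K.faces P := by
    refine ⟨fun F => ?_, fun B hB i x hx => ?_⟩
    · rw [mem_faces]
      constructor
      · rintro (rfl | ⟨-, B, hB, hFB⟩)
        · obtain ⟨B, hB⟩ := h.nonempty
          exact ⟨B, hB, by simp⟩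
        · exact ⟨B, hB, hFB⟩
      · rintro ⟨B, hB, hFB⟩
        rcases F.eq_empty_or_nonempty with h | h
        · exact Or.inl h
        · exact Or.inr ⟨h, B, hB, hFB⟩
    · have := mem_Icc.1 (h.bound B hB i hx)
      refine ⟨⟨⟨i, ⟨x - 1, by omega⟩⟩⟩, rfl, ?_⟩
      exact Nat.sub_add_cancel this.1
  have hpart : (fun i => #(K.part i)) = lam := by
    funext i
    have : #(K.part i) = Fintype.card (Fin (lam i)) := by
      rw [← card_univ]
      refine (card_bij (fun x _ => (⟨⟨i, x⟩⟩ : FamilyVertex.{u} lam)) (fun x _ => ?_)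
        (fun x _ y _ hxy => ?_) fun v hv => ?_).symm
      · exact mem_part.2 rfl
      · simpa using hxy
      · obtain ⟨⟨j, x⟩⟩ := v
        obtain rfl : j = i := mem_part.1 hv
        exact ⟨x, mem_univ _, rfl⟩
    rw [this, Fintype.card_fin]
  obtain ⟨S, hS, hSc⟩ := hT.exists_finset_card
  obtain ⟨h1, h2, h3⟩ := good_inducedTree_of_realizes hord hR (hpart.symm ▸ h)
  refine ⟨K, hSc ▸ isPureCompressedBalanced_of_realizes hord hR h hS, ?_⟩
  refine h1.eq_of_mem_iff ha hT (h2.trans hpart) fun B hB => ?_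
  have h4 := h3 B
  rw [hP, Set.mem_ofPred_eq] at h4
  exact ⟨fun hM => (h4.2 ⟨hB, hM⟩).2, fun hM => (h4.1 ⟨hB, hM⟩).2⟩

end Construction

end

section

variable {n : ℕ} {a : Fin n → ℕ} {N : ℕ}

open OrderedColoredComplex

/-! ### Isomorphisms of compressed complexes -/

section Degree

variable {K : OrderedColoredComplex.{u} n}

open Classical in
theorem insert_erase_mem_faces (hK : K.IsColorCompressed) {v w : K.V}
    (hc : K.color v = K.color w) (hvw : v ≤ w) {F : Finset K.V} (hF : F ∈ K.faces) (hw : w ∈ F)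
    (hv : v ∉ F) : insert v (F.erase w) ∈ K.faces := by
  set t := K.color w with ht
  have hwA : w ∈ F ∩ K.part t := mem_inter.2 ⟨hw, mem_part.2 rfl⟩
  have hvA : v ∉ F ∩ K.part t := fun h => hv (mem_inter.1 h).1
  have hvE : v ∉ (F ∩ K.part t).erase w := fun h => hvA (mem_of_mem_erase h)
  have h1 := hK F hF t (F ∩ K.part t) (mem_traces.2 ⟨F, hF, rfl, rfl, rfl⟩)
    (insert v ((F ∩ K.part t).erase w))
    (mem_powersetCard.2 ⟨?_, ?_⟩) ?_
  · obtain ⟨F', hF', -, hd, hi⟩ := mem_traces.1 h1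
    convert hF' using 1
    rw [← sdiff_union_inter F' (K.part t), hd, hi]
    ext u
    have hvt : v ∈ K.part t := mem_part.2 hc
    have hwt : w ∈ K.part t := mem_part.2 rfl
    simp only [mem_insert, mem_erase, mem_union, mem_sdiff, mem_inter]
    by_cases hu : u ∈ K.part t
    · simp [hu]
    · have h2 : u ≠ v := fun h => hu (h ▸ hvt)
      have h3 : u ≠ w := fun h => hu (h ▸ hwt)
      simp [hu, h2, h3]
  · rw [insert_subset_iff]
    exact ⟨mem_part.2 hc, (erase_subset _ _).trans inter_subset_right⟩
  · rw [card_insert_of_notMem hvE, card_erase_of_mem hwA]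
    have := card_pos.2 ⟨w, hwA⟩
    omega
  · conv_rhs => rw [← insert_erase hwA]
    rwa [Colex.insert_le_insert hvE (by simp)]

open Classical in
/-- The number of faces that contain a vertex. -/
noncomputable def degree (K : OrderedColoredComplex.{u} n) (v : K.V) : ℕ :=
  #(K.faces.filter fun F => v ∈ F)

open Classical in
/-- Exchange `w` for the smaller vertex `v` in a face, unless `v` is already in it. -/
noncomputable def shift (v w : K.V) (F : Finset K.V) : Finset K.V :=
  if v ∈ F then F else insert v (F.erase w)

open Classical in
theorem shift_mapsTo (hK : K.IsColorCompressed) {v w : K.V} (hc : K.color v = K.color w)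
    (hvw : v ≤ w) : ∀ F ∈ K.faces.filter fun F => w ∈ F,
      shift v w F ∈ K.faces.filter fun F => v ∈ F := by
  intro F hF
  rw [mem_filter] at hF ⊢
  rw [shift]
  split_ifs with hv
  · exact ⟨hF.1, hv⟩
  · exact ⟨insert_erase_mem_faces hK hc hvw hF.1 hF.2 hv, mem_insert_self _ _⟩

open Classical in
theorem shift_injOn {v w : K.V} (hvw : v ≠ w) :
    Set.InjOn (shift v w) (K.faces.filter fun F => w ∈ F) := by
  have hne : ∀ F : Finset K.V, w ∉ insert v (F.erase w) := fun F => by simp [hvw.symm]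
  intro F hF G hG hFG
  have hF' := (mem_filter.1 hF).2
  have hG' := (mem_filter.1 hG).2
  rw [shift, shift] at hFG
  split_ifs at hFG with h1 h2 h2
  · exact hFG
  · exact absurd (hFG ▸ hF') (hne G)
  · exact absurd (hFG ▸ hG') (hne F)
  · rw [← insert_erase hF', ← insert_erase hG', ← erase_insert (a := v) (s := F.erase w),
      hFG, erase_insert]
    · exact fun h => h2 (mem_of_mem_erase h)
    · exact fun h => h1 (mem_of_mem_erase h)

theorem degree_le_degree (hK : K.IsColorCompressed) {v w : K.V} (hc : K.color v = K.color w)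
    (hvw : v < w) : degree K w ≤ degree K v :=
  card_le_card_of_injOn (shift v w) (shift_mapsTo hK hc hvw.le) (shift_injOn hvw.ne)

open Classical in
/-- If `v < w` have equal degrees, then the injection `shift v w` is a bijection. -/
theorem insert_erase_mem_faces_of_degree (hK : K.IsColorCompressed) {v w : K.V}
    (hc : K.color v = K.color w) (hvw : v < w) (hd : degree K v = degree K w) {F : Finset K.V}
    (hF : F ∈ K.faces) (hv : v ∈ F) (hw : w ∉ F) : insert w (F.erase v) ∈ K.faces := by
  obtain ⟨G, hG, hGF⟩ := surjOn_of_injOn_of_card_le (shift v w) (shift_mapsTo hK hc hvw.le)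
    (shift_injOn hvw.ne) hd.le (mem_coe.2 (mem_filter.2 ⟨hF, hv⟩))
  rw [mem_coe, mem_filter] at hG
  rw [shift] at hGF
  split_ifs at hGF with h
  · exact absurd (hGF ▸ hG.2) hw
  · rw [← hGF, erase_insert fun h' => h (mem_of_mem_erase h'), insert_erase hG.2]
    exact hG.1

open Classical in
/-- In a compressed complex, vertices of the same colour and the same degree may be swapped. -/
theorem map_swap_mem_faces (hK : K.IsColorCompressed) {v w : K.V} (hc : K.color v = K.color w)
    (hvw : v < w) (hd : degree K v = degree K w) {F : Finset K.V} (hF : F ∈ K.faces) :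
    F.map (Equiv.swap v w).toEmbedding ∈ K.faces := by
  have key : ∀ u, u ∈ F.map (Equiv.swap v w).toEmbedding ↔ Equiv.swap v w u ∈ F := by
    intro u
    rw [mem_map_equiv, Equiv.symm_swap]
  have hne := hvw.ne
  by_cases hv : v ∈ F <;> by_cases hw : w ∈ F
  · convert hF using 1
    ext u
    rw [key, Equiv.swap_apply_def]
    split_ifs with h1 h2 <;> simp_all
  · convert insert_erase_mem_faces_of_degree hK hc hvw hd hF hv hw using 1
    ext u
    rw [key, Equiv.swap_apply_def, mem_insert, mem_erase]
    split_ifs with h1 h2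
    · subst h1; simp [hne, hw]
    · subst h2; simp [hv]
    · simp [h1, h2]
  · convert insert_erase_mem_faces hK hc hvw.le hF hw hv using 1
    ext u
    rw [key, Equiv.swap_apply_def, mem_insert, mem_erase]
    split_ifs with h1 h2
    · subst h1; simp [hw]
    · subst h2; simp [hne.symm, hv]
    · simp [h1, h2]
  · convert hF using 1
    ext u
    rw [key, Equiv.swap_apply_def]
    split_ifs with h1 h2 <;> simp_all

open Classical in
theorem isIso_swap (hK : K.IsColorCompressed) {v w : K.V} (hc : K.color v = K.color w)
    (hvw : v < w) (hd : degree K v = degree K w) : IsIso K K (Equiv.swap v w) := by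
  refine ⟨fun u => ?_, fun F => ⟨map_swap_mem_faces hK hc hvw hd, fun h => ?_⟩⟩
  · rw [Equiv.swap_apply_def]
    split_ifs with h1 h2
    · rw [h1, hc]
    · rw [h2, hc]
    · rfl
  · have := map_swap_mem_faces hK hc hvw hd h
    rw [map_map] at this
    convert this using 1
    ext u
    simp

end Degree

variable {K K' : OrderedColoredComplex.{u} n}

theorem isIso_trans {K'' : OrderedColoredComplex.{u} n} {e : K.V ≃ K'.V} {e' : K'.V ≃ K''.V}
    (h : IsIso K K' e) (h' : IsIso K' K'' e') : IsIso K K'' (e.trans e') := by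
  refine ⟨fun v => by rw [Equiv.trans_apply, h'.1, h.1], fun F => ?_⟩
  rw [h.2, h'.2, map_map]
  rfl

theorem degree_apply_of_isIso {e : K.V ≃ K'.V} (h : IsIso K K' e) (v : K.V) :
    degree K' (e v) = degree K v := by
  classical
  refine (card_bij (fun F _ => F.map e.toEmbedding) (fun F hF => ?_) (fun F _ G _ hFG => ?_)
    fun G hG => ?_).symm
  · rw [mem_filter] at hF ⊢
    exact ⟨(h.2 F).1 hF.1, by simpa using hF.2⟩
  · exact map_injective _ hFG
  · rw [mem_filter] at hG
    have hG' : (G.map e.symm.toEmbedding).map e.toEmbedding = G := by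
      rw [map_map]
      ext u
      simp
    refine ⟨G.map e.symm.toEmbedding, mem_filter.2 ⟨(h.2 _).2 (by rw [hG']; exact hG.1), ?_⟩, hG'⟩
    rw [mem_map_equiv]
    simpa using hG.2

theorem sum_swap_lt {V : Type*} [Fintype V] [DecidableEq V] (f g : V → ℕ) {v w : V}
    (hf : f v < f w) (hg : g w < g v) :
    ∑ u, f u * g u < ∑ u, f u * g (Equiv.swap v w u) := by
  have hne : v ≠ w := fun h => by rw [h] at hf; omega
  have hmem : w ∈ univ.erase v := mem_erase.2 ⟨hne.symm, mem_univ w⟩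
  rw [← add_sum_erase univ (fun u => f u * g u) (mem_univ v),
    ← add_sum_erase _ (fun u => f u * g u) hmem,
    ← add_sum_erase univ (fun u => f u * g (Equiv.swap v w u)) (mem_univ v),
    ← add_sum_erase _ (fun u => f u * g (Equiv.swap v w u)) hmem]
  have hrest : ∑ u ∈ (univ.erase v).erase w, f u * g (Equiv.swap v w u) =
      ∑ u ∈ (univ.erase v).erase w, f u * g u := by
    refine sum_congr rfl fun u hu => ?_
    simp only [mem_erase] at hu
    rw [Equiv.swap_apply_of_ne_of_ne hu.2.1 hu.1]
  rw [hrest, Equiv.swap_apply_left, Equiv.swap_apply_right]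
  nlinarith

/-- Isomorphic compressed complexes are isomorphic by a map that is increasing on each class.  By
the rearrangement inequality, an isomorphism for which the sum of the products of the ranks of a
vertex and of its image is maximal has this property: vertices in the wrong order have the same
degree, and may be swapped. -/
theorem orderIsomorphic_of_isomorphic (hK : K.IsColorCompressed) (hK' : K'.IsColorCompressed)
    (h : Isomorphic K K') : OrderIsomorphic K K' := by
  classical
  obtain ⟨e₀, he₀⟩ := h
  obtain ⟨e, he, hmax⟩ := exists_max_image (univ.filter fun e : K.V ≃ K'.V => IsIso K K' e)
    (fun e => ∑ u, rank K u * rank K' (e u)) ⟨e₀, by simpa using he₀⟩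
  rw [mem_filter] at he
  have hiso := he.2
  have hmono : ∀ v w, v ≤ w → e v ≤ e w := by
    intro v w hvw
    have hc : K.color v = K.color w := (K.comparable_iff v w).1 (Or.inl hvw)
    have hc' : K'.color (e v) = K'.color (e w) := by rw [hiso.1, hiso.1, hc]
    rcases hvw.eq_or_lt with rfl | hvw
    · exact le_rfl
    by_contra hne
    have hle : e w ≤ e v := ((K'.comparable_iff _ _).2 hc').resolve_left hne
    have hlt : e w < e v := lt_of_le_not_ge hle hne
    have h1 := degree_le_degree hK hc hvw
    have h2 := degree_le_degree hK' hc'.symm hlt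
    rw [degree_apply_of_isIso hiso, degree_apply_of_isIso hiso] at h2
    have hsw := isIso_trans (isIso_swap hK hc hvw (le_antisymm h2 h1)) hiso
    have hf : rank K v < rank K w := by
      rw [← not_le, ← rank_le_rank_iff hc.symm]
      exact hvw.not_ge
    have hg : rank K' (e w) < rank K' (e v) := by
      rw [← not_le, ← rank_le_rank_iff hc']
      exact hne
    have h3 := sum_swap_lt (rank K) (fun u => rank K' (e u)) hf hg
    have h4 := hmax _ (mem_filter.2 ⟨mem_univ _, hsw⟩)
    simp only [Equiv.trans_apply] at h4
    omega
  refine ⟨e, hiso, fun v w => ⟨hmono v w, fun hvw => ?_⟩⟩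
  have hc : K.color v = K.color w := by
    have := (K'.comparable_iff _ _).1 (Or.inl hvw)
    rwa [hiso.1, hiso.1] at this
  rcases (K.comparable_iff v w).2 hc with h | h
  · exact h
  · have := le_antisymm hvw (hmono w v h)
    rw [e.injective this]

/-- The family of facets and the class sizes determine a compressed complex. -/
theorem isomorphic_of_facetFamily_eq (hK : IsPureCompressedBalanced a N K)
    (hK' : IsPureCompressedBalanced a N K') (hpart : ∀ i, #(K.part i) = #(K'.part i))
    (hP : facetFamily K a = facetFamily K' a) : Isomorphic K K' := by
  have hex : ∀ v : K.V, ∃ w : K'.V, K'.color w = K.color v ∧ rank K' w = rank K v := fun v =>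
    exists_rank_eq (by rw [← hpart]; exact rank_mem_Icc v)
  have hex' : ∀ v : K'.V, ∃ w : K.V, K.color w = K'.color v ∧ rank K w = rank K' v := fun v =>
    exists_rank_eq (by rw [hpart]; exact rank_mem_Icc v)
  choose f hfc hfr using hex
  choose g hgc hgr using hex'
  refine ⟨⟨f, g, fun v => rank_injective (by rw [hgc, hfc]) (by rw [hgr, hfr]),
    fun v => rank_injective (by rw [hfc, hgc]) (by rw [hfr, hgr])⟩, hfc, fun F => ?_⟩
  rw [hK.realizes.mem_iff, hK'.realizes.mem_iff, hP]
  refine exists_congr fun B => and_congr_right fun _ => ?_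
  constructor
  · intro H w hw
    obtain ⟨v, hv, rfl⟩ := mem_map.1 hw
    rw [Equiv.coe_toEmbedding, Equiv.coe_fn_mk, hfr, hfc]
    exact H v hv
  · intro H v hv
    rw [← hfr, ← hfc]
    exact H (f v) (mem_map_of_mem _ hv)

theorem rank_apply_of_orderIso {e : K.V ≃ K'.V} (he : IsIso K K' e)
    (hle : ∀ v w, v ≤ w ↔ e v ≤ e w) (v : K.V) : rank K' (e v) = rank K v := by
  classical
  refine (card_bij (fun w _ => e w) (fun w hw => ?_) (fun w _ u _ h => e.injective h)
    fun w hw => ?_).symm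
  · rw [mem_filter, mem_part] at hw ⊢
    rw [he.1, he.1]
    exact ⟨hw.1, (hle _ _).1 hw.2⟩
  · rw [mem_filter, mem_part, he.1] at hw
    refine ⟨e.symm w, mem_filter.2 ⟨mem_part.2 ?_, ?_⟩, e.apply_symm_apply w⟩
    · rw [← he.1, e.apply_symm_apply, hw.1]
    · rw [hle, e.apply_symm_apply]
      exact hw.2

theorem card_part_eq_of_isIso {e : K.V ≃ K'.V} (he : IsIso K K' e) (i : Fin n) :
    #(K.part i) = #(K'.part i) := by
  refine card_bij (fun w _ => e w) (fun w hw => ?_) (fun w _ u _ h => e.injective h)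
    fun w hw => ?_
  · rw [mem_part, he.1]
    exact mem_part.1 hw
  · refine ⟨e.symm w, mem_part.2 ?_, e.apply_symm_apply w⟩
    rw [← he.1, e.apply_symm_apply]
    exact mem_part.1 hw

theorem facetFamily_eq_of_orderIsomorphic {e : K.V ≃ K'.V} (he : IsIso K K' e)
    (hle : ∀ v w, v ≤ w ↔ e v ≤ e w) : facetFamily K a = facetFamily K' a := by
  ext B
  have h1 : (vertexSet K.color (rank K) B).map e.toEmbedding = vertexSet K'.color (rank K') B := by
    ext w
    rw [mem_map_equiv, mem_vertexSet, mem_vertexSet, ← rank_apply_of_orderIso he hle, ← he.1,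
      e.apply_symm_apply]
  simp only [facetFamily, Set.mem_ofPred_eq, card_part_eq_of_isIso he]
  rw [he.2, h1]

/-- Isomorphic compressed complexes induce the same tree. -/
theorem inducedTree_eq_of_isomorphic (ha : ∀ i, 0 < a i) (hK : IsPureCompressedBalanced a N K)
    (hK' : IsPureCompressedBalanced a N K') (h : Isomorphic K K') :
    K.inducedTree a = K'.inducedTree a := by
  obtain ⟨e, he, hle⟩ := orderIsomorphic_of_isomorphic hK.compressed hK'.compressed h
  obtain ⟨h1, h2, h3, -⟩ := hK.good_inducedTree
  obtain ⟨h1', h2', h3', -⟩ := hK'.good_inducedTree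
  refine h1.eq_of_mem_iff ha h1' ?_ fun B hB => ?_
  · rw [h2, h2']
    exact funext fun i => card_part_eq_of_isIso he i
  · have h4 := h3 B
    have h5 := h3' B
    rw [facetFamily_eq_of_orderIsomorphic he hle, h5] at h4
    exact ⟨fun hM => (h4.2 ⟨hB, hM⟩).2, fun hM => (h4.1 ⟨hB, hM⟩).2⟩

/-- Compressed complexes that induce the same tree are isomorphic. -/
theorem isomorphic_of_inducedTree_eq (hK : IsPureCompressedBalanced a N K)
    (hK' : IsPureCompressedBalanced a N K') (h : K.inducedTree a = K'.inducedTree a) :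
    Isomorphic K K' := by
  obtain ⟨-, h2, h3, -⟩ := hK.good_inducedTree
  obtain ⟨-, h2', h3', -⟩ := hK'.good_inducedTree
  refine isomorphic_of_facetFamily_eq hK hK' (fun i => ?_) (Set.ext fun B => ?_)
  · have := congrFun (h2.symm.trans ((congrArg MTree.lw h).trans h2')) i
    exact this
  · rw [h3, h3', h]

end

section

variable {n : ℕ} {a m : Fin n → ℕ} {N : ℕ}

/-! ### Addresses of vertices -/

section Addresses

variable {α : Type*}

theorem sub_nil (T : LTree n α) : T.sub [] = some T := by cases T <;> rfl

theorem sub_false (t : Fin n) (l r : LTree n α) (p : List Bool) :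
    (LTree.node t l r).sub (false :: p) = l.sub p := rfl

theorem sub_true (t : Fin n) (l r : LTree n α) (p : List Bool) :
    (LTree.node t l r).sub (true :: p) = r.sub p := rfl

theorem sub_leaf_cons (x : α) (b : Bool) (p : List Bool) :
    (LTree.leaf x : LTree n α).sub (b :: p) = none := rfl

theorem sub_append {T S : LTree n α} {p : List Bool} (h : T.sub p = some S) (q : List Bool) :
    T.sub (p ++ q) = S.sub q := by
  induction p generalizing T with
  | nil =>
    rw [sub_nil] at h
    cases h
    rfl
  | cons b p ih =>
    cases T with
    | leaf x => simp [sub_leaf_cons] at h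
    | node t l r =>
      cases b with
      | false => exact ih h
      | true => exact ih h

theorem exists_sub_of_append {T S : LTree n α} {p q : List Bool} (h : T.sub (p ++ q) = some S) :
    ∃ S', T.sub p = some S' := by
  induction p generalizing T with
  | nil => exact ⟨T, sub_nil T⟩
  | cons b p ih =>
    cases T with
    | leaf x => simp [sub_leaf_cons] at h
    | node t l r =>
      cases b with
      | false => exact ih h
      | true => exact ih h

theorem sub_child {T : LTree n α} {p : List Bool} {t : Fin n} {l r : LTree n α}
    (h : T.sub p = some (.node t l r)) (b : Bool) :
    T.sub (p ++ [b]) = some (if b then r else l) := by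
  rw [sub_append h]
  cases b
  · rw [sub_false, sub_nil]; rfl
  · rw [sub_true, sub_nil]; rfl

theorem exists_node_of_concat {T S : LTree n α} {p : List Bool} {b : Bool}
    (h : T.sub (p ++ [b]) = some S) : ∃ t l r, T.sub p = some (.node t l r) := by
  obtain ⟨S', hS'⟩ := exists_sub_of_append h
  rw [sub_append hS'] at h
  cases S' with
  | leaf x => simp [sub_leaf_cons] at h
  | node t l r => exact ⟨t, l, r, hS'⟩

theorem Below.sub {k : ℕ} {T S : LTree n α} (h : Below k T) {p : List Bool}
    (hp : T.sub p = some S) : Below k S := by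
  induction p generalizing T with
  | nil =>
    rw [sub_nil] at hp
    cases hp
    exact h
  | cons b p ih =>
    cases T with
    | leaf x => simp [sub_leaf_cons] at hp
    | node t l r =>
      cases b with
      | false => exact ih h.2.1 hp
      | true => exact ih h.2.2 hp

theorem below_of_sub {k : ℕ} {T : LTree n α}
    (h : ∀ p t l r, T.sub p = some (.node t l r) → (t : ℕ) < k) : Below k T := by
  induction T with
  | leaf x => trivial
  | node t l r ihl ihr =>
    exact ⟨h [] t l r (sub_nil _), ihl fun p => h (false :: p), ihr fun p => h (true :: p)⟩

end Addresses

theorem splitLabel_nil (T : MTree n) (v : Fin n → ℤ) : splitLabel T v [] = v := by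
  cases T <;> rfl

theorem splitLabel_append {T S : MTree n} {p : List Bool} (h : T.sub p = some S) (v : Fin n → ℤ)
    (q : List Bool) : splitLabel T v (p ++ q) = splitLabel S (splitLabel T v p) q := by
  induction p generalizing T v with
  | nil =>
    rw [sub_nil] at h
    cases h
    rw [splitLabel_nil]
    rfl
  | cons b p ih =>
    cases T with
    | leaf x => simp [sub_leaf_cons] at h
    | node t l r =>
      cases b with
      | false => exact ih h _
      | true => exact ih h _

theorem splitLabel_le (T : MTree n) (v : Fin n → ℤ) (p : List Bool) (i : Fin n) :
    splitLabel T v p i ≤ v i := by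
  induction p generalizing T v with
  | nil => rw [splitLabel_nil]
  | cons b p ih =>
    cases T with
    | leaf x => exact le_rfl
    | node t l r =>
      cases b with
      | false => exact ih _ _
      | true =>
        refine (ih r (v - Pi.single t 1)).trans ?_
        by_cases hi : i = t
        · subst hi; simp
        · simp [hi]

theorem weightAt_of_sub {T S : MTree n} {p : List Bool} (h : T.sub p = some S) :
    weightAt T p = MTree.lw S := by
  simp [weightAt, h]

theorem weightAt_append {T S : MTree n} {p : List Bool} (h : T.sub p = some S) (q : List Bool) :
    weightAt T (p ++ q) = weightAt S q := by
  rw [weightAt, weightAt, sub_append h]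

/-! ### Good trees satisfy the conditions on Macaulay trees -/

theorem Good.sub {T S : MTree n} (h : Good a T m) {p : List Bool} (hp : T.sub p = some S) :
    ∃ m' : Fin n → ℕ, Good a S m' ∧
      splitLabel T (fun i => (m i : ℤ)) p = fun i => (m' i : ℤ) := by
  induction p generalizing T m with
  | nil =>
    rw [sub_nil] at hp
    cases hp
    exact ⟨m, h, splitLabel_nil _ _⟩
  | cons b p ih =>
    cases T with
    | leaf x => simp [sub_leaf_cons] at hp
    | node t l r =>
      obtain ⟨hm, -, -, -, -, -, -, -, -, hl, hr, -⟩ := h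
      cases b with
      | false => exact ih hl hp
      | true =>
        obtain ⟨m', h1, h2⟩ := ih hr hp
        refine ⟨m', h1, ?_⟩
        rw [← h2, ← natCast_sub_single hm]
        rfl

/-- The label of every trivalent vertex is at most that of each of its ancestors. -/
def LabelsAntitone (T : MTree n) : Prop :=
  ∀ p q t l r t' l' r', T.sub p = some (.node t l r) →
    T.sub (p ++ q) = some (.node t' l' r') → t' ≤ t

theorem Good.antitone {T : MTree n} (h : Good a T m) : LabelsAntitone T := by
  intro p q t l r t' l' r' hp hq
  obtain ⟨m', hS, -⟩ := h.sub hp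
  rw [sub_append hp] at hq
  exact Fin.le_def.2 (Nat.lt_succ_iff.1 (hS.below.sub hq).1)

theorem Good.lw_sub {k : ℕ} {T S : MTree n} (h : Good a T m) (hT : Below k T) {p : List Bool}
    (hp : T.sub p = some S) {i : Fin n} (hi : k ≤ i) : MTree.lw S i = MTree.lw T i := by
  induction p generalizing T m with
  | nil =>
    rw [sub_nil] at hp
    cases hp
    rfl
  | cons b p ih =>
    cases T with
    | leaf x => simp [sub_leaf_cons] at hp
    | node t l r =>
      obtain ⟨hm, -, -, -, -, hc, -, -, -, hl, hr, -⟩ := h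
      have hti : (t : ℕ) < i := hT.1.trans_le hi
      rw [lw_node_of_ne (Fin.ne_of_gt hti)]
      cases b with
      | false => exact ih hl hT.2.1 hp
      | true => rw [ih hr hT.2.2 hp, hc i hti]

/-- With only one element left to choose in the first colour, a vertex cannot be labeled by that
colour: it would have a cloning vertex among its left relatives. -/
theorem Good.ne_one_of_node {z : Fin n} (hz : (z : ℕ) = 0) {l r : MTree n}
    (h : Good a (.node z l r) m) : m z ≠ 1 := by
  intro h1
  induction hl' : l generalizing r l with
  | leaf x =>
    subst hl'
    obtain ⟨-, -, -, hbr, -, hc, -, hone, hcl, -, hr, -⟩ := h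
    cases r with
    | leaf y =>
      refine hcl ⟨congrArg _ (funext fun i => ?_), trivial⟩
      rcases (show z ≤ i from Fin.le_def.2 (by omega)).eq_or_lt with rfl | hi
      · exact (hone h1).symm
      · exact (hc i hi).symm
    | node t l' r' =>
      have h2 := hr.1
      have h3 : t = z := Fin.ext (by have := hbr.1; omega)
      rw [h3, sub_single_self] at h2
      omega
  | node t l' r' ihl ihr =>
    subst hl'
    obtain ⟨-, -, hbl, -, -, -, -, -, -, hl, -, -⟩ := h
    have h3 : t = z := Fin.ext (by have := hbl.1; omega)
    subst h3
    exact ihl hl rfl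

theorem Good.pos_of_sub {z : Fin n} (hz : (z : ℕ) = 0) {T S : MTree n} (h : Good a T m)
    (hm : 0 < m z) {p : List Bool} (hp : T.sub p = some S) :
    0 < splitLabel T (fun i => (m i : ℤ)) p z := by
  induction p generalizing T m with
  | nil => rw [splitLabel_nil]; exact_mod_cast hm
  | cons b p ih =>
    cases T with
    | leaf x => simp [sub_leaf_cons] at hp
    | node t l r =>
      have hne : t = z → m z ≠ 1 := by
        rintro rfl
        exact h.ne_one_of_node hz
      obtain ⟨hmt, -, -, -, -, -, -, -, -, hl, hr, -⟩ := h
      cases b with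
      | false => exact ih hl hm hp
      | true =>
        have := ih hr ?_ hp
        · rw [← natCast_sub_single hmt] at this
          exact this
        · by_cases htz : z = t
          · subst htz
            rw [sub_single_self]
            have := hne rfl
            omega
          · rwa [sub_single_of_ne htz]

theorem Good.isMacaulayTree (hn : 0 < n) (ha : ∀ i, 0 < a i) {T : MTree n} (h : Good a T a) :
    IsMacaulayTree a (leafSum T fun i => (a i : ℤ)) T where
  leaf_pos p x hp i := by
    obtain ⟨m', hS, -⟩ := h.sub hp
    exact hS.1 i
  antitone := h.antitone
  orderly p t l r hp q q' x x' hq hq' i hi := by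
    obtain ⟨m', hS, -⟩ := h.sub hp
    rw [sub_append hp] at hq hq'
    have h1 := hS.lw_sub hS.below hq (i := i) hi
    have h2 := hS.lw_sub hS.below hq' (i := i) hi
    exact h1.trans h2.symm
  proper p t l r hp := by
    obtain ⟨m', hS, -⟩ := h.sub hp
    exact hS.2.2.2.2.1
  nu_le p x hp i := by
    obtain ⟨m', hS, h1⟩ := h.sub hp
    rw [nu, h1]
    exact Int.ofNat_le.2 (hS.2 i)
  nu_pos p x hp := by
    obtain ⟨m', hS, h1⟩ := h.sub hp
    have h2 := h.pos_of_sub (z := ⟨0, hn⟩) rfl (ha _) hp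
    rw [← nu] at h1 h2
    refine lt_of_le_of_ne (fun i => ?_) fun h3 => ?_
    · rw [h1]
      exact Int.natCast_nonneg _
    · rw [← h3] at h2
      exact lt_irrefl _ h2
  right_weight p t l r hp h1 q S hq := by
    obtain ⟨m', hS, h2⟩ := h.sub hp
    rw [nu, h2] at h1
    have hm' : m' t = 1 := Int.ofNat_inj.1 h1
    obtain ⟨-, -, -, hbr, -, -, -, hone, -, -, hr, -⟩ := hS
    have hbr' : Below t r := by
      rcases hr.below_or hbr with h | ⟨l', r', rfl⟩
      · exact h
      · have := hr.1
        rw [sub_single_self] at this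
        omega
    rw [hr.lw_sub hbr' hq le_rfl, hone hm', lw_node_self]
  sum_eq := rfl

theorem Good.isCondensed {T : MTree n} (h : Good a T a) : IsCondensed T := by
  rintro p ⟨t, l, r, hp, hlr, ⟨⟨S, hS, hS'⟩, -⟩, -⟩
  rw [sub_child hp] at hS
  obtain rfl : l = S := by simpa using hS
  obtain ⟨m', hG, -⟩ := h.sub hp
  refine hG.2.2.2.2.2.2.2.2.1 ⟨hlr, ?_⟩
  cases l with
  | leaf x => trivial
  | node t' l' r' =>
    exact (hG.2.2.2.2.2.2.2.2.2.1 : Good a (.node t' l' r') m').below.mono (hS' t' l' r' rfl)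

theorem Good.weightAt_take {t : Fin n} {T : MTree n} (h : Good a T m) (hT : Below (t + 1) T)
    (hF : Full t T) {s : List Bool} {l r : MTree n} (hs : T.sub s = some (.node t l r)) {i : ℕ}
    (hi : i ≤ s.length + 1) : weightAt T ((s ++ [true]).take i) t + i = MTree.lw T t := by
  induction s generalizing T m i with
  | nil =>
    rw [sub_nil] at hs
    cases hs
    simp only [List.length_nil, zero_add] at hi
    interval_cases i
    · simp [weightAt, sub_nil]
    · simp only [List.nil_append, List.take_succ_cons, List.take_zero]
      rw [weightAt_of_sub (sub_true _ _ _ _ |>.trans (sub_nil _)), hF.1 rfl, lw_node_self]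
  | cons b s ih =>
    cases i with
    | zero => simp [weightAt, sub_nil]
    | succ i =>
      simp only [List.length_cons, add_le_add_iff_right] at hi
      cases T with
      | leaf x => simp [sub_leaf_cons] at hs
      | node t' l' r' =>
        have htt : t' = t := by
          refine le_antisymm (Fin.le_def.2 (Nat.lt_succ_iff.1 hT.1)) ?_
          exact h.antitone [] (b :: s) _ _ _ _ _ _ (sub_nil _) hs
        subst htt
        obtain ⟨-, -, hbl, hbr, -, -, -, -, -, hl, hr, -⟩ := h
        rw [lw_node_self, List.cons_append, List.take_succ_cons]
        cases b with
        | false =>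
          have h1 := ih hl hbl hF.2.1 hs hi
          have h2 : weightAt (.node t' l' r') (false :: (s ++ [true]).take i) =
            weightAt l' ((s ++ [true]).take i) := rfl
          rw [h2]
          omega
        | true =>
          have h1 := ih hr hbr hF.2.2 hs hi
          have h2 : weightAt (.node t' l' r') (true :: (s ++ [true]).take i) =
            weightAt r' ((s ++ [true]).take i) := rfl
          have h3 := hF.1 rfl
          rw [h2]
          omega

theorem lw_leftEnd_of_ne {t i : Fin n} (hi : i ≠ t) (T : MTree n) :
    MTree.lw (leftEnd t T) i = MTree.lw T i := by
  induction T with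
  | leaf x => rfl
  | node s l r ihl ihr =>
    rw [leftEnd]
    split_ifs with hs
    · rw [ihl, lw_node_of_ne (hs ▸ hi)]
    · rfl

theorem Good.lw_runEnd {t : Fin n} {T : MTree n} (h : Good a T m) {i : Fin n} (hi : t < i) :
    MTree.lw (runEnd t T) i = MTree.lw T i := by
  induction T generalizing m with
  | leaf x => rfl
  | node s l r ihl ihr =>
    rw [runEnd]
    split_ifs with hs
    · subst hs
      obtain ⟨-, -, -, -, -, hc, -, -, -, -, hr, -⟩ := h
      rw [ihr hr, hc i hi, lw_node_of_ne hi.ne']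
    · rfl

theorem Good.isCompressedLike (ha : ∀ i, 0 < a i) {T : MTree n} (h : Good a T a) :
    IsCompressedLike T where
  path q s t l r l' r' hq hs i hi hi' := by
    obtain ⟨m', hS, -⟩ := h.sub hq
    rw [sub_append hq, sub_false] at hs
    obtain ⟨-, -, hbl, -, -, -, hF, -, -, hl, -, -⟩ := hS
    obtain ⟨i, rfl⟩ := Nat.exists_eq_succ_of_ne_zero (Nat.one_le_iff_ne_zero.1 hi)
    rw [List.append_assoc, List.take_length_add_append, weightAt_append hq, weightAt_of_sub hq,
      lw_node_self, List.cons_append, List.take_succ_cons]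
    have h1 := hl.weightAt_take hbl hF hs (i := i) (by omega)
    have h2 : weightAt (.node t l r) (false :: (s ++ [true]).take i) =
      weightAt l ((s ++ [true]).take i) := rfl
    rw [h2]
    omega
  run p t l r hp i hi := by
    obtain ⟨m', hS, -⟩ := h.sub hp
    obtain ⟨-, hma, hbl, hbr, -, hc, -, -, -, hl, hr, hcont⟩ := hS
    rcases lt_or_gt_of_ne hi with hi | hi
    · obtain ⟨B, hB, hM, hiB⟩ := (hr.good_leftEnd t).exists_mem i
      have hmi : (m' - Pi.single t 1 : Fin n → ℕ) i = a i := by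
        rw [sub_single_of_ne hi.ne, hma i hi]
      rw [← lw_leftEnd_of_ne hi.ne]
      have h1 := ((hr.good_leftEnd t).mem_iff t.2.le (hr.below_leftEnd hbr)).1 hM
      have h2 := hcont B (fun j hj => by
        rw [(hB j j.2).1, sub_single_of_ne hj.ne, hma j hj]) h1.1
      obtain ⟨m'', h3, -⟩ := hl.good_runEnd t
      exact (mem_Icc.1 (h3.subset_of_mem h2 hi (hiB (by rw [hmi]; exact ha i)))).2
    · rw [hl.lw_runEnd hi, hc i hi]

/-! ### Recovering good trees -/

theorem exists_leaf (T : MTree n) : ∃ p x, T.sub p = some (.leaf x) ∧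
    (∀ v, splitLabel T v p = v) ∧ ∀ i : Fin n, Below i T → MTree.lw T i = x i := by
  induction T with
  | leaf x => exact ⟨[], x, sub_nil _, splitLabel_nil _, fun _ _ => rfl⟩
  | node t l r ihl ihr =>
    obtain ⟨p, x, h1, h2, h3⟩ := ihl
    refine ⟨false :: p, x, h1, h2, fun i hi => ?_⟩
    rw [lw_node_of_ne (Fin.ne_of_gt hi.1), h3 i hi.2.1]

theorem full_of_sub {t : Fin n} {T : MTree n}
    (h : ∀ s l r, T.sub s = some (.node t l r) → MTree.lw r t = MTree.lw l t) : Full t T := by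
  induction T with
  | leaf x => trivial
  | node t' l r ihl ihr =>
    refine ⟨?_, ihl fun s => h (false :: s), ihr fun s => h (true :: s)⟩
    rintro rfl
    exact h [] l r (sub_nil _)

theorem splitLabel_eq_of_le {T : MTree n} {p : List Bool} {i : Fin n} (v : Fin n → ℤ)
    (h : ∀ q q' t l r, p = q ++ q' → q' ≠ [] → T.sub q = some (.node t l r) → i ≠ t) :
    splitLabel T v p i = v i := by
  induction p generalizing T v with
  | nil => rw [splitLabel_nil]
  | cons b p ih =>
    cases T with
    | leaf x => rfl
    | node t l r =>
      have hit := h [] (b :: p) t l r rfl (by simp) (sub_nil _)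
      cases b with
      | false =>
        refine ih v fun q q' t' l' r' hp hq' hq => h (false :: q) q' t' l' r' ?_ hq' hq
        rw [hp]; rfl
      | true =>
        have h1 := ih (v - Pi.single t 1) fun q q' t' l' r' hp hq' hq =>
          h (true :: q) q' t' l' r' (by rw [hp]; rfl) hq' hq
        refine h1.trans ?_
        simp [hit]

theorem nu_child_false {T : MTree n} {p : List Bool} {t : Fin n} {l r : MTree n}
    (h : T.sub p = some (.node t l r)) : nu a T (p ++ [false]) = nu a T p := by
  rw [nu, splitLabel_append h]
  exact splitLabel_nil _ _

theorem nu_child_true {T : MTree n} {p : List Bool} {t : Fin n} {l r : MTree n}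
    (h : T.sub p = some (.node t l r)) : nu a T (p ++ [true]) = nu a T p - Pi.single t 1 := by
  rw [nu, splitLabel_append h]
  exact splitLabel_nil _ _

/-- A Macaulay tree that is condensed and satisfies the path condition is good, provided that the
families below consecutive leading vertices are nested. -/
theorem good_of_isMacaulayTree {T : MTree n} (hT : IsMacaulayTree a N T) (hC : IsCondensed T)
    (hL : IsCompressedLike T)
    (hcont : ∀ p t l r (m : Fin n → ℕ), T.sub p = some (.node t l r) →
      (nu a T p = fun i => (m i : ℤ)) → 0 < m t → (∀ i < t, m i = a i) →
      Below (t + 1) l → Below (t + 1) r → Good a l m → Good a r (m - Pi.single t 1) →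
      ∀ B : Fin n → Finset ℕ, (∀ i < t, #(B i) = a i) →
        Mem t (leftEnd t r) B → Mem t (runEnd t l) B) : Good a T a := by
  have key : ∀ (S : MTree n) (p : List Bool) (m : Fin n → ℕ), T.sub p = some S →
      (nu a T p = fun i => (m i : ℤ)) → Good a S m := by
    intro S
    induction S with
    | leaf x =>
      intro p m hp hm
      refine ⟨hT.leaf_pos p x hp, fun i => ?_⟩
      have := hT.nu_le p x hp i
      rw [hm] at this
      exact Int.ofNat_le.1 this
    | node t l r ihl ihr =>
      intro p m hp hm
      have hpl := sub_child hp false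
      have hpr := sub_child hp true
      simp only [Bool.false_eq_true, if_false, if_true] at hpl hpr
      have hbelow : Below (t + 1) (LTree.node t l r) := below_of_sub fun q t' l' r' hq =>
        Nat.lt_succ_iff.2 (Fin.le_def.1 (hT.antitone p q t l r t' l' r' hp
          (by rw [sub_append hp]; exact hq)))
      obtain ⟨-, hbl, hbr⟩ := hbelow
      have hmt : 0 < m t := by
        obtain ⟨q, x, h1, h2, -⟩ := exists_leaf r
        have h3 := (hT.nu_pos (p ++ [true] ++ q) x (by rw [sub_append hpr]; exact h1)).le t
        have h4 : nu a T (p ++ [true] ++ q) = nu a T (p ++ [true]) := by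
          rw [nu, splitLabel_append hpr, h2]; rfl
        rw [h4, nu_child_true hp, hm] at h3
        simp only [Pi.zero_apply, Pi.sub_apply, Pi.single_eq_same] at h3
        omega
      have hma : ∀ i < t, m i = a i := by
        intro i hi
        have h1 : nu a T p i = a i := splitLabel_eq_of_le _ fun q q' t' l' r' hq _ hs => by
          have := hT.antitone q q' t' l' r' t l r hs (hq ▸ hp)
          exact (hi.trans_le this).ne
        rw [hm] at h1
        exact Int.ofNat_inj.1 h1
      have hnur : nu a T (p ++ [true]) =
          fun i => (((m - Pi.single t 1 : Fin n → ℕ) i : ℕ) : ℤ) := by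
        rw [nu_child_true hp, hm, natCast_sub_single hmt]
      have hGl := ihl (p ++ [false]) m hpl (by rw [nu_child_false hp, hm])
      have hGr := ihr (p ++ [true]) _ hpr hnur
      refine ⟨hmt, hma, hbl, hbr, hT.proper p t l r hp, fun i hi => ?_, ?_, fun h1 => ?_, ?_, hGl,
        hGr, hcont p t l r m hp hm hmt hma hbl hbr hGl hGr⟩
      · obtain ⟨q, x, h1, -, h2⟩ := exists_leaf r
        obtain ⟨q', x', h1', -, h2'⟩ := exists_leaf l
        rw [h2 i (hbr.mono hi), h2' i (hbl.mono hi)]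
        exact hT.orderly p t l r hp (true :: q) (false :: q') x x'
          (by rw [sub_append hp]; exact h1) (by rw [sub_append hp]; exact h1') i hi
      · refine full_of_sub fun s l' r' hs => ?_
        have hs' : T.sub (p ++ false :: s) = some (.node t l' r') := by
          rw [sub_append hp]; exact hs
        have h1 := hL.path p s t l r l' r' hp hs' (s.length + 1) (by omega) (by omega)
        have h2 := hL.path p s t l r l' r' hp hs' (s.length + 2) (by omega) (by omega)
        rw [List.append_assoc, List.take_length_add_append] at h1 h2
        have h3 : (false :: s ++ [true]).take (s.length + 1) = false :: s := by simp
        have h4 : (false :: s ++ [true]).take (s.length + 2) = false :: s ++ [true] := by simp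
        rw [h3, weightAt_of_sub hs', lw_node_self] at h1
        rw [h4, ← List.append_assoc, weightAt_of_sub (sub_child hs' true)] at h2
        simp only [if_true] at h2
        omega
      · have h2 := hT.right_weight p t l r hp (by rw [hm]; exact congrArg _ h1) [] r (sub_nil _)
        rw [lw_node_self] at h2
        omega
      · rintro ⟨rfl, hb⟩
        have hlead : ∀ b, IsLeading T t (p ++ [b]) := by
          intro b
          refine ⟨⟨l, by rw [sub_child hp]; simp, fun t' l' r' h => ?_⟩,
            fun q b' t' l' r' hq hs => ?_⟩
          · subst h
            exact hb.1
          · obtain ⟨rfl, -⟩ := List.append_inj' hq rfl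
            rw [hp] at hs
            cases hs
            exact le_rfl
        exact hC p ⟨t, l, l, hp, rfl, hlead false, hlead true⟩
  exact key T [] a (sub_nil T) (splitLabel_nil _ _)

end

section

variable {n : ℕ} {a m : Fin n → ℕ} {N : ℕ}

/-! ### Depth-first order -/

theorem cons_le_cons_same (b : Bool) (p q : List Bool) : b :: p ≤ b :: q ↔ p ≤ q := by
  rw [← not_lt, ← not_lt, List.cons_lt_cons_self]

theorem false_cons_lt_true_cons (p q : List Bool) : false :: p < true :: q :=
  List.Lex.rel (by decide)

theorem append_le_append_same (p q r : List Bool) : p ++ q ≤ p ++ r ↔ q ≤ r := by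
  induction p with
  | nil => rfl
  | cons b p ih => exact (cons_le_cons_same b _ _).trans ih

/-! ### Leading vertices -/

/-- The addresses `q` of the vertices that are not labeled `j` while all their proper ancestors are,
in a tree all of whose labels are at most `j`.  Below a `(j + 1)`-leading vertex of a tree, these
are the `j`-leading vertices. -/
def Hang (j : Fin n) : MTree n → List Bool → Prop
  | .leaf _, [] => True
  | .leaf _, _ :: _ => False
  | .node t _ _, [] => t < j
  | .node t l _, false :: q => t = j ∧ Hang j l q
  | .node t _ r, true :: q => t = j ∧ Hang j r q

theorem hang_nil {j : Fin n} {T : MTree n} : Hang j T [] ↔ ∀ t l r, T = .node t l r → t < j := by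
  cases T with
  | leaf x => simp [Hang]
  | node t l r =>
    refine ⟨fun h t' l' r' heq => ?_, fun h => h t l r rfl⟩
    cases heq
    exact h

theorem Good.exists_sub_of_hang {j : Fin n} {S : MTree n} (h : Good a S m) {q : List Bool}
    (hq : Hang j S q) : ∃ S' m', S.sub q = some S' ∧ Below j S' ∧ Good a S' m' ∧
      ∀ i ≠ j, m' i = m i := by
  induction q generalizing S m with
  | nil =>
    refine ⟨S, m, sub_nil S, ?_, h, fun _ _ => rfl⟩
    cases S with
    | leaf x => trivial
    | node t l r => exact h.below.mono (Fin.lt_def.1 hq)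
  | cons b q ih =>
    cases S with
    | leaf x => exact absurd hq id
    | node t l r =>
      obtain ⟨-, -, -, -, -, -, -, -, -, hl, hr, -⟩ := h
      cases b with
      | false => exact ih hl hq.2
      | true =>
        obtain ⟨rfl, hq⟩ := hq
        obtain ⟨S', m', h1, h2, h3, h4⟩ := ih hr hq
        exact ⟨S', m', h1, h2, h3, fun i hi => by rw [h4 i hi, sub_single_of_ne hi]⟩

/-- The parent of `p`, if it is not the root, has a label that is at least `k`. -/
def ParentGe (T : MTree n) (k : ℕ) (p : List Bool) : Prop :=
  ∀ q b t l r, p = q ++ [b] → T.sub q = some (.node t l r) → k ≤ (t : ℕ)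

theorem parentGe_concat {T : MTree n} {p : List Bool} {t : Fin n} {l r : MTree n} {k : ℕ}
    (h : T.sub p = some (.node t l r)) (hk : k ≤ (t : ℕ)) (b : Bool) :
    ParentGe T k (p ++ [b]) := by
  intro q b' t' l' r' hq hs
  obtain ⟨rfl, -⟩ := List.append_inj' hq rfl
  rw [h] at hs
  cases hs
  exact hk

theorem isLeading_append_iff {T S : MTree n} {j : Fin n} {p q : List Bool} (hp : T.sub p = some S)
    (hpar : ParentGe T j p) (hS : Good a S m) (hb : Below (j + 1) S) :
    IsLeading T j (p ++ q) ↔ Hang j S q := by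
  induction q generalizing p S m with
  | nil =>
    rw [List.append_nil, hang_nil]
    refine ⟨fun h t l r heq => ?_, fun h => ⟨⟨S, hp, h⟩, hpar⟩⟩
    obtain ⟨⟨S', h1, h2⟩, -⟩ := h
    rw [hp] at h1
    cases h1
    exact h2 t l r heq
  | cons b q ih =>
    cases S with
    | leaf x =>
      refine iff_of_false ?_ id
      rintro ⟨⟨S', h1, -⟩, -⟩
      rw [sub_append hp] at h1
      simp [sub_leaf_cons] at h1
    | node t l r =>
      have hchild := sub_child hp b
      by_cases htj : t = j
      · subst htj
        have hpar' : ParentGe T t (p ++ [b]) := parentGe_concat hp le_rfl b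
        obtain ⟨-, -, hbl, hbr, -, -, -, -, -, hl, hr, -⟩ := hS
        rw [List.append_cons]
        cases b with
        | false => simpa [Hang] using ih (S := l) (by simpa using hchild) hpar' hl hbl
        | true => simpa [Hang] using ih (S := r) (by simpa using hchild) hpar' hr hbr
      · refine iff_of_false ?_ fun h => htj (by cases b <;> exact h.1)
        rintro ⟨⟨S', h1, -⟩, h2⟩
        obtain ⟨q₀, b₀, hq₀⟩ : ∃ q₀ b₀, b :: q = q₀ ++ [b₀] :=
          ⟨_, _, (List.dropLast_append_getLast (by simp)).symm⟩
        rw [hq₀, ← List.append_assoc] at h1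
        obtain ⟨t', l', r', hs⟩ := exists_node_of_concat h1
        have h3 := h2 (p ++ q₀) b₀ t' l' r' (by rw [hq₀, List.append_assoc]) hs
        rw [sub_append hp] at hs
        have h4 := (hS.below.sub hs).1
        have h5 : (t : ℕ) ≠ j := fun h => htj (Fin.ext h)
        have h6 := hb.1
        omega

theorem IsLeading.ancestor_ge {T : MTree n} (hT : LabelsAntitone T) {k : ℕ} {p : List Bool}
    (hp : ParentGe T k p) {q q' : List Bool} {t : Fin n} {l r : MTree n} (hpq : p = q ++ q')
    (hq' : q' ≠ []) (hq : T.sub q = some (.node t l r)) {S : MTree n} (hS : T.sub p = some S) :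
    k ≤ (t : ℕ) := by
  obtain ⟨q₀, b₀, rfl⟩ : ∃ q₀ b₀, q' = q₀ ++ [b₀] :=
    ⟨_, _, (List.dropLast_append_getLast hq').symm⟩
  rw [hpq, ← List.append_assoc] at hS
  obtain ⟨t', l', r', hs⟩ := exists_node_of_concat hS
  have h1 := hp (q ++ q₀) b₀ t' l' r' (by rw [hpq, List.append_assoc]) hs
  exact h1.trans (hT q q₀ t l r t' l' r' hq hs)

/-- A vertex that is `k`-leading is not a proper descendant of another one. -/
theorem IsLeading.eq_of_append {T : MTree n} (hT : LabelsAntitone T) {k : ℕ} {p q : List Bool}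
    (hp : IsLeading T k p) (hpq : IsLeading T k (p ++ q)) : q = [] := by
  by_contra hq
  obtain ⟨⟨S, hS, hS'⟩, -⟩ := hp
  obtain ⟨⟨S₂, hS₂, -⟩, hpar⟩ := hpq
  cases S with
  | leaf x =>
    rw [sub_append hS] at hS₂
    cases q with
    | nil => exact hq rfl
    | cons b q => simp [sub_leaf_cons] at hS₂
  | node t l r =>
    have h1 := hS' t l r rfl
    have h2 := IsLeading.ancestor_ge hT hpar rfl hq hS hS₂
    omega

/-! ### Signatures -/

theorem psiColor_nil (T : MTree n) (t : Fin n) : psiColor T t [] = ∅ := by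
  cases T <;> simp [psiColor, psi]

theorem psiColor_false (s t : Fin n) (l r : MTree n) (p : List Bool) :
    psiColor (.node s l r) t (false :: p) = psiColor l t p := rfl

theorem psiColor_true (s t : Fin n) (l r : MTree n) (p : List Bool) :
    psiColor (.node s l r) t (true :: p) =
      if s = t then insert (MTree.lw l t + 1) (psiColor r t p) else psiColor r t p := by
  rw [psiColor, psi, filter_insert]
  split_ifs with h
  · simp only at h
    subst h
    rw [image_insert, lw_node_self]
    rfl
  · rfl

theorem psiColor_append {T S : MTree n} {p : List Bool} (hp : T.sub p = some S) {j : Fin n}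
    (h : ∀ q q' t l r, p = q ++ q' → q' ≠ [] → T.sub q = some (.node t l r) → t ≠ j)
    (q : List Bool) : psiColor T j (p ++ q) = psiColor S j q := by
  induction p generalizing T with
  | nil =>
    rw [sub_nil] at hp
    cases hp
    rfl
  | cons b p ih =>
    cases T with
    | leaf x => simp [sub_leaf_cons] at hp
    | node t l r =>
      have htj := h [] (b :: p) t l r rfl (by simp) (sub_nil _)
      cases b with
      | false =>
        rw [List.cons_append, psiColor_false]
        exact ih hp fun q q' t' l' r' hpq => h (false :: q) q' t' l' r' (by rw [hpq]; rfl)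
      | true =>
        rw [List.cons_append, psiColor_true, if_neg htj]
        exact ih hp fun q q' t' l' r' hpq => h (true :: q) q' t' l' r' (by rw [hpq]; rfl)

/-- The colex-largest `m`-set of colour `j` that is sent to the vertex `q`, for `q` as in `Hang`.
This is the `j`-signature of `q`. -/
def localSig (j : Fin n) : MTree n → ℕ → List Bool → Finset ℕ
  | T, m, [] => Ioc (MTree.lw T j - m) (MTree.lw T j)
  | .leaf _, _, _ :: _ => ∅
  | .node _ l _, m, false :: q => localSig j l m q
  | .node _ l r, m, true :: q => insert (MTree.lw l j + 1) (localSig j r (m - 1) q)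

/-- The colex-largest `m`-subset in the colour `j` that occurs in the family encoded by the tree. -/
def topSig (j : Fin n) : MTree n → ℕ → Finset ℕ
  | .leaf x, m => Ioc (x j - m) (x j)
  | .node t l r, m =>
    if t = j then insert (MTree.lw l j + 1) (topSig j r (m - 1))
    else Ioc (MTree.lw (.node t l r) j - m) (MTree.lw (.node t l r) j)

theorem localSig_nil (j : Fin n) (T : MTree n) (m : ℕ) :
    localSig j T m [] = Ioc (MTree.lw T j - m) (MTree.lw T j) := by
  cases T <;> rfl

theorem topSig_of_hang_nil {j : Fin n} {T : MTree n} (h : Hang j T []) (m : ℕ) :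
    topSig j T m = Ioc (MTree.lw T j - m) (MTree.lw T j) := by
  cases T with
  | leaf x => rfl
  | node t l r => rw [topSig, if_neg (Fin.ne_of_lt h)]

theorem topSig_node (j : Fin n) (l r : MTree n) (m : ℕ) :
    topSig j (.node j l r) m = insert (MTree.lw l j + 1) (topSig j r (m - 1)) := by
  rw [topSig, if_pos rfl]

theorem runWeights_union_eq_topSig (j : Fin n) (T : MTree n) (m : ℕ) :
    runWeights j T ∪ Ioc (MTree.lw (runEnd j T) j - (m - runLength j T)) (MTree.lw (runEnd j T) j) =
      topSig j T m := by
  induction T generalizing m with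
  | leaf x => simp [runWeights, runEnd, runLength, topSig, lw_leaf]
  | node t l r ihl ihr =>
    rw [runWeights, runEnd, runLength, topSig]
    split_ifs with h
    · subst h
      rw [← ihr (m - 1), insert_union, lw_node_self, Nat.sub_sub, Nat.add_comm 1]
    · simp

/-! ### Membership and leading vertices -/

section Local

variable {j : Fin n}

theorem hang_nil_or {S : MTree n} (hb : Below (j + 1) S) :
    Hang j S [] ∨ ∃ l r, S = .node j l r := by
  cases S with
  | leaf x => exact Or.inl trivial
  | node t l r =>
    rcases (show t ≤ j from Fin.le_def.2 (Nat.lt_succ_iff.1 hb.1)).eq_or_lt with rfl | h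
    · exact Or.inr ⟨l, r, rfl⟩
    · exact Or.inl h

theorem hang_node_cons {l r : MTree n} {q : List Bool} (hq : Hang j (.node j l r) q) :
    (∃ q', q = false :: q' ∧ Hang j l q') ∨ ∃ q', q = true :: q' ∧ Hang j r q' := by
  cases q with
  | nil => exact absurd hq (lt_irrefl j)
  | cons b q =>
    cases b with
    | false => exact Or.inl ⟨q, rfl, hq.2⟩
    | true => exact Or.inr ⟨q, rfl, hq.2⟩

theorem eq_nil_of_hang {S : MTree n} {q : List Bool} (h : Hang j S []) (hq : Hang j S q) :
    q = [] := by
  cases q with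
  | nil => rfl
  | cons b q =>
    cases S with
    | leaf x => exact absurd hq id
    | node t l r =>
      have h1 : t < j := h
      have h2 : t = j := by cases b <;> exact hq.1
      exact absurd h2 h1.ne

theorem Good.below_of_hang_nil {S : MTree n} (h : Good a S m) (hn : Hang j S []) : Below j S := by
  cases S with
  | leaf x => trivial
  | node t l r => exact h.below.mono (Fin.lt_def.1 hn)

theorem Good.localSig_subset {S : MTree n} (h : Good a S m) (k : ℕ) {q : List Bool}
    (hq : Hang j S q) : localSig j S k q ⊆ Icc 1 (MTree.lw S j) := by
  induction q generalizing S m k with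
  | nil => rw [localSig_nil]; exact Ioc_sub_subset_Icc _ _
  | cons b q ih =>
    cases S with
    | leaf x => exact absurd hq id
    | node t l r =>
      obtain ⟨-, -, -, -, hle, -, -, -, -, hl, hr, -⟩ := h
      cases b with
      | false =>
        obtain ⟨rfl, hq⟩ := hq
        exact (ih hl k hq).trans (Icc_subset_Icc_right (lw_le_lw_node _ _ _ _))
      | true =>
        obtain ⟨rfl, hq⟩ := hq
        rw [localSig, insert_subset_iff, lw_node_self]
        refine ⟨by simp, (ih hr _ hq).trans (Icc_subset_Icc_right ?_)⟩
        exact (hle t).trans (Nat.le_succ _)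

theorem Good.card_localSig {S : MTree n} (h : Good a S m) {q : List Bool} (hq : Hang j S q) :
    #(localSig j S (m j) q) = m j := by
  induction q generalizing S m with
  | nil => rw [localSig_nil]; exact card_Ioc_sub (h.le_lw j)
  | cons b q ih =>
    cases S with
    | leaf x => exact absurd hq id
    | node t l r =>
      obtain ⟨hm, -, -, -, hle, -, -, -, -, hl, hr, -⟩ := h
      cases b with
      | false => exact ih hl hq.2
      | true =>
        obtain ⟨rfl, hq⟩ := hq
        have h1 := ih hr hq
        rw [sub_single_self] at h1
        rw [localSig, card_insert_of_notMem, h1]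
        · omega
        · exact succ_notMem_of_subset_Icc
            ((hr.localSig_subset _ hq).trans (Icc_subset_Icc_right (hle t)))

theorem Good.psiColor_subset {S : MTree n} (h : Good a S m) {q : List Bool} (hq : Hang j S q) :
    psiColor S j q ⊆ Icc 1 (MTree.lw S j) := by
  induction q generalizing S m with
  | nil => simp [psiColor_nil]
  | cons b q ih =>
    cases S with
    | leaf x => exact absurd hq id
    | node t l r =>
      obtain ⟨-, -, -, -, hle, -, -, -, -, hl, hr, -⟩ := h
      cases b with
      | false =>
        rw [psiColor_false]
        exact (ih hl hq.2).trans (Icc_subset_Icc_right (lw_le_lw_node _ _ _ _))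
      | true =>
        obtain ⟨rfl, hq⟩ := hq
        rw [psiColor_true, if_pos rfl, insert_subset_iff, lw_node_self]
        refine ⟨by simp, (ih hr hq).trans (Icc_subset_Icc_right ?_)⟩
        exact (hle t).trans (Nat.le_succ _)

theorem Good.psiColor_union_eq_localSig {S S' : MTree n} (h : Good a S m) (k : ℕ) {q : List Bool}
    (hq : Hang j S q) (hS' : S.sub q = some S') :
    psiColor S j q ∪ Ioc (MTree.lw S' j - (k - #(psiColor S j q))) (MTree.lw S' j) =
      localSig j S k q := by
  induction q generalizing S m k with
  | nil =>
    rw [sub_nil] at hS'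
    cases hS'
    simp [localSig_nil, psiColor_nil]
  | cons b q ih =>
    cases S with
    | leaf x => exact absurd hq id
    | node t l r =>
      obtain ⟨-, -, -, -, hle, -, -, -, -, hl, hr, -⟩ := h
      cases b with
      | false => exact ih hl k hq.2 hS'
      | true =>
        obtain ⟨rfl, hq⟩ := hq
        rw [psiColor_true, if_pos rfl, localSig, ← ih hr (k - 1) hq hS', card_insert_of_notMem,
          insert_union, Nat.sub_sub, Nat.add_comm 1]
        exact succ_notMem_of_subset_Icc
          ((hr.psiColor_subset hq).trans (Icc_subset_Icc_right (hle t)))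

theorem Good.topSig_subset {S : MTree n} (h : Good a S m) (k : ℕ) :
    topSig j S k ⊆ Icc 1 (MTree.lw S j) := by
  induction S generalizing m k with
  | leaf x => exact Ioc_sub_subset_Icc _ _
  | node t l r ihl ihr =>
    rw [topSig]
    split_ifs with ht
    · subst ht
      obtain ⟨-, -, -, -, hle, -, -, -, -, hl, hr, -⟩ := h
      rw [insert_subset_iff, lw_node_self]
      refine ⟨by simp, (ihr hr _).trans (Icc_subset_Icc_right ?_)⟩
      exact (hle t).trans (Nat.le_succ _)
    · exact Ioc_sub_subset_Icc _ _

theorem Good.localSig_le_topSig {S : MTree n} (h : Good a S m) (hb : Below (j + 1) S) (k : ℕ)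
    {q : List Bool} (hq : Hang j S q) : toColex (localSig j S k q) ≤ toColex (topSig j S k) := by
  induction q generalizing S m k with
  | nil => rw [localSig_nil, topSig_of_hang_nil hq]
  | cons b q ih =>
    cases S with
    | leaf x => exact absurd hq id
    | node t l r =>
      obtain ⟨-, -, hbl, hbr, hle, -, -, -, -, hl, hr, -⟩ := h
      obtain rfl : t = j := by cases b <;> exact hq.1
      rw [topSig_node]
      cases b with
      | false =>
        refine (toColex_lt_of_mem (w := MTree.lw l t + 1) (fun x hx => ?_) (by simp)).le
        exact Nat.lt_succ_of_le (mem_Icc.1 (hl.localSig_subset k hq.2 hx)).2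
      | true =>
        rw [localSig, toColex_insert_le_insert]
        · exact ih hr hbr (k - 1) hq.2
        · exact succ_notMem_of_subset_Icc
            ((hr.localSig_subset _ hq.2).trans (Icc_subset_Icc_right (hle t)))
        · exact succ_notMem_of_subset_Icc
            ((hr.topSig_subset _).trans (Icc_subset_Icc_right (hle t)))

theorem exists_hang_localSig_eq {S : MTree n} (hb : Below (j + 1) S) (k : ℕ) :
    ∃ q, Hang j S q ∧ localSig j S k q = topSig j S k := by
  induction S generalizing k with
  | leaf x => exact ⟨[], trivial, rfl⟩
  | node t l r ihl ihr =>
    rcases hang_nil_or hb with h | ⟨l', r', h⟩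
    · exact ⟨[], h, by rw [localSig_nil, topSig_of_hang_nil h]⟩
    · cases h
      obtain ⟨q, h1, h2⟩ := ihr hb.2.2 (k - 1)
      exact ⟨true :: q, ⟨rfl, h1⟩, by rw [localSig, h2, topSig_node]⟩

theorem Full.topSig_eq {S : MTree n} (hF : Full j S) {k : ℕ} (h : Good a S m) (hk : k = m j)
    (hb : Below (j + 1) S) : topSig j S k = Ioc (MTree.lw S j - k) (MTree.lw S j) := by
  induction S generalizing m k with
  | leaf x => rfl
  | node t l r ihl ihr =>
    rcases hang_nil_or hb with h' | ⟨l', r', h'⟩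
    · exact topSig_of_hang_nil h' k
    · cases h'
      obtain ⟨hm, -, hbl, hbr, -, -, -, -, -, hl, hr, -⟩ := h
      rw [topSig_node, ihr hF.2.2 hr (by rw [sub_single_self, hk]) hbr, hF.1 rfl, lw_node_self,
        ← erase_Ioc_succ (by omega), insert_erase]
      rw [mem_Ioc]
      omega

/-- If `B j` is the signature of `q`, then membership is decided at `q`. -/
theorem Good.mem_localSig_iff {S S' : MTree n} (h : Good a S m) (hb : Below (j + 1) S)
    {q : List Bool} (hq : Hang j S q) (hS' : S.sub q = some S') {B : Fin n → Finset ℕ} {k : ℕ}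
    (hB : B j = localSig j S k q) : Mem (j + 1) S B ↔ Mem j S' B := by
  induction q generalizing S m k B with
  | nil =>
    rw [sub_nil] at hS'
    cases hS'
    rw [h.mem_iff (Nat.le_succ _) (h.below_of_hang_nil hq)]
    refine and_iff_left fun i hi hi' => ?_
    obtain rfl : i = j := Fin.ext (by omega)
    rw [hB, localSig_nil]
    exact Ioc_sub_subset_Icc _ _
  | cons b q ih =>
    cases S with
    | leaf x => exact absurd hq id
    | node t l r =>
      have hsub := h.exists_sub_of_hang hq
      obtain ⟨-, -, hbl, hbr, hle, -, -, -, -, hl, hr, -⟩ := h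
      obtain rfl : t = j := by cases b <;> exact hq.1
      cases b with
      | false =>
        rw [mem_node_of_notMem]
        · exact ih hl hbl hq.2 hS' hB
        · rw [hB]
          exact succ_notMem_of_subset_Icc (hl.localSig_subset k hq.2)
      | true =>
        rw [localSig] at hB
        have hw : MTree.lw l t + 1 ∉ localSig t r (k - 1) q := succ_notMem_of_subset_Icc
          ((hr.localSig_subset _ hq.2).trans (Icc_subset_Icc_right (hle t)))
        rw [mem_node_of_mem (by rw [hB]; simp),
          ih hr hbr hq.2 hS' (k := k - 1) (by rw [Function.update_self, hB, erase_insert hw])]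
        obtain ⟨S'', -, h1, h2, -⟩ := hsub
        rw [hS'] at h1
        cases h1
        exact mem_congr h2 fun i hi => by rw [Function.update_of_ne (Fin.ne_of_lt hi)]

/-- A member of the family is sent to some vertex `q`, whose signature is at least `B j`. -/
theorem Good.exists_hang_of_mem {S : MTree n} (h : Good a S m) (hb : Below (j + 1) S)
    {B : Fin n → Finset ℕ} (hB : #(B j) = m j) (hM : Mem (j + 1) S B) :
    ∃ q S', Hang j S q ∧ S.sub q = some S' ∧ toColex (B j) ≤ toColex (localSig j S (m j) q) ∧
      Mem j S' B := by
  induction S generalizing m B with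
  | leaf x =>
    refine ⟨[], _, trivial, sub_nil _, ?_, fun i hi => hM i (by omega)⟩
    rw [localSig_nil]
    exact toColex_le_Ioc hB (hM j (Nat.lt_succ_self _))
  | node t l r ihl ihr =>
    rcases hang_nil_or hb with h' | ⟨l', r', h'⟩
    · refine ⟨[], _, h', sub_nil _, ?_, ?_⟩
      · rw [localSig_nil]
        exact toColex_le_Ioc hB (h.subset_of_mem hM (Nat.lt_succ_self _))
      · exact ((h.mem_iff (Nat.le_succ _) (h.below.mono (Fin.lt_def.1 h'))).1 hM).1
    · cases h'
      obtain ⟨hm, -, hbl, hbr, hle, -, -, -, -, hl, hr, -⟩ := h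
      by_cases hw : MTree.lw l j + 1 ∈ B j
      · rw [mem_node_of_mem hw] at hM
        obtain ⟨q, S', h1, h2, h3, h4⟩ := ihr hr hbr
          (by rw [Function.update_self, card_erase_of_mem hw, hB, sub_single_self]) hM
        obtain ⟨S'', -, h5, h6, -⟩ := hr.exists_sub_of_hang h1
        rw [h2] at h5
        cases h5
        refine ⟨true :: q, S', ⟨rfl, h1⟩, h2, ?_, (mem_congr h6 fun i hi => ?_).1 h4⟩
        · rw [Function.update_self, sub_single_self] at h3
          rw [localSig, ← insert_erase hw, toColex_insert_le_insert (by simp)]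
          · exact h3
          · exact succ_notMem_of_subset_Icc
              ((hr.localSig_subset _ h1).trans (Icc_subset_Icc_right (hle j)))
        · rw [Function.update_of_ne (Fin.ne_of_lt hi)]
      · rw [mem_node_of_notMem hw] at hM
        obtain ⟨q, S', h1, h2, h3, h4⟩ := ihl hl hbl hB hM
        exact ⟨false :: q, S', ⟨rfl, h1⟩, h2, h3, h4⟩

theorem Good.isLeast_hang_nil {S : MTree n} (h : Good a S m) (hn : Hang j S []) {A : Finset ℕ}
    (h0 : 0 ∉ A) (hle : toColex A ≤ toColex (topSig j S (m j))) :
    ∃ q S', IsLeast {z | Hang j S z ∧ toColex A ≤ toColex (localSig j S (m j) z)} q ∧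
      S.sub q = some S' ∧ ∀ B : Fin n → Finset ℕ, B j = A → (Mem (j + 1) S B ↔ Mem j S' B) := by
  rw [topSig_of_hang_nil hn] at hle
  refine ⟨[], S, ⟨⟨hn, by rwa [localSig_nil]⟩, fun z hz => ?_⟩, sub_nil S, fun B hB => ?_⟩
  · rw [eq_nil_of_hang hn hz.1]
  · rw [h.mem_iff (Nat.le_succ _) (h.below_of_hang_nil hn)]
    refine and_iff_left fun i hi hi' => ?_
    obtain rfl : i = j := Fin.ext (by omega)
    rw [hB]
    exact subset_Icc_of_toColex_le hle h0 (Ioc_sub_subset_Icc _ _)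

/-- A set `A` of colour `j` is sent to the first vertex whose signature is at least `A`. -/
theorem Good.exists_isLeast_hang {S : MTree n} (h : Good a S m) (hb : Below (j + 1) S)
    {A : Finset ℕ} (hA : #A = m j) (h0 : 0 ∉ A) (hle : toColex A ≤ toColex (topSig j S (m j))) :
    ∃ q S', IsLeast {z | Hang j S z ∧ toColex A ≤ toColex (localSig j S (m j) z)} q ∧
      S.sub q = some S' ∧ ∀ B : Fin n → Finset ℕ, B j = A → (Mem (j + 1) S B ↔ Mem j S' B) := by
  induction S generalizing m A with
  | leaf x => exact h.isLeast_hang_nil trivial h0 hle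
  | node t l r ihl ihr =>
    rcases hang_nil_or hb with h' | ⟨l', r', h'⟩
    · exact h.isLeast_hang_nil h' h0 hle
    cases h'
    have hAs := subset_Icc_of_toColex_le hle h0 (h.topSig_subset (m j))
    obtain ⟨hm, -, hbl, hbr, hlw, -, hF, -, -, hl, hr, -⟩ := h
    rw [lw_node_self] at hAs
    by_cases hw : MTree.lw l j + 1 ∈ A
    · have hwr : ∀ {q}, Hang j r q → MTree.lw l j + 1 ∉ localSig j r (m j - 1) q := fun hq =>
        succ_notMem_of_subset_Icc
          ((hr.localSig_subset _ hq).trans (Icc_subset_Icc_right (hlw j)))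
      rw [topSig_node, ← insert_erase hw, toColex_insert_le_insert (by simp)
        (succ_notMem_of_subset_Icc
          ((hr.topSig_subset _).trans (Icc_subset_Icc_right (hlw j))))] at hle
      have e1 : #(A.erase (MTree.lw l j + 1)) = (m - Pi.single j 1 : Fin n → ℕ) j := by
        rw [card_erase_of_mem hw, hA, sub_single_self]
      have e2 : 0 ∉ A.erase (MTree.lw l j + 1) := fun h => h0 (mem_of_mem_erase h)
      have e3 : toColex (A.erase (MTree.lw l j + 1)) ≤
          toColex (topSig j r ((m - Pi.single j 1 : Fin n → ℕ) j)) := by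
        rw [sub_single_self]; exact hle
      obtain ⟨q, S', ⟨⟨h1, h2⟩, h3⟩, h4, h5⟩ := ihr hr hbr e1 e2 e3
      rw [sub_single_self] at h2 h3
      refine ⟨true :: q, S', ⟨⟨⟨rfl, h1⟩, ?_⟩, ?_⟩, h4, fun B hB => ?_⟩
      · rw [localSig, ← insert_erase hw, toColex_insert_le_insert (by simp) (hwr h1)]
        exact h2
      · rintro z ⟨hz, hzA⟩
        rcases hang_node_cons hz with ⟨z, rfl, hz'⟩ | ⟨z, rfl, hz'⟩
        · refine absurd hzA (not_le.2 (toColex_lt_of_mem (fun x hx => ?_) hw))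
          exact Nat.lt_succ_of_le (mem_Icc.1 (hl.localSig_subset _ hz' hx)).2
        · rw [cons_le_cons_same]
          refine h3 ⟨hz', ?_⟩
          rwa [localSig, ← insert_erase hw, toColex_insert_le_insert (by simp) (hwr hz')] at hzA
      · rw [mem_node_of_mem (by rwa [hB]), h5 _ (by rw [Function.update_self, hB])]
        obtain ⟨S'', -, h6, h7, -⟩ := hr.exists_sub_of_hang h1
        rw [h4] at h6
        cases h6
        exact mem_congr h7 fun i hi => by rw [Function.update_of_ne (Fin.ne_of_lt hi)]
    · have e3 : toColex A ≤ toColex (topSig j l (m j)) := by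
        rw [hF.topSig_eq hl rfl hbl]
        exact toColex_le_Ioc hA (subset_Icc_pred hAs hw)
      obtain ⟨q, S', ⟨⟨h1, h2⟩, h3⟩, h4, h5⟩ := ihl hl hbl hA h0 e3
      refine ⟨false :: q, S', ⟨⟨⟨rfl, h1⟩, h2⟩, ?_⟩, h4, fun B hB => ?_⟩
      · rintro z ⟨hz, hzA⟩
        rcases hang_node_cons hz with ⟨z, rfl, hz'⟩ | ⟨z, rfl, hz'⟩
        · rw [cons_le_cons_same]
          exact h3 ⟨hz', hzA⟩
        · exact (false_cons_lt_true_cons _ _).le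
      · rw [mem_node_of_notMem (by rwa [hB])]
        exact h5 B hB

end Local

end

section

variable {n : ℕ} {a m : Fin n → ℕ} {N : ℕ}

/-! ### Compatibility and nested families -/

theorem ParentGe.mono {T : MTree n} {k k' : ℕ} (hk : k ≤ k') {p : List Bool}
    (h : ParentGe T k' p) : ParentGe T k p :=
  fun q b t l r hp hq => hk.trans (h q b t l r hp hq)

theorem IsLeading.below {T S : MTree n} {k : ℕ} {p : List Bool} (h : IsLeading T k p)
    (hp : T.sub p = some S) (hS : Good a S m) : Below k S := by
  obtain ⟨⟨S', h1, h2⟩, -⟩ := h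
  rw [hp] at h1
  cases h1
  cases S with
  | leaf x => trivial
  | node t l r => exact hS.below.mono (h2 t l r rfl)

theorem runWeights_eq_empty {t : Fin n} {S : MTree n} (h : Below t S) : runWeights t S = ∅ := by
  cases S with
  | leaf x => rfl
  | node s l r => rw [runWeights, if_neg (Fin.ne_of_lt h.1)]

theorem runLength_eq_zero {t : Fin n} {S : MTree n} (h : Below t S) : runLength t S = 0 := by
  cases S with
  | leaf x => rfl
  | node s l r => rw [runLength, if_neg (Fin.ne_of_lt h.1)]

theorem psiColor_append_of_parentGe {T S : MTree n} (hT : LabelsAntitone T) {j : Fin n}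
    {p : List Bool} (hp : T.sub p = some S) (hpar : ParentGe T (j + 1) p) (q : List Bool) :
    psiColor T j (p ++ q) = psiColor S j q :=
  psiColor_append hp (fun _ _ _ _ _ hpq hq' hq =>
    Fin.ne_of_gt (IsLeading.ancestor_ge hT hpar hpq hq' hq hp)) q

theorem signature_append {T S : MTree n} (hT : LabelsAntitone T) {j : Fin n} {p q : List Bool}
    (hp : T.sub p = some S) (hpar : ParentGe T (j + 1) p) (hS : Good a S m) (hq : Hang j S q) :
    signature a T j (p ++ q) = localSig j S (a j) q := by
  obtain ⟨S', m', h1, h2, -, -⟩ := hS.exists_sub_of_hang hq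
  rw [← hS.psiColor_union_eq_localSig (a j) hq h1]
  simp only [signature, sub_append hp, h1, psiColor_append_of_parentGe hT hp hpar,
    runWeights_eq_empty h2, runLength_eq_zero h2, runEnd_eq_of_below h2, union_empty, Nat.sub_zero]

theorem signature_eq_topSig {T S : MTree n} (hT : LabelsAntitone T) {j : Fin n} {p : List Bool}
    (hp : T.sub p = some S) (hpar : ParentGe T (j + 1) p) :
    signature a T j p = topSig j S (a j) := by
  have h1 := psiColor_append_of_parentGe hT hp hpar []
  rw [List.append_nil, psiColor_nil] at h1
  rw [← runWeights_union_eq_topSig]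
  simp only [signature, hp, h1, empty_union, card_empty, Nat.sub_zero]

theorem IsZeta.eq_or {T : MTree n} {s : Fin n} {k : ℕ} {x y : List Bool} (h : IsZeta a T s k x y) :
    (k = s ∧ IsGreatest {z | IsLeading T s z ∧ z < x} y) ∨
    ∃ j : Fin n, k = j ∧ j < s ∧ ∃ x' y', IsLeading T (j + 1) x' ∧ x' <+: x ∧
      IsZeta a T s (j + 1) x' y' ∧ IsLeast {z | IsLeading T j z ∧ y' <+: z ∧
        toColex (signature a T j x) ≤ toColex (signature a T j z)} y := by
  cases h with
  | base _ _ hx hy => exact Or.inl ⟨rfl, hy⟩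
  | step j hj _ x' y' _ hx hx' hxx' hz hy =>
    exact Or.inr ⟨j, rfl, hj, x', y', hx', hxx', hz, hy⟩

theorem IsLeading.eq_of_prefix {T : MTree n} (hT : LabelsAntitone T) {k : ℕ} {p q : List Bool}
    (hp : IsLeading T k p) (hq : IsLeading T k q) (hpq : p <+: q) : p = q := by
  obtain ⟨z, rfl⟩ := hpq
  rw [hp.eq_of_append hT hq, List.append_nil]

theorem IsZeta.unique {T : MTree n} (hT : LabelsAntitone T) {s : Fin n} {k : ℕ}
    {x y y₂ : List Bool} (h : IsZeta a T s k x y) (h₂ : IsZeta a T s k x y₂) : y = y₂ := by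
  induction h generalizing y₂ with
  | base x y hx hy =>
    rcases h₂.eq_or with ⟨-, h⟩ | ⟨j, hj, hj', -⟩
    · exact hy.unique h
    · exact absurd hj (Fin.lt_def.1 hj').ne'
  | step j hj x x' y' y hx hx' hxx' hz hy ih =>
    rcases h₂.eq_or with ⟨h, -⟩ | ⟨j₂, h1, -, x₂, y₂', h2, h3, h4, h5⟩
    · exact absurd h (Fin.lt_def.1 hj).ne
    · obtain rfl : j = j₂ := Fin.ext h1
      have hxx : x' = x₂ := by
        rcases List.prefix_or_prefix_of_prefix hxx' h3 with h | h
        · exact hx'.eq_of_prefix hT h2 h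
        · exact (h2.eq_of_prefix hT hx' h).symm
      subst hxx
      obtain rfl := ih h4
      exact hy.unique h5

theorem exists_hang_prefix {j : Fin n} {S V : MTree n} (hb : Below (j + 1) S) {z : List Bool}
    (hz : S.sub z = some V) (hV : ∀ t l r, V = .node t l r → t < j) :
    ∃ q, Hang j S q ∧ q <+: z := by
  induction z generalizing S with
  | nil =>
    rw [sub_nil] at hz
    cases hz
    exact ⟨[], hang_nil.2 hV, List.nil_prefix⟩
  | cons b z ih =>
    rcases hang_nil_or hb with h | ⟨l, r, rfl⟩
    · exact ⟨[], h, List.nil_prefix⟩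
    · cases b with
      | false =>
        obtain ⟨q, h1, h2⟩ := ih hb.2.1 hz
        exact ⟨false :: q, ⟨rfl, h1⟩, (List.prefix_cons_inj false).2 h2⟩
      | true =>
        obtain ⟨q, h1, h2⟩ := ih hb.2.2 hz
        exact ⟨true :: q, ⟨rfl, h1⟩, (List.prefix_cons_inj true).2 h2⟩

theorem zero_notMem_of_mem {S : MTree n} (h : Good a S m) {k : ℕ} {B : Fin n → Finset ℕ}
    (hM : Mem k S B) {i : Fin n} (hi : (i : ℕ) < k) : 0 ∉ B i := fun h0 => by
  have := (mem_Icc.1 (h.subset_of_mem hM hi h0)).1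
  omega

/-- If `ζ` maps `x` to `y` at level `j + 1`, and the `j`-signature of `x` is at most that of `y`,
then `ζ` is defined at level `j` below `x`: it maps a vertex to the one below `y` to which the
signature of the former is sent. -/
theorem exists_isZeta_append {T X Y : MTree n} (hT : LabelsAntitone T) {s j : Fin n} (hj : j < s)
    {x y : List Bool} {mx my : Fin n → ℕ} (hx : IsLeading T (j + 1) x)
    (hy : IsLeading T (j + 1) y) (hX : T.sub x = some X) (hY : T.sub y = some Y)
    (hGX : Good a X mx) (hGY : Good a Y my) (hmx : mx j = a j) (hmy : my j = a j)
    (hz : IsZeta a T s (j + 1) x y) (htop : toColex (topSig j X (a j)) ≤ toColex (topSig j Y (a j)))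
    {q : List Bool} (hq : Hang j X q) :
    ∃ q' Y', Hang j Y q' ∧ Y.sub q' = some Y' ∧ IsLeading T j (x ++ q) ∧ IsLeading T j (y ++ q') ∧
      IsZeta a T s j (x ++ q) (y ++ q') ∧
      ∀ B : Fin n → Finset ℕ, B j = localSig j X (a j) q → (Mem (j + 1) Y B ↔ Mem j Y' B) := by
  have hbX := hx.below hX hGX
  have hbY := hy.below hY hGY
  have hpx := ParentGe.mono (Nat.le_succ (j : ℕ)) hx.2
  have hpy := ParentGe.mono (Nat.le_succ (j : ℕ)) hy.2
  have hcard : #(localSig j X (a j) q) = my j := by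
    rw [hmy, ← hmx]
    exact hGX.card_localSig hq
  have h0 : 0 ∉ localSig j X (a j) q := fun h0 => by
    have := (mem_Icc.1 (hGX.localSig_subset _ hq h0)).1
    omega
  have hle := hGX.localSig_le_topSig hbX (a j) hq
  obtain ⟨q', Y', ⟨⟨h1, h2⟩, h3⟩, h4, h5⟩ := hGY.exists_isLeast_hang hbY hcard h0
    (by rw [hmy]; exact hle.trans htop)
  rw [hmy] at h2 h3
  have hlx := (isLeading_append_iff hX hpx hGX hbX).2 hq
  have hly := (isLeading_append_iff hY hpy hGY hbY).2 h1
  refine ⟨q', Y', h1, h4, hlx, hly, ?_, h5⟩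
  refine IsZeta.step j hj _ x y _ hlx hx (List.prefix_append _ _) hz
    ⟨⟨hly, List.prefix_append _ _, ?_⟩, ?_⟩
  · rw [signature_append hT hX hx.2 hGX hq, signature_append hT hY hy.2 hGY h1]
    exact h2
  · rintro _ ⟨hz1, ⟨w, rfl⟩, hz3⟩
    have hw := (isLeading_append_iff hY hpy hGY hbY).1 hz1
    rw [signature_append hT hX hx.2 hGX hq, signature_append hT hY hy.2 hGY hw] at hz3
    exact (append_le_append_same _ _ _).2 (h3 ⟨hw, hz3⟩)

/-- If `ζ` maps `x` to `y`, then the conditions imposed by compatibility on the descendants of `x`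
amount to the family below `x` being contained in the family below `y`.  In the induction step, the
condition on `x` itself says that the last set of the largest colour that occurs below `x` also
occurs below `y`, and the families are compared separately below each vertex `x ++ q` of the next
level: its members may be moved up to its signature `localSig`, and from there to `ζ` of it. -/
theorem compatible_below_iff {T : MTree n} (hT : LabelsAntitone T) {s : Fin n} {k : ℕ} (hk : k ≤ s)
    {x y : List Bool} {X Y : MTree n} {mx my : Fin n → ℕ} (hx : IsLeading T k x)
    (hy : IsLeading T k y) (hX : T.sub x = some X) (hY : T.sub y = some Y)
    (hGX : Good a X mx) (hGY : Good a Y my) (hmx : ∀ i : Fin n, (i : ℕ) < k → mx i = a i)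
    (hmy : ∀ i : Fin n, (i : ℕ) < k → my i = a i) (hz : IsZeta a T s k x y) :
    (∀ c : Fin n, (c : ℕ) + 1 ≤ k → ∀ x₁, IsLeading T (c + 1) x₁ → x <+: x₁ →
      ∃ y₁, IsZeta a T s (c + 1) x₁ y₁ ∧
        toColex (signature a T c x₁) ≤ toColex (signature a T c y₁)) ↔
    ∀ B : Fin n → Finset ℕ, (∀ i : Fin n, (i : ℕ) < k → #(B i) = a i) → Mem k X B → Mem k Y B := by
  induction k generalizing x y X Y mx my with
  | zero =>
    refine iff_of_true (fun c hc => absurd hc (Nat.not_succ_le_zero _)) fun B _ _ => ?_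
    have hb := hy.below hY hGY
    cases Y with
    | leaf x => exact fun i hi => absurd hi (Nat.not_lt_zero _)
    | node t l r => exact absurd hb.1 (Nat.not_lt_zero _)
  | succ k ih =>
    obtain ⟨j, rfl⟩ : ∃ j : Fin n, (j : ℕ) = k := ⟨⟨k, by omega⟩, rfl⟩
    have hjs : j < s := Fin.lt_def.2 hk
    have hjj := Nat.lt_succ_self (j : ℕ)
    have hbX := hx.below hX hGX
    have hbY := hy.below hY hGY
    have hmxj := hmx j hjj
    have hmyj := hmy j hjj
    have hupd : ∀ (B : Fin n → Finset ℕ) (A : Finset ℕ) (i : Fin n), (i : ℕ) < j →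
        Function.update B j A i = B i := fun B A i hi => Function.update_of_ne (Fin.ne_of_lt hi) _ _
    constructor
    · intro H B hB hM
      have htop : toColex (topSig j X (a j)) ≤ toColex (topSig j Y (a j)) := by
        obtain ⟨y₁, h1, h2⟩ := H j le_rfl x hx (List.prefix_refl x)
        obtain rfl := hz.unique hT h1
        rwa [signature_eq_topSig hT hX hx.2, signature_eq_topSig hT hY hy.2] at h2
      obtain ⟨q, X', h1, h2, h3, h4⟩ := hGX.exists_hang_of_mem hbX (by rw [hB j hjj, hmxj]) hM
      obtain ⟨q', Y', h5, h6, h7, h8, h9, h10⟩ :=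
        exists_isZeta_append hT hjs hx hy hX hY hGX hGY hmxj hmyj hz htop h1
      obtain ⟨X₂, mx', e1, hbX', hGX', hmx'⟩ := hGX.exists_sub_of_hang h1
      rw [h2] at e1
      cases e1
      obtain ⟨Y₂, my', e2, hbY', hGY', hmy'⟩ := hGY.exists_sub_of_hang h5
      rw [h6] at e2
      cases e2
      have h11 := (ih (Nat.le_of_succ_le hk) h7 h8 (by rw [sub_append hX, h2])
        (by rw [sub_append hY, h6]) hGX' hGY'
        (fun i hi => by rw [hmx' i (Fin.ne_of_lt hi), hmx i (hi.trans hjj)])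
        (fun i hi => by rw [hmy' i (Fin.ne_of_lt hi), hmy i (hi.trans hjj)]) h9).1
        (fun c hc x₁ hx₁ hxx₁ => H c (hc.trans hjj.le) x₁ hx₁ ((List.prefix_append _ _).trans hxx₁))
        B (fun i hi => hB i (hi.trans hjj)) h4
      have h12 : Mem (j + 1) Y (Function.update B j (localSig j X (a j) q)) := by
        rw [h10 _ (Function.update_self ..)]
        exact (mem_congr hbY' fun i hi => hupd B _ i hi).2 h11
      have hBt : Typ (j + 1) my B := fun i hi =>
        ⟨by rw [hB i hi, hmy i hi], zero_notMem_of_mem hGX hM hi⟩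
      have hA : #(localSig j X (a j) q) = a j := by
        have := hGX.card_localSig h1
        rwa [hmxj] at this
      refine hGY.down hbY (hBt.update (by rw [hA, hmyj]) fun h0 => ?_) hBt (fun i hi => ?_) h12
      · have := (mem_Icc.1 (hGX.localSig_subset _ h1 h0)).1
        omega
      · by_cases hij : i = j
        · subst hij
          rw [Function.update_self, ← hmxj]
          exact h3
        · rw [Function.update_of_ne hij]
    · intro H
      have hcontain : ∀ q X', Hang j X q → X.sub q = some X' → ∀ B : Fin n → Finset ℕ,
          (∀ i : Fin n, (i : ℕ) < j → #(B i) = a i) → Mem j X' B →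
          Mem (j + 1) Y (Function.update B j (localSig j X (a j) q)) := by
        intro q X' hq hX' B hB hM
        obtain ⟨X₂, mx', e1, hbX', hGX', hmx'⟩ := hGX.exists_sub_of_hang hq
        rw [hX'] at e1
        cases e1
        refine H _ (fun i hi => ?_) ?_
        · by_cases hij : i = j
          · subst hij
            rw [Function.update_self, ← hmxj]
            exact hGX.card_localSig hq
          · rw [Function.update_of_ne hij]
            refine hB i ?_
            have : (i : ℕ) ≠ j := fun h => hij (Fin.ext h)
            omega
        · rw [hGX.mem_localSig_iff hbX hq hX' (Function.update_self ..)]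
          exact (mem_congr hbX' fun i hi => hupd B _ i hi).2 hM
      have htop : toColex (topSig j X (a j)) ≤ toColex (topSig j Y (a j)) := by
        obtain ⟨q, hq, hq'⟩ := exists_hang_localSig_eq hbX (a j)
        obtain ⟨X', mx', hX', hbX', hGX', hmx'⟩ := hGX.exists_sub_of_hang hq
        obtain ⟨B, hB, hM, -⟩ := hGX'.exists_mem j
        have h1 := hcontain q X' hq hX' B (fun i hi => by
          rw [(hB i i.2).1, hmx' i (Fin.ne_of_lt hi), hmx i (hi.trans hjj)])
          ((hGX'.mem_iff j.2.le hbX').1 hM).1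
        have hA : #(localSig j X (a j) q) = my j := by
          rw [hmyj, ← hmxj]
          exact hGX.card_localSig hq
        obtain ⟨q', Y', h2, -, h3, -⟩ := hGY.exists_hang_of_mem hbY
          (by rw [Function.update_self, hA]) h1
        rw [Function.update_self, hmyj, hq'] at h3
        exact h3.trans (hGY.localSig_le_topSig hbY _ h2)
      intro c hc x₁ hx₁ hxx₁
      rcases hc.eq_or_lt with hc | hc
      · obtain rfl : c = j := Fin.ext (by omega)
        obtain rfl := hx.eq_of_prefix hT hx₁ hxx₁
        refine ⟨y, hz, ?_⟩
        rwa [signature_eq_topSig hT hX hx.2, signature_eq_topSig hT hY hy.2]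
      · obtain ⟨z, rfl⟩ := hxx₁
        obtain ⟨⟨V, hV, hV'⟩, -⟩ := id hx₁
        rw [sub_append hX] at hV
        obtain ⟨q, hq, hqz⟩ := exists_hang_prefix hbX hV fun t l r h =>
          Fin.lt_def.2 ((hV' t l r h).trans_le (Nat.lt_succ_iff.1 hc))
        obtain ⟨q', Y', h5, h6, h7, h8, h9, h10⟩ :=
          exists_isZeta_append hT hjs hx hy hX hY hGX hGY hmxj hmyj hz htop hq
        obtain ⟨X', mx', hX', hbX', hGX', hmx'⟩ := hGX.exists_sub_of_hang hq
        obtain ⟨Y₂, my', e2, hbY', hGY', hmy'⟩ := hGY.exists_sub_of_hang h5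
        rw [h6] at e2
        cases e2
        refine (ih (Nat.le_of_succ_le hk) h7 h8 (by rw [sub_append hX, hX'])
          (by rw [sub_append hY, h6]) hGX' hGY'
          (fun i hi => by rw [hmx' i (Fin.ne_of_lt hi), hmx i (hi.trans hjj)])
          (fun i hi => by rw [hmy' i (Fin.ne_of_lt hi), hmy i (hi.trans hjj)]) h9).2
          (fun B hB hM => ?_) c (Nat.lt_succ_iff.1 hc) (x ++ z) hx₁
          ((List.prefix_append_right_inj x).2 hqz)
        have h1 := hcontain q X' hq hX' B hB hM
        rw [h10 _ (Function.update_self ..)] at h1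
        exact (mem_congr hbY' fun i hi => hupd B _ i hi).1 h1

/-! ### Consecutive leading vertices -/

/-- The address of the vertex at the top of `leftEnd t`. -/
def leftAddr (t : Fin n) : MTree n → List Bool
  | .leaf _ => []
  | .node s l _ => if s = t then false :: leftAddr t l else []

/-- The address of the vertex at the top of `runEnd t`. -/
def runAddr (t : Fin n) : MTree n → List Bool
  | .leaf _ => []
  | .node s _ r => if s = t then true :: runAddr t r else []

theorem sub_leftAddr (t : Fin n) (S : MTree n) : S.sub (leftAddr t S) = some (leftEnd t S) := by
  induction S with
  | leaf x => rfl
  | node s l r ihl ihr =>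
    rw [leftAddr, leftEnd]
    split_ifs
    · exact ihl
    · rfl

theorem sub_runAddr (t : Fin n) (S : MTree n) : S.sub (runAddr t S) = some (runEnd t S) := by
  induction S with
  | leaf x => rfl
  | node s l r ihl ihr =>
    rw [runAddr, runEnd]
    split_ifs
    · exact ihr
    · rfl

theorem hang_leftAddr {t : Fin n} {S : MTree n} (hb : Below (t + 1) S) :
    Hang t S (leftAddr t S) := by
  induction S with
  | leaf x => trivial
  | node s l r ihl ihr =>
    rw [leftAddr]
    split_ifs with h
    · exact ⟨h, ihl hb.2.1⟩
    · exact lt_of_le_of_ne (Fin.le_def.2 (Nat.lt_succ_iff.1 hb.1)) h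

theorem hang_runAddr {t : Fin n} {S : MTree n} (hb : Below (t + 1) S) :
    Hang t S (runAddr t S) := by
  induction S with
  | leaf x => trivial
  | node s l r ihl ihr =>
    rw [runAddr]
    split_ifs with h
    · exact ⟨h, ihr hb.2.2⟩
    · exact lt_of_le_of_ne (Fin.le_def.2 (Nat.lt_succ_iff.1 hb.1)) h

theorem leftAddr_le_of_hang {t : Fin n} {S : MTree n} {z : List Bool} (hz : Hang t S z) :
    leftAddr t S ≤ z := by
  induction z generalizing S with
  | nil =>
    cases S with
    | leaf x => exact le_rfl
    | node s l r => rw [leftAddr, if_neg (Fin.ne_of_lt hz)]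
  | cons b z ih =>
    cases S with
    | leaf x => exact absurd hz id
    | node s l r =>
      cases b with
      | false =>
        rw [leftAddr, if_pos hz.1, cons_le_cons_same]
        exact ih hz.2
      | true =>
        rw [leftAddr, if_pos hz.1]
        exact (false_cons_lt_true_cons _ _).le

theorem le_runAddr_of_hang {t : Fin n} {S : MTree n} {z : List Bool} (hz : Hang t S z) :
    z ≤ runAddr t S := by
  induction z generalizing S with
  | nil =>
    cases S with
    | leaf x => exact le_rfl
    | node s l r => rw [runAddr, if_neg (Fin.ne_of_lt hz)]
  | cons b z ih =>
    cases S with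
    | leaf x => exact absurd hz id
    | node s l r =>
      cases b with
      | false =>
        rw [runAddr, if_pos hz.1]
        exact (false_cons_lt_true_cons _ _).le
      | true =>
        rw [runAddr, if_pos hz.1, cons_le_cons_same]
        exact ih hz.2

theorem append_lt_append_same (p q r : List Bool) : p ++ q < p ++ r ↔ q < r := by
  rw [← not_le, append_le_append_same, not_le]

theorem prefix_or_lt (p z : List Bool) :
    p <+: z ∨ z <+: p ∨ (∀ u, z < p ++ u) ∨ ∀ u, p ++ u < z := by
  induction p generalizing z with
  | nil => exact Or.inl List.nil_prefix
  | cons b p ih =>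
    cases z with
    | nil => exact Or.inr (Or.inl List.nil_prefix)
    | cons c z =>
      by_cases hbc : b = c
      · subst hbc
        rw [List.prefix_cons_inj, List.prefix_cons_inj]
        simp only [List.cons_append, List.cons_lt_cons_self]
        exact ih z
      · refine Or.inr (Or.inr ?_)
        cases b <;> cases c
        · exact absurd rfl hbc
        · exact Or.inr fun u => false_cons_lt_true_cons _ _
        · exact Or.inl fun u => false_cons_lt_true_cons _ _
        · exact absurd rfl hbc

/-- At a vertex `p` labeled `t`, the first `t`-leading vertex on the right is immediately preceded
by the last `t`-leading vertex on the left. -/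
theorem isZeta_of_node {T l r : MTree n} (hT : LabelsAntitone T) {p : List Bool} {t : Fin n}
    (hp : T.sub p = some (.node t l r)) {ml mr : Fin n → ℕ} (hl : Good a l ml) (hr : Good a r mr)
    (hbl : Below (t + 1) l) (hbr : Below (t + 1) r) :
    IsLeading T t (p ++ true :: leftAddr t r) ∧ IsLeading T t (p ++ false :: runAddr t l) ∧
      IsZeta a T t t (p ++ true :: leftAddr t r) (p ++ false :: runAddr t l) := by
  have hpl := sub_child hp false
  have hpr := sub_child hp true
  simp only [Bool.false_eq_true, if_false, if_true] at hpl hpr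
  have hleadl : ∀ z, IsLeading T t (p ++ false :: z) ↔ Hang t l z := fun z => by
    rw [List.append_cons]
    exact isLeading_append_iff hpl (parentGe_concat hp le_rfl false) hl hbl
  have hleadr : ∀ z, IsLeading T t (p ++ true :: z) ↔ Hang t r z := fun z => by
    rw [List.append_cons]
    exact isLeading_append_iff hpr (parentGe_concat hp le_rfl true) hr hbr
  have h1 := (hleadr _).2 (hang_leftAddr hbr)
  have h2 := (hleadl _).2 (hang_runAddr hbl)
  refine ⟨h1, h2, IsZeta.base _ _ h1 ⟨⟨h2, ?_⟩, ?_⟩⟩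
  · exact (append_lt_append_same _ _ _).2 (false_cons_lt_true_cons _ _)
  · rintro z ⟨hz, hlt⟩
    have hanc : ∀ w, p ≠ z ++ w := by
      rintro w rfl
      obtain ⟨⟨S, hS, hS'⟩, -⟩ := hz
      rw [sub_append hS] at hp
      cases S with
      | leaf x => cases w <;> simp [sub_leaf_cons, sub_nil] at hp
      | node t' l' r' =>
        have h3 := hS' t' l' r' rfl
        have h4 := hT z w t' l' r' t l r hS (by rw [sub_append hS]; exact hp)
        exact absurd h3 (not_lt.2 (Fin.le_def.1 h4))
    rcases prefix_or_lt p z with ⟨w, rfl⟩ | ⟨w, hw⟩ | h | h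
    · cases w with
      | nil => exact absurd (by simp) (hanc [])
      | cons b w =>
        cases b with
        | false =>
          rw [append_le_append_same, cons_le_cons_same]
          exact le_runAddr_of_hang ((hleadl w).1 hz)
        | true =>
          rw [append_lt_append_same, List.cons_lt_cons_self] at hlt
          exact absurd (leftAddr_le_of_hang ((hleadr w).1 hz)) (not_le.2 hlt)
    · exact absurd hw.symm (hanc w)
    · exact (h _).le
    · exact absurd hlt (lt_asymm (h _))

/-- The conditions imposed by compatibility on the descendants of the first `t`-leading vertex on
the right of a vertex labeled `t` amount to the containment condition of a good tree. -/
theorem compatible_node_iff {T l r : MTree n} (hT : LabelsAntitone T) {p : List Bool} {t : Fin n}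
    (hp : T.sub p = some (.node t l r)) {ml mr : Fin n → ℕ} (hl : Good a l ml) (hr : Good a r mr)
    (hbl : Below (t + 1) l) (hbr : Below (t + 1) r) (hml : ∀ i < t, ml i = a i)
    (hmr : ∀ i < t, mr i = a i) :
    (∀ c : Fin n, c < t → ∀ x, IsLeading T (c + 1) x → p ++ true :: leftAddr t r <+: x →
      ∃ y, IsZeta a T t (c + 1) x y ∧
        toColex (signature a T c x) ≤ toColex (signature a T c y)) ↔
    ∀ B : Fin n → Finset ℕ, (∀ i < t, #(B i) = a i) →
      Mem t (leftEnd t r) B → Mem t (runEnd t l) B := by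
  obtain ⟨h1, h2, h3⟩ := isZeta_of_node hT hp hl hr hbl hbr
  obtain ⟨X, mx, hX, -, hGX, hmx⟩ := hr.exists_sub_of_hang (hang_leftAddr hbr)
  obtain ⟨Y, my, hY, -, hGY, hmy⟩ := hl.exists_sub_of_hang (hang_runAddr hbl)
  rw [sub_leftAddr] at hX
  rw [sub_runAddr] at hY
  cases hX
  cases hY
  exact compatible_below_iff hT le_rfl h1 h2
    (by rw [sub_append hp, sub_true, sub_leftAddr]) (by rw [sub_append hp, sub_false, sub_runAddr])
    hGX hGY (fun i hi => by rw [hmx i (Fin.ne_of_lt hi), hmr i hi])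
    (fun i hi => by rw [hmy i (Fin.ne_of_lt hi), hml i hi]) h3

theorem leftAddr_prefix {T V : MTree n} {s : Fin n} {x : List Bool} (hx : T.sub x = some V)
    (hV : ∀ l r, V ≠ .node s l r) {v : Fin n → ℤ} (hv : v s ≤ splitLabel T v x s) :
    leftAddr s T <+: x := by
  induction x generalizing T with
  | nil =>
    rw [sub_nil] at hx
    cases hx
    cases V with
    | leaf x => exact List.nil_prefix
    | node t l r =>
      rw [leftAddr, if_neg]
      rintro rfl
      exact hV l r rfl
  | cons b x ih =>
    cases T with
    | leaf x => exact List.nil_prefix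
    | node t l r =>
      rw [leftAddr]
      split_ifs with hts
      · subst hts
        cases b with
        | false => exact (List.prefix_cons_inj false).2 (ih hx hv)
        | true =>
          have h1 := hv.trans (splitLabel_le r (v - Pi.single t 1) x t)
          simp at h1
      · exact List.nil_prefix

/-- A vertex at which the entry of `ν` in the colour `s` has dropped descends from the first
`s`-leading vertex on the right of some vertex labeled `s`. -/
theorem exists_node_prefix {T V : MTree n} {s : Fin n} {x : List Bool} (hx : T.sub x = some V)
    (hV : ∀ l r, V ≠ .node s l r) {v : Fin n → ℤ} (hv : splitLabel T v x s < v s) :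
    ∃ p l r, T.sub p = some (.node s l r) ∧ p ++ true :: leftAddr s r <+: x := by
  induction x generalizing T v with
  | nil => exact absurd hv (by rw [splitLabel_nil]; exact lt_irrefl _)
  | cons b x ih =>
    cases T with
    | leaf y => exact absurd hv (lt_irrefl _)
    | node t l r =>
      cases b with
      | false =>
        obtain ⟨p, l', r', h1, h2⟩ := ih hx hv
        exact ⟨false :: p, l', r', h1, (List.prefix_cons_inj false).2 h2⟩
      | true =>
        by_cases hdrop : splitLabel r (v - Pi.single t 1) x s < (v - Pi.single t 1 : Fin n → ℤ) s
        · obtain ⟨p, l', r', h1, h2⟩ := ih hx hdrop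
          exact ⟨true :: p, l', r', h1, (List.prefix_cons_inj true).2 h2⟩
        · by_cases hts : t = s
          · subst hts
            exact ⟨[], l, r, sub_nil _,
              (List.prefix_cons_inj true).2 (leftAddr_prefix hx hV (not_lt.1 hdrop))⟩
          · have h1 : (v - Pi.single t 1 : Fin n → ℤ) s = v s := by
              simp [Pi.single_eq_of_ne (Ne.symm hts)]
            rw [h1] at hdrop
            exact absurd hv hdrop

theorem Good.isCompatible {T : MTree n} (h : Good a T a) : IsCompatible a T := by
  intro c s hcs x hx hpos
  obtain ⟨⟨V, hV, hV'⟩, -⟩ := id hx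
  obtain ⟨p, l, r, hp, hpx⟩ := exists_node_prefix (s := s) hV
    (fun l r hVs => by
      have := hV' s l r hVs
      have := Fin.lt_def.1 hcs
      omega) (v := fun i => (a i : ℤ)) (by rw [nu] at hpos; omega)
  obtain ⟨m', hS, -⟩ := h.sub hp
  obtain ⟨-, hma, hbl, hbr, -, -, -, -, -, hl, hr, hcont⟩ := hS
  exact (compatible_node_iff h.antitone hp hl hr hbl hbr hma
    fun i hi => by rw [sub_single_of_ne hi.ne, hma i hi]).2 hcont c hcs x hx hpx

theorem good_of_isGenMacaulayRep {T : MTree n} (h : IsGenMacaulayRep a N T) : Good a T a := by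
  refine good_of_isMacaulayTree h.macaulay h.condensed h.compressedLike
    fun p t l r m hp hm hmt hma hbl hbr hl hr => ?_
  refine (compatible_node_iff h.macaulay.antitone hp hl hr hbl hbr hma
    fun i hi => by rw [sub_single_of_ne hi.ne, hma i hi]).1 fun c hc x hx hpx => ?_
  refine h.compatible c t hc x hx ?_
  obtain ⟨w, rfl⟩ := hpx
  have hpr := sub_child hp true
  have h1 : nu a T (p ++ true :: leftAddr t r ++ w) t ≤ nu a T (p ++ [true]) t := by
    rw [List.append_assoc, List.cons_append, List.append_cons, nu, splitLabel_append hpr]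
    exact splitLabel_le _ _ _ _
  have h2 : nu a T p t ≤ a t := splitLabel_le _ _ _ _
  rw [nu_child_true hp] at h1
  simp only [Pi.sub_apply, Pi.single_eq_same] at h1
  omega

end

end GenMac

theorem mainTheorem6 {n : ℕ} (hn : 0 < n) (a : Fin n → ℕ) (ha : ∀ i, 0 < a i)
    (N : ℕ) (hN : 0 < N) :
    (∀ T : GenMac.MTree n, GenMac.IsMacaulayTree a N T →
      ((∃ K : GenMac.OrderedColoredComplex.{u} n,
          GenMac.IsPureCompressedBalanced a N K ∧ K.inducedTree a = T) ↔
        GenMac.IsCondensed T ∧ GenMac.IsCompressedLike T ∧ GenMac.IsCompatible a T)) ∧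
    (∃ f : Quotient (GenMac.isoSetoid.{u} a N) → GenMac.GenMacaulayRep a N,
      Function.Bijective f ∧
        ∀ K : GenMac.CompressedComplex.{u} a N,
          (f (Quotient.mk (GenMac.isoSetoid a N) K)).1 = K.1.inducedTree a) ∧
    (∀ K K' : GenMac.CompressedComplex.{u} a N,
      GenMac.OrderedColoredComplex.Isomorphic K.1 K'.1 →
        GenMac.OrderedColoredComplex.OrderIsomorphic K.1 K'.1) := by
  have hrep : ∀ K : GenMac.CompressedComplex.{u} a N,
      GenMac.IsGenMacaulayRep a N (K.1.inducedTree a) := by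
    intro K
    obtain ⟨hT, -, -, hsum⟩ := K.2.good_inducedTree
    have hM := hT.isMacaulayTree hn ha
    rw [← hsum] at hM
    exact ⟨hM, hT.isCondensed, hT.isCompressedLike ha, hT.isCompatible⟩
  have hex : ∀ T : GenMac.MTree n, GenMac.IsGenMacaulayRep a N T →
      ∃ K : GenMac.OrderedColoredComplex.{u} n,
        GenMac.IsPureCompressedBalanced a N K ∧ K.inducedTree a = T := by
    intro T hT
    have h := (GenMac.good_of_isGenMacaulayRep hT).exists_complex.{u} hn ha
    rwa [← hT.macaulay.sum_eq] at h
  refine ⟨fun T hT => ⟨?_, fun ⟨h1, h2, h3⟩ => hex T ⟨hT, h1, h2, h3⟩⟩, ?_, fun K K' h =>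
    GenMac.orderIsomorphic_of_isomorphic K.2.compressed K'.2.compressed h⟩
  · rintro ⟨K, hK, rfl⟩
    have h := hrep ⟨K, hK⟩
    exact ⟨h.condensed, h.compressedLike, h.compatible⟩
  · refine ⟨Quotient.lift (fun K => ⟨K.1.inducedTree a, hrep K⟩) fun K K' h =>
      Subtype.ext (GenMac.inducedTree_eq_of_isomorphic ha K.2 K'.2 h), ⟨?_, ?_⟩, fun K => rfl⟩
    · rintro ⟨K⟩ ⟨K'⟩ h
      exact Quotient.sound
        (GenMac.isomorphic_of_inducedTree_eq K.2 K'.2 (congrArg Subtype.val h))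
    · rintro ⟨T, hT⟩
      obtain ⟨K, hK, rfl⟩ := hex T hT
      exact ⟨Quotient.mk _ ⟨K, hK⟩, rfl⟩
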